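/- Throughout, $I=(0,1]$, Landau's $O$ and all limits of nets indexed by $I$ are for $\varepsilon\to0^+$, locally convex spaces are complex and Hausdorff, $L(E,F)$ denotes the continuous linear maps, $L_b$ and $L_\sigma$ refer to the topologies of bounded and of pointwise convergence, $\operatorname{csn}$ denotes the set of continuous seminorms, and $V\Subset U$ means that $V,U$ are open and $\overline V$ is compact and contained in $U$. **Scales.** A set $\mathcal A\subseteq[0,\infty)^I$ is an asymptotic growth scale if for all $\lambda,\mu\in\mathcal A$ there are $\nu,\nu'\in\mathcal A$ with $\lambda_\varepsilon+\mu_\varepsilon=O(\nu_\varepsilon)$ and $\lambda_\varepsilon\mu_\varepsilon=O(\nu'_\varepsilon)$, and some $\lambda\in\mathcal A$ has $\liminf\lambda_\varepsilon>0$. A set $\mathcal I\subseteq[0,\infty)^I$ is an asymptotic decay scale if for every $\lambda\in\mathcal I$ there are $\mu,\nu\in\mathcal I$ with $\mu_\varepsilon+\nu_\varepsilon=O(\lambda_\varepsilon)$ and $\mu',\nu'\in\mathcal I$ with $\mu'_\varepsilon\nu'_\varepsilon=O(\lambda_\varepsilon)$, and some $\lambda\in\mathcal I$ tends to $0$. The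 pair $\mathcal S=(\mathcal A,\mathcal I)$ is admissible if, moreover, for all $\lambda\in\mathcal I$, $\mu\in\mathcal A$ there is $\nu\in\mathcal I$ with $\mu_\varepsilon\nu_\varepsilon=O(\lambda_\varepsilon)$, and there are $\lambda\in\mathcal A$, $\mu\in\mathcal I$ with $\mu_\varepsilon=O(\lambda_\varepsilon)$. **Sheaves.** Let $X$ be a Hausdorff, locally compact, paracompact topological space. A presheaf of vector spaces with restriction maps $\rho_{V,U}$ is a sheaf if for every open $U\subseteq X$ and every open covering $(U_i)_i$ of $U$: (S1) if $\rho_{U_i,U}(u)=0$ for all $i$ then $u=0$; (S2) if $u_i$ are sections over $U_i$ with $\rho_{U_i\cap U_j,U_i}(u_i)=\rho_{U_i\cap U_j,U_j}(u_j)$ for all $i,j$, then there is a section $u$ over $U$ with $\rho_{U_i,U}(u)=u_i$ for all $i$. A locally convex sheaf is a sheaf of locally convex spaces with continuous linear restriction maps such that, for every open covering $(U_i)_i$ of an open $U$, the topology of $E(U)$ is the projective topology with respect to the maps $\rho_{U_i,U}$. A test pair of sheaves $(E,F)$ consists of locally convex sheaves $E,F$ on $X$ such that $F$ is a subsheaf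 of $E$, the topology of $F(U)$ is finer than the one induced by $E(U)$ for every open $U$, and for every open $U$ and every open covering $(U_i)_i$ of $U$ there are sheaf endomorphisms $\eta^i$ of $E|_U$ (families of continuous linear maps commuting with restrictions), each restricting to a sheaf endomorphism of the locally convex sheaf $F|_U$, whose supports form a locally finite family in $U$, with $\operatorname{supp}\eta^i\subseteq U_i$ and $\sum_i\eta^i=\mathrm{id}$. **Test objects.** Put $\mathrm{RO}(U)=L(E(U),F(U))$. Let $\mathrm{TO}(U)$ be the set of all $(\Phi_\varepsilon)\in\mathrm{RO}(U)^I$ such that for all $p\in\operatorname{csn}(L_\sigma(E(U),F(U)))$ there is $\lambda\in\mathcal A$ with $p(\Phi_\varepsilon)=O(\lambda_\varepsilon)$; for all $p\in\operatorname{csn}(L_\sigma(F(U),F(U)))$ and $\lambda\in\mathcal I$, $p(\Phi_\varepsilon|_{F(U)}-\mathrm{id})=O(\lambda_\varepsilon)$; and $\Phi_\varepsilon\to\mathrm{id}$ in $L_\sigma(E(U),E(U))$. Let $\mathrm{TO}^0(U)$ be defined in the same way with $\mathrm{id}$ replaced by $0$ in the last two conditions. A net $(\Phi_\varepsilon)\in\mathrm{RO}(U)^I$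 is localizing if for all $V\Subset V_0\Subset U$ there is $\varepsilon_0\in I$ such that for all $\varepsilon<\varepsilon_0$ and $u\in E(U)$, $\rho_{V_0,U}(u)=0$ implies $\rho_{V,U}(\Phi_\varepsilon(u))=0$. Let $\mathrm{TO}_{\mathrm{loc}}(U)$ and $\mathrm{TO}^0_{\mathrm{loc}}(U)$ be the sets of localizing elements of $\mathrm{TO}(U)$ and $\mathrm{TO}^0(U)$. **The quotient.** Let $\mathcal E_{\mathrm{loc}}(U)$ be the vector space of all maps $R\colon L_b(E(U),F(U))\to F(U)$ that are smooth in the sense of convenient calculus (they map smooth curves to smooth curves) and local: for all open $V\subseteq U$ and all $\Phi_1,\Phi_2\in\mathrm{RO}(U)$, $\rho_{V,U}\circ\Phi_1=\rho_{V,U}\circ\Phi_2$ implies $\rho_{V,U}(R(\Phi_1))=\rho_{V,U}(R(\Phi_2))$. Such an $R$ is moderate if for all $p\in\operatorname{csn}(F(U))$, $l\in\mathbb N$, $(\Phi_\varepsilon)\in\mathrm{TO}_{\mathrm{loc}}(U)$ and $(\Psi_{1,\varepsilon}),\dots,(\Psi_{l,\varepsilon})\in\mathrm{TO}^0_{\mathrm{loc}}(U)$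 there is $\lambda\in\mathcal A$ with $$p\big(\mathrm d^lR(\Phi_\varepsilon)(\Psi_{1,\varepsilon},\dots,\Psi_{l,\varepsilon})\big)=O(\lambda_\varepsilon),$$ and negligible if for all such $p,l,\Phi,\Psi_j$ this estimate holds for every $\lambda\in\mathcal I$. **Proposition.** Let $(E,F)$ be a test pair of sheaves on $X$ and $\mathcal S=(\mathcal A,\mathcal I)$ an admissible pair of scales such that $\mathrm{TO}_{\mathrm{loc}}(U)\neq\emptyset$ for every open $U\subseteq X$. Then: 1. the moderate elements of $\mathcal E_{\mathrm{loc}}(U)$ form a subspace $\mathcal E_{\mathcal M,\mathrm{loc}}(U)$, and the negligible ones a subspace $\mathcal E_{\mathcal N,\mathrm{loc}}(U)$ of it; put $\mathcal G_{\mathrm{loc}}(U)=\mathcal E_{\mathcal M,\mathrm{loc}}(U)/\mathcal E_{\mathcal N,\mathrm{loc}}(U)$; 2. for open $V\subseteq U$ there is a unique linear map $\rho^{\mathcal E}_{V,U}\colon\mathcal E_{\mathrm{loc}}(U)\to\mathcal E_{\mathrm{loc}}(V)$ such that, for all $R\in\mathcal E_{\mathrm{loc}}(U)$, $W\Subset V$,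 $\Phi\in\mathrm{RO}(V)$ and $\Phi'\in\mathrm{RO}(U)$ with $\rho_{W,V}\circ\Phi\circ\rho_{V,U}=\rho_{W,U}\circ\Phi'$, one has $\rho_{W,V}(\rho^{\mathcal E}_{V,U}(R)(\Phi))=\rho_{W,U}(R(\Phi'))$; 3. $\rho^{\mathcal G}_{V,U}([R])=[\rho^{\mathcal E}_{V,U}(R)]$ is well defined as a linear map $\mathcal G_{\mathrm{loc}}(U)\to\mathcal G_{\mathrm{loc}}(V)$, and with these restriction maps $U\mapsto\mathcal G_{\mathrm{loc}}(U)$ is a sheaf of vector spaces, that is, a presheaf satisfying (S1) and (S2). -/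

import Mathlib

open TopologicalSpace Filter Topology Asymptotics
open scoped NNReal ENNReal

universe u v w

namespace NonlinearExt

/-! ### Asymptotic scales -/

/-- The parameter interval `I = (0,1]`. -/
abbrev Eps : Type := Set.Ioc (0 : ℝ) 1

/-- The filter `ε → 0⁺` on `I = (0,1]`. -/
def epsZero : Filter Eps := comap Subtype.val (𝓝[>] (0 : ℝ))

/-- Landau's `f = O(g)` for `ε → 0⁺`, for nonnegative nets. -/
def BigO (f g : Eps → ℝ≥0) : Prop :=
  (fun ε => (f ε : ℝ)) =O[epsZero] (fun ε => (g ε : ℝ))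

structure IsGrowthScale (A : Set (Eps → ℝ≥0)) : Prop where
  add : ∀ l ∈ A, ∀ m ∈ A, ∃ n ∈ A, BigO (fun ε => l ε + m ε) n
  mul : ∀ l ∈ A, ∀ m ∈ A, ∃ n ∈ A, BigO (fun ε => l ε * m ε) n
  liminf_pos : ∃ l ∈ A, 0 < liminf (fun ε => (l ε : ℝ≥0∞)) epsZero

structure IsDecayScale (D : Set (Eps → ℝ≥0)) : Prop where
  add : ∀ l ∈ D, ∃ m ∈ D, ∃ n ∈ D, BigO (fun ε => m ε + n ε) l
  mul : ∀ l ∈ D, ∃ m ∈ D, ∃ n ∈ D, BigO (fun ε => m ε * n ε) l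
  tendsto_zero : ∃ l ∈ D, Tendsto l epsZero (𝓝 0)

/-- Admissible pairs of scales (growth scale `A`, decay scale `D`). -/
structure IsAdmissible (A D : Set (Eps → ℝ≥0)) : Prop where
  growth : IsGrowthScale A
  decay : IsDecayScale D
  mul : ∀ l ∈ D, ∀ m ∈ A, ∃ n ∈ D, BigO (fun ε => m ε * n ε) l
  compare : ∃ l ∈ A, ∃ m ∈ D, BigO m l

/-! ### Smooth maps between locally convex spaces (convenient calculus) -/

section Calculus

variable {E : Type v} {F : Type w}

/-- The curve `c` has derivative `y` at `t`: its difference quotients at `t` converge to `y`. -/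
def HasCurveDerivAt [AddCommGroup E] [Module ℝ E] [TopologicalSpace E]
    (c : ℝ → E) (y : E) (t : ℝ) : Prop :=
  Tendsto (slope c t) (𝓝[≠] t) (𝓝 y)

/-- The derivative of a curve (meaningful when the limit of the difference quotients exists). -/
noncomputable def curveDeriv [AddCommGroup E] [Module ℝ E] [TopologicalSpace E]
    (c : ℝ → E) (t : ℝ) : E :=
  limUnder (𝓝[≠] t) (slope c t)

/-- A curve is smooth if its derivatives of all orders exist. -/
def IsSmoothCurve [AddCommGroup E] [Module ℝ E] [TopologicalSpace E] (c : ℝ → E) : Prop :=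
  ∃ d : ℕ → ℝ → E, d 0 = c ∧ ∀ n t, HasCurveDerivAt (d n) (d (n + 1) t) t

/-- A map is smooth in the sense of convenient calculus if it maps smooth curves to smooth
curves. -/
def IsSmoothMap [AddCommGroup E] [Module ℝ E] [TopologicalSpace E]
    [AddCommGroup F] [Module ℝ F] [TopologicalSpace F] (f : E → F) : Prop :=
  ∀ c : ℝ → E, IsSmoothCurve c → IsSmoothCurve (f ∘ c)

/-- The `l`-th differential `d^l f(x)(v₁, …, v_l)`, by iterating
`d^l f(x)(v₁, …, v_l) = d/dt|_{t=0} d^{l-1} f(x + t v₁)(v₂, …, v_l)`. -/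
noncomputable def iterDifferential [AddCommGroup E] [Module ℝ E]
    [AddCommGroup F] [Module ℝ F] [TopologicalSpace F] (f : E → F) :
    (l : ℕ) → E → (Fin l → E) → F
  | 0, x, _ => f x
  | l + 1, x, v =>
      curveDeriv (fun t : ℝ => iterDifferential f l (x + t • v 0) (Fin.tail v)) 0

theorem HasCurveDerivAt.add [AddCommGroup E] [Module ℝ E] [TopologicalSpace E]
    [IsTopologicalAddGroup E] {c d : ℝ → E} {y z : E} {t : ℝ}
    (hc : HasCurveDerivAt c y t) (hd : HasCurveDerivAt d z t) :
    HasCurveDerivAt (c + d) (y + z) t := by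
  refine (Tendsto.add hc hd).congr fun s => ?_
  simp only [slope, vsub_eq_sub, Pi.add_apply, ← smul_add]
  congr 1
  abel

theorem HasCurveDerivAt.smul [AddCommGroup E] [Module ℂ E] [TopologicalSpace E]
    [ContinuousSMul ℂ E] {c : ℝ → E} {y : E} {t : ℝ} (a : ℂ)
    (hc : HasCurveDerivAt c y t) : HasCurveDerivAt (a • c) (a • y) t := by
  refine (Tendsto.const_smul hc a).congr fun s => ?_
  simp only [slope, vsub_eq_sub, Pi.smul_apply, ← smul_sub]
  rw [smul_comm]

theorem IsSmoothMap.zero [AddCommGroup E] [Module ℝ E] [TopologicalSpace E]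
    [AddCommGroup F] [Module ℝ F] [TopologicalSpace F] :
    IsSmoothMap (0 : E → F) := by
  intro c _
  refine ⟨fun _ _ => 0, rfl, fun n t => ?_⟩
  refine tendsto_const_nhds.congr fun s => ?_
  simp [slope]

theorem IsSmoothMap.add [AddCommGroup E] [Module ℝ E] [TopologicalSpace E]
    [AddCommGroup F] [Module ℝ F] [TopologicalSpace F] [IsTopologicalAddGroup F]
    {f g : E → F} (hf : IsSmoothMap f) (hg : IsSmoothMap g) : IsSmoothMap (f + g) := by
  intro c hc
  obtain ⟨d, hd0, hd⟩ := hf c hc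
  obtain ⟨e, he0, he⟩ := hg c hc
  refine ⟨fun n => d n + e n, ?_, fun n t => (hd n t).add (he n t)⟩
  simp only [hd0, he0]
  rfl

theorem IsSmoothMap.smul [AddCommGroup E] [Module ℝ E] [TopologicalSpace E]
    [AddCommGroup F] [Module ℂ F] [TopologicalSpace F] [ContinuousSMul ℂ F]
    {f : E → F} (a : ℂ) (hf : IsSmoothMap f) : IsSmoothMap (a • f) := by
  intro c hc
  obtain ⟨d, hd0, hd⟩ := hf c hc
  refine ⟨fun n => a • d n, ?_, fun n t => (hd n t).smul a⟩
  simp only [hd0]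
  rfl

end Calculus

/-! ### Test objects, moderateness and negligibility for a test pair of locally convex spaces -/

section TestObjects

variable {E : Type v} {F : Type w}
  [AddCommGroup E] [Module ℂ E] [TopologicalSpace E] [IsTopologicalAddGroup E]
  [ContinuousSMul ℂ E]
  [AddCommGroup F] [Module ℂ F] [TopologicalSpace F] [IsTopologicalAddGroup F]
  [ContinuousSMul ℂ F]

/-- `p(Φ_ε) = O(λ_ε)` for a seminorm `p` on `L_σ(E, F)`, the space of continuous linear maps with
the topology of pointwise convergence. -/
def SeminormBigO (p : Seminorm ℂ (E →Lₚₜ[ℂ] F)) (Φ : Eps → (E →L[ℂ] F)) (l : Eps → ℝ≥0) : Prop :=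
  (fun ε => p (ContinuousLinearMap.toPointwiseConvergenceCLM ℂ (RingHom.id ℂ) E F (Φ ε)))
    =O[epsZero] (fun ε => (l ε : ℝ))

/-- Test objects of the test pair `(E, F)`, where `j : F → E` is the inclusion. -/
structure IsTestObject (j : F →L[ℂ] E) (A D : Set (Eps → ℝ≥0)) (Φ : Eps → (E →L[ℂ] F)) :
    Prop where
  moderate : ∀ p : Seminorm ℂ (E →Lₚₜ[ℂ] F), Continuous p → ∃ l ∈ A, SeminormBigO p Φ l
  approx : ∀ p : Seminorm ℂ (F →Lₚₜ[ℂ] F), Continuous p → ∀ l ∈ D,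
    SeminormBigO p (fun ε => (Φ ε).comp j - ContinuousLinearMap.id ℂ F) l
  tendsto_id : Tendsto
    (fun ε => ContinuousLinearMap.toPointwiseConvergenceCLM ℂ (RingHom.id ℂ) E E (j.comp (Φ ε)))
    epsZero
    (𝓝 (ContinuousLinearMap.toPointwiseConvergenceCLM ℂ (RingHom.id ℂ) E E
      (ContinuousLinearMap.id ℂ E)))

/-- `0`-test objects of the test pair `(E, F)`. -/
structure IsZeroTestObject (j : F →L[ℂ] E) (A D : Set (Eps → ℝ≥0)) (Ψ : Eps → (E →L[ℂ] F)) :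
    Prop where
  moderate : ∀ p : Seminorm ℂ (E →Lₚₜ[ℂ] F), Continuous p → ∃ l ∈ A, SeminormBigO p Ψ l
  approx : ∀ p : Seminorm ℂ (F →Lₚₜ[ℂ] F), Continuous p → ∀ l ∈ D,
    SeminormBigO p (fun ε => (Ψ ε).comp j) l
  tendsto_zero : Tendsto
    (fun ε => ContinuousLinearMap.toPointwiseConvergenceCLM ℂ (RingHom.id ℂ) E E (j.comp (Ψ ε)))
    epsZero (𝓝 0)

/-- `R` is moderate with respect to the sets `Λ`, `Λ₀` of test objects and the growth scale `A`. -/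
def IsModerate (A : Set (Eps → ℝ≥0)) (Λ Λ₀ : Set (Eps → (E →L[ℂ] F)))
    (R : (E →L[ℂ] F) → F) : Prop :=
  ∀ p : Seminorm ℂ F, Continuous p → ∀ l : ℕ, ∀ Φ ∈ Λ, ∀ Ψ : Fin l → Eps → (E →L[ℂ] F),
    (∀ i, Ψ i ∈ Λ₀) → ∃ a ∈ A,
      (fun ε => p (iterDifferential R l (Φ ε) (fun i => Ψ i ε))) =O[epsZero]
        (fun ε => (a ε : ℝ))

/-- `R` is negligible with respect to the sets `Λ`, `Λ₀` of test objects and the decay scale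
`D`. -/
def IsNegligible (D : Set (Eps → ℝ≥0)) (Λ Λ₀ : Set (Eps → (E →L[ℂ] F)))
    (R : (E →L[ℂ] F) → F) : Prop :=
  ∀ p : Seminorm ℂ F, Continuous p → ∀ l : ℕ, ∀ Φ ∈ Λ, ∀ Ψ : Fin l → Eps → (E →L[ℂ] F),
    (∀ i, Ψ i ∈ Λ₀) → ∀ a ∈ D,
      (fun ε => p (iterDifferential R l (Φ ε) (fun i => Ψ i ε))) =O[epsZero]
        (fun ε => (a ε : ℝ))

end TestObjects

/-! ### Sheaves -/

/-- The spaces `S U` (`U ⊆ X` open) with the maps `res U V h : S U → S V` for `h : V ≤ U` form a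
sheaf of complex vector spaces: `res_self` and `res_res` say that they form a presheaf, and
`separated`, `glue` are the two sheaf axioms. -/
structure IsVectorSheaf {X : Type u} [TopologicalSpace X] (S : Opens X → Type v)
    [∀ U, AddCommGroup (S U)] [∀ U, Module ℂ (S U)]
    (res : ∀ U V : Opens X, V ≤ U → (S U →ₗ[ℂ] S V)) : Prop where
  res_self : ∀ (U : Opens X) (s : S U), res U U le_rfl s = s
  res_res : ∀ (U V W : Opens X) (hVU : V ≤ U) (hWV : W ≤ V) (s : S U),
    res V W hWV (res U V hVU s) = res U W (hWV.trans hVU) s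
  separated : ∀ (U : Opens X) (ι : Type u) (c : ι → Opens X) (hc : ∀ i, c i ≤ U),
    U ≤ ⨆ i, c i → ∀ s : S U, (∀ i, res U (c i) (hc i) s = 0) → s = 0
  glue : ∀ (U : Opens X) (ι : Type u) (c : ι → Opens X) (hc : ∀ i, c i ≤ U),
    U ≤ ⨆ i, c i → ∀ s : ∀ i, S (c i),
      (∀ i j, res (c i) (c i ⊓ c j) inf_le_left (s i) = res (c j) (c i ⊓ c j) inf_le_right (s j)) →
      ∃ t : S U, ∀ i, res U (c i) (hc i) t = s i

/-- A sheaf of (Hausdorff, complex) locally convex spaces. -/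
structure LCSheaf (X : Type u) [TopologicalSpace X] where
  Sec : Opens X → Type v
  [addCommGroup : ∀ U, AddCommGroup (Sec U)]
  [module : ∀ U, Module ℂ (Sec U)]
  [topology : ∀ U, TopologicalSpace (Sec U)]
  [topologicalAddGroup : ∀ U, IsTopologicalAddGroup (Sec U)]
  [continuousSMul : ∀ U, ContinuousSMul ℂ (Sec U)]
  [locallyConvex : ∀ U, LocallyConvexSpace ℝ (Sec U)]
  [t2 : ∀ U, T2Space (Sec U)]
  res : ∀ U V : Opens X, V ≤ U → (Sec U →L[ℂ] Sec V)
  isSheaf : IsVectorSheaf Sec (fun U V h => (res U V h : Sec U →ₗ[ℂ] Sec V))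
  /-- The topology on `Sec U` is the projective one with respect to the restrictions to the
  members of any open covering of `U`. -/
  projective : ∀ (U : Opens X) (ι : Type u) (c : ι → Opens X) (hc : ∀ i, c i ≤ U),
    U ≤ ⨆ i, c i → topology U = ⨅ i, (topology (c i)).induced (res U (c i) (hc i))

attribute [instance] LCSheaf.addCommGroup LCSheaf.module LCSheaf.topology
  LCSheaf.topologicalAddGroup LCSheaf.continuousSMul LCSheaf.locallyConvex LCSheaf.t2

variable {X : Type u} [TopologicalSpace X]

/-- `V ⋐ U`: the closure of `V` is compact and contained in `U`. -/
def CompactlyIn (V U : Opens X) : Prop :=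
  closure (V : Set X) ⊆ U ∧ IsCompact (closure (V : Set X))

theorem CompactlyIn.le {V U : Opens X} (h : CompactlyIn V U) : V ≤ U :=
  fun _ hx => h.1 (subset_closure hx)

/-- Elements of `Hom(E|_U, E|_U)`. -/
structure SheafEnd (E : LCSheaf.{u, v} X) (U : Opens X) where
  map : ∀ V : Opens X, V ≤ U → (E.Sec V →L[ℂ] E.Sec V)
  comm : ∀ (V W : Opens X) (hVU : V ≤ U) (hWV : W ≤ V) (s : E.Sec V),
    E.res V W hWV (map V hVU s) = map W (hWV.trans hVU) (E.res V W hWV s)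

/-- The restriction of `η ∈ Hom(E|_U, E|_U)` to `V ⊆ U` is zero. -/
def SheafEnd.VanishesOn {E : LCSheaf.{u, v} X} {U : Opens X} (η : SheafEnd E U)
    (V : Opens X) : Prop :=
  ∀ (W : Opens X) (hWU : W ≤ U), W ≤ V → η.map W hWU = 0

/-- The support of `η ∈ Hom(E|_U, E|_U)`: the complement in `U` of the union of all open sets on
which `η` vanishes. -/
def SheafEnd.supp {E : LCSheaf.{u, v} X} {U : Opens X} (η : SheafEnd E U) : Set X :=
  {x | x ∈ U ∧ ∀ V : Opens X, V ≤ U → η.VanishesOn V → x ∉ V}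

/-- A test pair of sheaves `(E, F)`. The inclusion of the subsheaf `F` of `E` is given by injective
maps compatible with the restrictions; they are continuous because the topology of `F(U)` is finer
than the one induced by `E(U)`. -/
structure TestPair (E : LCSheaf.{u, v} X) (F : LCSheaf.{u, w} X) where
  incl : ∀ U : Opens X, F.Sec U →L[ℂ] E.Sec U
  incl_injective : ∀ U, Function.Injective (incl U)
  incl_res : ∀ (U V : Opens X) (h : V ≤ U) (s : F.Sec U),
    E.res U V h (incl U s) = incl V (F.res U V h s)
  /-- For every open `U` and every open covering `c` of `U` there is a partition of unity
  `η i ∈ Hom(E|_U, E|_U)` subordinate to `c` whose members restrict to elements of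
  `Hom(F|_U, F|_U)`. The sum `∑ i, η i = id` is locally finite: on an open set met by the supports
  of the `η i` for `i ∈ J` only, it is the sum over `J`. -/
  partition : ∀ (U : Opens X) (ι : Type u) (c : ι → Opens X), (∀ i, c i ≤ U) → U ≤ ⨆ i, c i →
    ∃ η : ι → SheafEnd E U,
      (∀ i, ∃ θ : SheafEnd F U, ∀ (V : Opens X) (hVU : V ≤ U) (s : F.Sec V),
        incl V (θ.map V hVU s) = (η i).map V hVU (incl V s)) ∧
      (∀ i, (η i).supp ⊆ c i) ∧
      (∀ x ∈ U, ∃ V : Opens X, x ∈ V ∧ {i | ((η i).supp ∩ V).Nonempty}.Finite) ∧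
      (∀ (V : Opens X) (hVU : V ≤ U) (J : Finset ι),
        (∀ i, i ∉ J → Disjoint (η i).supp (V : Set X)) →
        ∀ s : E.Sec V, ∑ i ∈ J, (η i).map V hVU s = s)

namespace TestPair

variable {E : LCSheaf.{u, v} X} {F : LCSheaf.{u, w} X}

/-- Regularization operators on `U`: continuous linear maps `E(U) → F(U)`, with the topology of
bounded convergence. -/
abbrev RO (_T : TestPair E F) (U : Opens X) : Type (max v w) := E.Sec U →L[ℂ] F.Sec U

variable (T : TestPair E F)

/-- Localizing nets of regularization operators. -/
def IsLocalizing (U : Opens X) (Φ : Eps → T.RO U) : Prop :=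
  ∀ (V V₀ : Opens X) (hV : CompactlyIn V V₀) (hV₀ : CompactlyIn V₀ U),
    ∃ ε₀ : Eps, ∀ ε < ε₀, ∀ s : E.Sec U,
      E.res U V₀ hV₀.le s = 0 → F.res U V (hV.le.trans hV₀.le) (Φ ε s) = 0

/-- Localizing test objects on `U`. -/
def TOloc (A D : Set (Eps → ℝ≥0)) (U : Opens X) : Set (Eps → T.RO U) :=
  {Φ | IsTestObject (T.incl U) A D Φ ∧ T.IsLocalizing U Φ}

/-- Localizing `0`-test objects on `U`. -/
def TOzloc (A D : Set (Eps → ℝ≥0)) (U : Opens X) : Set (Eps → T.RO U) :=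
  {Ψ | IsZeroTestObject (T.incl U) A D Ψ ∧ T.IsLocalizing U Ψ}

/-- `R` is local: if two regularization operators agree after restriction to an open `V ⊆ U`, so do
their images under `R`. -/
def IsLocal (U : Opens X) (R : T.RO U → F.Sec U) : Prop :=
  ∀ (V : Opens X) (h : V ≤ U) (Φ₁ Φ₂ : T.RO U),
    (F.res U V h).comp Φ₁ = (F.res U V h).comp Φ₂ → F.res U V h (R Φ₁) = F.res U V h (R Φ₂)

/-- The local elements of the basic space `C^∞(L_b(E(U), F(U)), F(U))`, as a subspace of the space
of all maps. -/
def locSubmodule (U : Opens X) : Submodule ℂ (T.RO U → F.Sec U) where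
  carrier := {R | IsSmoothMap R ∧ T.IsLocal U R}
  zero_mem' := ⟨IsSmoothMap.zero, fun _ _ _ _ _ => rfl⟩
  add_mem' := by
    rintro R S ⟨hR, hR'⟩ ⟨hS, hS'⟩
    refine ⟨hR.add hS, fun V h Φ₁ Φ₂ hΦ => ?_⟩
    simp only [Pi.add_apply, map_add, hR' V h Φ₁ Φ₂ hΦ, hS' V h Φ₁ Φ₂ hΦ]
  smul_mem' := by
    rintro a R ⟨hR, hR'⟩
    refine ⟨hR.smul a, fun V h Φ₁ Φ₂ hΦ => ?_⟩
    simp only [Pi.smul_apply, map_smul, hR' V h Φ₁ Φ₂ hΦ]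

/-- The vector space of local elements of the basic space `C^∞(L_b(E(U), F(U)), F(U))`. -/
def LocBasic (U : Opens X) : Type (max v w) := ↥(T.locSubmodule U)

noncomputable instance (U : Opens X) : AddCommGroup (T.LocBasic U) :=
  inferInstanceAs (AddCommGroup (T.locSubmodule U))

noncomputable instance (U : Opens X) : Module ℂ (T.LocBasic U) :=
  inferInstanceAs (Module ℂ (T.locSubmodule U))

/-- The map `L(E(U), F(U)) → F(U)` given by an element of `LocBasic U`. -/
def LocBasic.toFun {T : TestPair E F} {U : Opens X} (R : T.LocBasic U) : T.RO U → F.Sec U :=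
  Subtype.val (p := fun R => R ∈ T.locSubmodule U) R

/-- The linear map `r` is a restriction map from `U` to `V` for local smooth maps: `r R (Φ)` and
`R (Φ')` agree on every `W ⋐ V` on which `Φ` and `Φ'` agree. -/
def IsLocRestriction (U V : Opens X) (hVU : V ≤ U) (r : T.LocBasic U →ₗ[ℂ] T.LocBasic V) : Prop :=
  ∀ (R : T.LocBasic U) (W : Opens X) (hW : CompactlyIn W V) (Φ : T.RO V) (Φ' : T.RO U),
    ((F.res V W hW.le).comp Φ).comp (E.res U V hVU) = (F.res U W (hW.le.trans hVU)).comp Φ' →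
    F.res V W hW.le ((r R).toFun Φ) =
      F.res U W (hW.le.trans hVU) (R.toFun Φ')

/-- The moderate elements of `LocBasic U`. -/
def IsModerateLoc (A D : Set (Eps → ℝ≥0)) (U : Opens X) (R : T.LocBasic U) : Prop :=
  IsModerate A (T.TOloc A D U) (T.TOzloc A D U) R.toFun

/-- The negligible elements of `LocBasic U`. -/
def IsNegligibleLoc (A D : Set (Eps → ℝ≥0)) (U : Opens X) (R : T.LocBasic U) : Prop :=
  IsNegligible D (T.TOloc A D U) (T.TOzloc A D U) R.toFun

end TestPair

end NonlinearExt

/-!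
Test objects over `V ≤ U` and over `U` can be exchanged near a set `W ⋐ V`: multiplying with
cutoffs from the partition of unity and subtracting a fixed localizing test object turns a test
object on one side into a test object on the other which agrees with it near `W` for small `ε`.
Since local smooth maps respect agreement, moderateness and negligibility pass to restrictions and
can be checked on a cover.

Given representatives `R i` over `c i` that agree up to negligible maps, a partition of unity `θ i`
subordinate to the cover and continuous extension operators `e i` from `c i` to `U` give
`S Φ = ∑ i, θ i (R i (res ∘ Φ ∘ e i))`. The differentials of `S` at a test object over `U` are, on
the support of `θ i`, those of `R i` at a test object of `c i`, so `S` restricts to `R j` up to a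
locally finite sum of negligible nets.
-/

namespace NonlinearExt

open scoped ContDiff

/-! ### Calculus of curves in topological vector spaces -/

section Curves

variable {E F : Type*}
  [AddCommGroup E] [Module ℝ E] [TopologicalSpace E]
  [AddCommGroup F] [Module ℝ F] [TopologicalSpace F]
  {c d : ℝ → E} {y z : E} {t : ℝ}

theorem HasCurveDerivAt.unique [T2Space E] (h : HasCurveDerivAt c y t)
    (h' : HasCurveDerivAt c z t) : y = z :=
  tendsto_nhds_unique h h'

theorem HasCurveDerivAt.curveDeriv_eq [T2Space E] (h : HasCurveDerivAt c y t) :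
    curveDeriv c t = y :=
  Tendsto.limUnder_eq h

omit [TopologicalSpace E] in
theorem slope_eventuallyEq (e : c =ᶠ[𝓝 t] d) : slope c t =ᶠ[𝓝[≠] t] slope d t := by
  filter_upwards [e.filter_mono nhdsWithin_le_nhds] with s hs
  rw [slope, slope, hs, e.eq_of_nhds]

theorem curveDeriv_congr (e : c =ᶠ[𝓝 t] d) : curveDeriv c t = curveDeriv d t := by
  unfold curveDeriv limUnder
  rw [Filter.map_congr (slope_eventuallyEq e)]

theorem HasCurveDerivAt.const (x : E) (t : ℝ) : HasCurveDerivAt (fun _ => x) 0 t := by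
  refine tendsto_const_nhds.congr fun s => ?_
  simp [slope]

theorem HasCurveDerivAt.map (h : HasCurveDerivAt c y t) (L : E →L[ℝ] F) :
    HasCurveDerivAt (fun s => L (c s)) (L y) t := by
  refine ((L.continuous.tendsto y).comp h).congr fun s => ?_
  simp [slope, map_smul, map_sub]

theorem hasCurveDerivAt_iff_hasDerivAt {G : Type*} [NormedAddCommGroup G] [NormedSpace ℝ G]
    {f : ℝ → G} {a : G} {t : ℝ} : HasCurveDerivAt f a t ↔ HasDerivAt f a t :=
  hasDerivAt_iff_tendsto_slope.symm

section TVS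

variable [ContinuousSMul ℝ E]

theorem HasCurveDerivAt.const_smul (h : HasCurveDerivAt c y t) (a : ℝ) :
    HasCurveDerivAt (fun s => a • c s) (a • y) t := by
  refine (Tendsto.const_smul h a).congr fun s => ?_
  simp only [slope, vsub_eq_sub, ← smul_sub]
  rw [smul_comm]

theorem HasCurveDerivAt.continuousAt [IsTopologicalAddGroup E] (h : HasCurveDerivAt c y t) :
    ContinuousAt c t := by
  rw [continuousAt_iff_punctured_nhds]
  have hlim : Tendsto (fun s : ℝ => (s - t) • slope c t s + c t) (𝓝[≠] t)
      (𝓝 ((t - t) • y + c t)) :=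
    ((((continuous_id.sub continuous_const).tendsto t).mono_left nhdsWithin_le_nhds).smul h).add
      tendsto_const_nhds
  simpa using hlim.congr fun s => by simp

theorem HasCurveDerivAt.comp {γ : ℝ → ℝ} {a : ℝ} (h : HasCurveDerivAt c y (γ t))
    (hγ : HasDerivAt γ a t) : HasCurveDerivAt (fun s => c (γ s)) (a • y) t := by
  classical
  set Q : ℝ → E := Function.update (slope c (γ t)) (γ t) y with hQ
  have hQc : ContinuousAt Q (γ t) := by
    rw [hQ, continuousAt_update_same]
    exact h
  have hlim : Tendsto (fun s => slope γ t s • Q (γ s)) (𝓝[≠] t) (𝓝 (a • Q (γ t))) :=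
    (hasDerivAt_iff_tendsto_slope.1 hγ).smul
      ((hQc.tendsto.comp hγ.continuousAt).mono_left nhdsWithin_le_nhds)
  have hQt : Q (γ t) = y := by simp [hQ]
  rw [hQt] at hlim
  refine hlim.congr fun s => ?_
  by_cases hs : γ s = γ t
  · simp [slope, hs]
  · rw [hQ, Function.update_of_ne hs]
    simp only [slope, vsub_eq_sub, smul_eq_mul, smul_smul]
    rw [mul_assoc, mul_inv_cancel₀ (sub_ne_zero.2 hs), mul_one]

variable [IsTopologicalAddGroup E]

omit [ContinuousSMul ℝ E] in
theorem HasCurveDerivAt.sum {ι : Type*} {s : Finset ι} {f : ι → ℝ → E} {y : ι → E}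
    (h : ∀ i ∈ s, HasCurveDerivAt (f i) (y i) t) :
    HasCurveDerivAt (fun u => ∑ i ∈ s, f i u) (∑ i ∈ s, y i) t := by
  refine (tendsto_finsetSum s h).congr fun u => ?_
  simp only [slope, vsub_eq_sub, ← Finset.smul_sum, Finset.sum_sub_distrib]

theorem HasCurveDerivAt.smul_of_hasDerivAt {φ : ℝ → ℝ} {a : ℝ} (h : HasCurveDerivAt c y t)
    (hφ : HasDerivAt φ a t) :
    HasCurveDerivAt (fun s => φ s • c s) (a • c t + φ t • y) t := by
  have hlim : Tendsto (fun s => slope φ t s • c s + φ t • slope c t s) (𝓝[≠] t)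
      (𝓝 (a • c t + φ t • y)) :=
    ((hasDerivAt_iff_tendsto_slope.1 hφ).smul
      (h.continuousAt.tendsto.mono_left nhdsWithin_le_nhds)).add (Tendsto.const_smul h _)
  refine hlim.congr fun s => ?_
  simp only [slope, vsub_eq_sub, smul_eq_mul, smul_sub, mul_sub, sub_smul, smul_smul]
  rw [mul_comm (φ t) (s - t)⁻¹]
  abel

end TVS

theorem isSmoothCurve_of_mem_of_derivClosed {S : Set (ℝ → E)}
    (h : ∀ c ∈ S, ∃ c' ∈ S, ∀ t, HasCurveDerivAt c (c' t) t) (hc : c ∈ S) : IsSmoothCurve c := by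
  choose! D hD hD' using h
  have hS : ∀ n, D^[n] c ∈ S := fun n => by
    induction n with
    | zero => exact hc
    | succ n ih => rw [Function.iterate_succ_apply']; exact hD _ ih
  refine ⟨fun n => D^[n] c, rfl, fun n t => ?_⟩
  beta_reduce
  rw [Function.iterate_succ_apply']
  exact hD' _ (hS n) t

theorem IsSmoothCurve.exists_deriv (hc : IsSmoothCurve c) :
    ∃ c', IsSmoothCurve c' ∧ ∀ t, HasCurveDerivAt c (c' t) t := by
  obtain ⟨d, rfl, hd⟩ := hc
  exact ⟨d 1, ⟨fun n => d (n + 1), rfl, fun n t => hd (n + 1) t⟩, hd 0⟩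

theorem IsSmoothCurve.hasCurveDerivAt [T2Space E] (hc : IsSmoothCurve c) (t : ℝ) :
    HasCurveDerivAt c (curveDeriv c t) t := by
  obtain ⟨c', -, h⟩ := hc.exists_deriv
  rw [(h t).curveDeriv_eq]
  exact h t

theorem IsSmoothCurve.curveDeriv [T2Space E] (hc : IsSmoothCurve c) :
    IsSmoothCurve (curveDeriv c) := by
  obtain ⟨c', hc', h⟩ := hc.exists_deriv
  rwa [show NonlinearExt.curveDeriv c = c' from funext fun t => (h t).curveDeriv_eq]

theorem IsSmoothCurve.iterate [T2Space E] (hc : IsSmoothCurve c) (n : ℕ) :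
    IsSmoothCurve (NonlinearExt.curveDeriv^[n] c) := by
  induction n with
  | zero => exact hc
  | succ n ih => rw [Function.iterate_succ_apply']; exact ih.curveDeriv

theorem IsSmoothCurve.hasCurveDerivAt_iterate [T2Space E] (hc : IsSmoothCurve c) (n : ℕ) (t : ℝ) :
    HasCurveDerivAt (NonlinearExt.curveDeriv^[n] c) (NonlinearExt.curveDeriv^[n + 1] c t) t := by
  rw [Function.iterate_succ_apply']
  exact (hc.iterate n).hasCurveDerivAt t

theorem iterate_curveDeriv_congr (e : c =ᶠ[𝓝 t] d) (n : ℕ) :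
    curveDeriv^[n] c =ᶠ[𝓝 t] curveDeriv^[n] d := by
  induction n with
  | zero => exact e
  | succ n ih =>
    rw [Function.iterate_succ_apply', Function.iterate_succ_apply']
    exact ih.eventuallyEq_nhds.mono fun s hs => curveDeriv_congr hs

theorem IsSmoothCurve.const (x : E) : IsSmoothCurve (fun _ : ℝ => x) :=
  isSmoothCurve_of_mem_of_derivClosed (S := Set.range fun x : E => fun _ : ℝ => x)
    (by rintro _ ⟨x, rfl⟩; exact ⟨_, ⟨0, rfl⟩, fun t => HasCurveDerivAt.const x t⟩) ⟨x, rfl⟩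

theorem IsSmoothCurve.map (hc : IsSmoothCurve c) (L : E →L[ℝ] F) :
    IsSmoothCurve (fun s => L (c s)) := by
  obtain ⟨d, rfl, hd⟩ := hc
  exact ⟨fun n s => L (d n s), rfl, fun n t => (hd n t).map L⟩

theorem IsSmoothCurve.add [IsTopologicalAddGroup E] (hc : IsSmoothCurve c)
    (hd : IsSmoothCurve d) : IsSmoothCurve (fun s => c s + d s) := by
  obtain ⟨e, rfl, he⟩ := hc
  obtain ⟨e', rfl, he'⟩ := hd
  exact ⟨fun n => e n + e' n, rfl, fun n t => (he n t).add (he' n t)⟩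

theorem isSmoothCurve_iff_contDiff {G : Type*} [NormedAddCommGroup G] [NormedSpace ℝ G]
    {f : ℝ → G} : IsSmoothCurve f ↔ ContDiff ℝ ∞ f := by
  constructor
  · rintro ⟨d, rfl, hd⟩
    have hd' : ∀ n t, HasDerivAt (d n) (d (n + 1) t) t := fun n t =>
      hasCurveDerivAt_iff_hasDerivAt.1 (hd n t)
    have : ∀ n, iteratedDeriv n (d 0) = d n := fun n => by
      induction n with
      | zero => exact iteratedDeriv_zero
      | succ n ih => rw [iteratedDeriv_succ, ih]; exact funext fun t => (hd' n t).deriv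
    refine contDiff_of_differentiable_iteratedDeriv fun m _ => ?_
    rw [this]
    exact fun t => (hd' m t).differentiableAt
  · intro hf
    refine ⟨fun n => iteratedDeriv n f, iteratedDeriv_zero, fun n t => ?_⟩
    beta_reduce
    rw [hasCurveDerivAt_iff_hasDerivAt, iteratedDeriv_succ]
    exact (hf.differentiable_iteratedDeriv n (by exact_mod_cast WithTop.coe_lt_top _)
      t).hasDerivAt

variable [IsTopologicalAddGroup E] [ContinuousSMul ℝ E]

theorem IsSmoothCurve.continuous (hc : IsSmoothCurve c) : Continuous c := by
  obtain ⟨c', -, h⟩ := hc.exists_deriv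
  exact continuous_iff_continuousAt.2 fun t => (h t).continuousAt

theorem isSmoothCurve_of_mem_span_of_derivClosed {S : Set (ℝ → E)}
    (h : ∀ c ∈ S, ∃ c' ∈ Submodule.span ℝ S, ∀ t, HasCurveDerivAt c (c' t) t)
    (hc : c ∈ Submodule.span ℝ S) : IsSmoothCurve c := by
  refine isSmoothCurve_of_mem_of_derivClosed (S := (Submodule.span ℝ S : Set (ℝ → E)))
    (fun c hc => ?_) hc
  refine Submodule.span_induction h ⟨0, zero_mem _, fun t => HasCurveDerivAt.const 0 t⟩ ?_ ?_ hc
  · rintro c d - - ⟨c', hc', h⟩ ⟨d', hd', h'⟩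
    exact ⟨c' + d', add_mem hc' hd', fun t => (h t).add (h' t)⟩
  · rintro a c - ⟨c', hc', h⟩
    exact ⟨a • c', Submodule.smul_mem _ a hc', fun t => (h t).const_smul a⟩

theorem IsSmoothCurve.smul_comp (hc : IsSmoothCurve c) {φ γ : ℝ → ℝ} (hφ : ContDiff ℝ ∞ φ)
    (hγ : ContDiff ℝ ∞ γ) : IsSmoothCurve (fun s => φ s • c (γ s)) := by
  refine isSmoothCurve_of_mem_span_of_derivClosed (S := {f | ∃ φ : ℝ → ℝ, ContDiff ℝ ∞ φ ∧
    ∃ c : ℝ → E, IsSmoothCurve c ∧ f = fun s => φ s • c (γ s)}) ?_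
    (Submodule.subset_span ⟨φ, hφ, c, hc, rfl⟩)
  rintro _ ⟨φ, hφ, c, hc, rfl⟩
  obtain ⟨c', hc', h⟩ := hc.exists_deriv
  have hφ' : ContDiff ℝ ∞ (deriv φ) := (contDiff_infty_iff_deriv.1 hφ).2
  have hγ' : ContDiff ℝ ∞ (deriv γ) := (contDiff_infty_iff_deriv.1 hγ).2
  refine ⟨(fun s => deriv φ s • c (γ s)) + fun s => (φ s * deriv γ s) • c' (γ s),
    add_mem (Submodule.subset_span ⟨_, hφ', c, hc, rfl⟩)
      (Submodule.subset_span ⟨_, hφ.mul hγ', c', hc', rfl⟩), fun t => ?_⟩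
  have := ((h (γ t)).comp (hγ.differentiable (by simp) t).hasDerivAt).smul_of_hasDerivAt
    (hφ.differentiable (by simp) t).hasDerivAt
  simpa [smul_smul] using this

theorem IsSmoothCurve.comp (hc : IsSmoothCurve c) {γ : ℝ → ℝ} (hγ : ContDiff ℝ ∞ γ) :
    IsSmoothCurve (fun s => c (γ s)) := by
  simpa using hc.smul_comp (φ := fun _ => 1) contDiff_const hγ

theorem IsSmoothCurve.line (x v : E) : IsSmoothCurve (fun s : ℝ => x + s • v) :=
  (IsSmoothCurve.const x).add ((IsSmoothCurve.const v).smul_comp contDiff_id contDiff_id)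

omit [IsTopologicalAddGroup E] in
theorem iterate_curveDeriv_comp_affine [T2Space E] (hc : IsSmoothCurve c) (a b : ℝ) (n : ℕ) :
    curveDeriv^[n] (fun s => c (a * s + b)) = fun s => a ^ n • curveDeriv^[n] c (a * s + b) := by
  induction n with
  | zero => simp
  | succ n ih =>
    rw [Function.iterate_succ_apply', ih]
    funext t
    have hγ : HasDerivAt (fun s : ℝ => a * s + b) a t := by
      simpa using ((hasDerivAt_id t).const_mul a).add_const b
    have := (HasCurveDerivAt.comp (γ := fun s => a * s + b)
      (hc.hasCurveDerivAt_iterate n (a * t + b)) hγ).const_smul (a ^ n)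
    rw [this.curveDeriv_eq, smul_smul, pow_succ]

end Curves

/-! ### Taylor estimates -/

section Taylor

variable {F : Type*} [AddCommGroup F] [Module ℝ F] [TopologicalSpace F] [IsTopologicalAddGroup F]
  [ContinuousSMul ℝ F]

theorem exists_clm_apply_eq_seminorm [LocallyConvexSpace ℝ F] {p : Seminorm ℝ F}
    (hp : Continuous p) (x : F) : ∃ L : F →L[ℝ] ℝ, L x = p x ∧ ∀ y, |L y| ≤ p y := by
  by_cases hx : x = 0
  · exact ⟨0, by simp [hx], by simp⟩
  let f : F →ₗ.[ℝ] ℝ := LinearPMap.mkSpanSingleton x (p x) hx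
  have hf : ∀ y : f.domain, f y ≤ p y := by
    rintro ⟨y, hy⟩
    obtain ⟨a, rfl⟩ := Submodule.mem_span_singleton.1 hy
    rw [LinearPMap.mkSpanSingleton'_apply, map_smul_eq_mul]
    exact mul_le_mul_of_nonneg_right (le_abs_self a) (apply_nonneg p x)
  obtain ⟨L, hLf, hL⟩ :=
    Module.Dual.exists_continuous_extension_of_le_seminorm_real f.domain f.toFun hp hf
  exact ⟨L, (hLf ⟨x, Submodule.mem_span_singleton_self x⟩).trans
    (LinearPMap.mkSpanSingleton_apply ℝ ℝ hx (p x)), hL⟩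

theorem seminorm_sub_le_of_hasCurveDerivAt [LocallyConvexSpace ℝ F] {p : Seminorm ℝ F}
    (hp : Continuous p) {c c' : ℝ → F} (h : ∀ t, HasCurveDerivAt c (c' t) t) {r C : ℝ}
    (hC : ∀ t, |t| ≤ |r| → p (c' t) ≤ C) : p (c r - c 0) ≤ C * |r| := by
  obtain ⟨L, hL, hLp⟩ := exists_clm_apply_eq_seminorm hp (c r - c 0)
  have := Convex.norm_image_sub_le_of_norm_hasDerivWithin_le (s := Set.Icc (-|r|) |r|)
    (f := fun t => L (c t)) (f' := fun t => L (c' t)) (C := C) (x := 0) (y := r)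
    (fun t _ => (hasCurveDerivAt_iff_hasDerivAt.1 ((h t).map L)).hasDerivWithinAt)
    (fun t ht => (hLp _).trans (hC t (abs_le.2 ht)))
    (convex_Icc _ _) (abs_le.1 (by simp)) (abs_le.1 le_rfl)
  rwa [← map_sub, hL, Real.norm_of_nonneg (apply_nonneg p _), sub_zero] at this

theorem hasDerivAt_pow_succ_div_factorial (k : ℕ) (t : ℝ) :
    HasDerivAt (fun s : ℝ => s ^ (k + 1) / (k + 1).factorial) (t ^ k / k.factorial) t := by
  refine ((hasDerivAt_pow (k + 1) t).div_const ((k + 1).factorial : ℝ)).congr_deriv ?_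
  rw [Nat.factorial_succ, Nat.add_sub_cancel]
  push_cast
  field_simp

theorem hasCurveDerivAt_sub_taylorSum {c c' : ℝ → F} {t : ℝ} (h : HasCurveDerivAt c (c' t) t)
    (a : ℕ → F) (n : ℕ) :
    HasCurveDerivAt (fun s => c s - ∑ k ∈ Finset.range (n + 1), (s ^ k / k.factorial) • a k)
      (c' t - ∑ k ∈ Finset.range n, (t ^ k / k.factorial) • a (k + 1)) t := by
  have hsum : HasCurveDerivAt
      (fun s => ∑ k ∈ Finset.range n, (s ^ (k + 1) / (k + 1).factorial) • a (k + 1))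
      (∑ k ∈ Finset.range n, (t ^ k / k.factorial) • a (k + 1)) t :=
    HasCurveDerivAt.sum fun k _ => by
      simpa using (HasCurveDerivAt.const (a (k + 1)) t).smul_of_hasDerivAt
        (hasDerivAt_pow_succ_div_factorial k t)
  convert (h.add (hsum.const_smul (-1))).add (HasCurveDerivAt.const (-a 0) t) using 1
  · funext s
    simp only [Finset.sum_range_succ', Pi.add_apply, pow_zero, Nat.factorial_zero, Nat.cast_one,
      div_one, one_smul, neg_one_smul]
    abel
  · simp [sub_eq_add_neg]

theorem seminorm_sub_taylorSum_le [LocallyConvexSpace ℝ F] {p : Seminorm ℝ F} (hp : Continuous p)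
    (n : ℕ) {d : ℕ → ℝ → F} (hd : ∀ k t, HasCurveDerivAt (d k) (d (k + 1) t) t) {r C : ℝ}
    (hC : ∀ t, |t| ≤ |r| → p (d n t) ≤ C) :
    p (d 0 r - ∑ k ∈ Finset.range n, (r ^ k / k.factorial) • d k 0) ≤ C * |r| ^ n := by
  induction n generalizing d r with
  | zero => simpa using hC r le_rfl
  | succ n ih =>
    have hC0 : 0 ≤ C := (apply_nonneg p _).trans (hC 0 (by simp))
    have hderiv : ∀ t, |t| ≤ |r| →
        p (d 1 t - ∑ k ∈ Finset.range n, (t ^ k / k.factorial) • d (k + 1) 0) ≤ C * |r| ^ n :=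
      fun t ht => (ih (fun k => hd (k + 1)) fun s hs => hC s (hs.trans ht)).trans (by gcongr)
    have key := seminorm_sub_le_of_hasCurveDerivAt hp
      (fun t => hasCurveDerivAt_sub_taylorSum (hd 0 t) (fun k => d k 0) n) hderiv
    simpa [Finset.sum_range_succ', pow_succ, mul_assoc] using key

end Taylor

/-! ### Smooth curves through prescribed line segments -/

section SpecialCurve

theorem exists_forall_norm_iteratedFDeriv_le {g : ℝ → ℝ} (hg : ContDiff ℝ ∞ g)
    (hsupp : HasCompactSupport g) (k : ℕ) : ∃ M, ∀ x, ‖iteratedFDeriv ℝ k g x‖ ≤ M :=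
  (hsupp.iteratedFDeriv (𝕜 := ℝ) k).exists_bound_of_continuous
    (hg.continuous_iteratedFDeriv (m := k) (by exact_mod_cast le_top))

variable {G : Type*} [NormedAddCommGroup G] [NormedSpace ℝ G]

theorem norm_iteratedFDeriv_bump_smul_le {g : ℝ → ℝ} (hg : ContDiff ℝ ∞ g) {k : ℕ} {M : ℝ}
    (hM : ∀ x, ‖iteratedFDeriv ℝ k g x‖ ≤ M) (r s : ℝ) (a : G) (t : ℝ) :
    ‖iteratedFDeriv ℝ k (fun t => g (r * (t - s)) • a) t‖ ≤ |r| ^ k * M * ‖a‖ := by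
  have hk : ContDiff ℝ k g := hg.of_le (by exact_mod_cast le_top)
  have hbump : ContDiff ℝ k fun t => g (r * (t - s)) := by fun_prop
  rw [norm_iteratedFDeriv_eq_norm_iteratedDeriv, iteratedDeriv_smul_const hbump.contDiffAt,
    norm_smul, iteratedDeriv_comp_sub_const k (fun y => g (r * y)) s,
    iteratedDeriv_comp_const_mul hk, norm_mul, norm_pow, Real.norm_eq_abs r,
    ← norm_iteratedFDeriv_eq_norm_iteratedDeriv]
  gcongr
  exact hM _

/-- The bumps sit at the times `2⁻ⁿ` and have width of order `4⁻ⁿ`, so that they are disjoint while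
their derivatives of order `k` grow like `4 ^ (k * n)` only. -/
theorem contDiff_tsum_bumps [CompleteSpace G] {g : ℝ → ℝ} (hg : ContDiff ℝ ∞ g)
    (hsupp : HasCompactSupport g) {a : ℕ → G} {C : ℝ} (ha : ∀ n, ‖a n‖ ≤ C / n.factorial) :
    ContDiff ℝ ∞ (fun t : ℝ => ∑' n, g (4 ^ (n + 1) * (t - (1 / 2) ^ n)) • a n) := by
  choose M hM using exists_forall_norm_iteratedFDeriv_le hg hsupp
  refine contDiff_tsum (N := ⊤) (v := fun k n => (4 ^ (n + 1)) ^ k * M k * (C / n.factorial))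
    (fun n => by fun_prop) (fun k _ => ?_) (fun k n x _ => ?_)
  · refine ((Real.summable_pow_div_factorial ((4 : ℝ) ^ k)).mul_left
      (C * 4 ^ k * M k)).congr fun n => ?_
    ring
  · have hM0 : 0 ≤ M k := (norm_nonneg _).trans (hM k 0)
    refine (norm_iteratedFDeriv_bump_smul_le hg (hM k) _ _ _ x).trans ?_
    rw [abs_of_pos (by positivity)]
    gcongr
    exact ha n

theorem one_le_abs_of_dist_lt_of_ne {m n : ℕ} (hmn : m ≠ n) {t : ℝ}
    (ht : |t - (1 / 2) ^ n| < (1 / 2) ^ n / 8) : 1 ≤ |4 ^ (m + 1) * (t - (1 / 2) ^ m)| := by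
  have htn := abs_lt.1 ht
  have hm : (0 : ℝ) < (1 / 2) ^ m := by positivity
  have hquarter : (1 / 2 : ℝ) ^ m / 4 ≤ |t - (1 / 2) ^ m| := by
    rcases lt_or_gt_of_ne hmn with hlt | hlt
    · have := pow_le_pow_of_le_one (by norm_num : (0 : ℝ) ≤ 1 / 2) (by norm_num) hlt
      rw [pow_succ] at this
      exact le_trans (by linarith) (neg_le_abs _)
    · have := pow_le_pow_of_le_one (by norm_num : (0 : ℝ) ≤ 1 / 2) (by norm_num) hlt
      rw [pow_succ] at this
      exact le_trans (by linarith) (le_abs_self _)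
  calc (1 : ℝ) ≤ 2 ^ m := one_le_pow₀ (by norm_num)
    _ = 4 ^ (m + 1) * ((1 / 2) ^ m / 4) := by
        rw [pow_succ, mul_assoc, mul_div_cancel₀ _ (by norm_num), ← mul_pow]; norm_num
    _ ≤ 4 ^ (m + 1) * |t - (1 / 2) ^ m| := by gcongr
    _ = _ := by rw [abs_mul, abs_of_pos (by positivity : (0 : ℝ) < 4 ^ (m + 1))]

theorem tsum_bumps_eventuallyEq {g : ℝ → ℝ} (hsupp : ∀ y, 1 ≤ |y| → g y = 0) (a : ℕ → G)
    (n : ℕ) : (fun t => ∑' m, g (4 ^ (m + 1) * (t - (1 / 2) ^ m)) • a m) =ᶠ[𝓝 ((1 / 2 : ℝ) ^ n)]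
      fun t => g (4 ^ (n + 1) * (t - (1 / 2) ^ n)) • a n := by
  filter_upwards [Metric.ball_mem_nhds ((1 / 2 : ℝ) ^ n)
    (show (0 : ℝ) < (1 / 2) ^ n / 8 by positivity)] with t ht
  refine tsum_eq_single n fun m hm => ?_
  rw [hsupp _ (one_le_abs_of_dist_lt_of_ne hm ht), zero_smul]

theorem exists_isSmoothCurve_through_segments [CompleteSpace G] (x₀ v : G) {x : ℕ → G}
    (hx : ∀ n, ‖x n - x₀‖ ≤ 1 / n.factorial) :
    ∃ c : ℝ → G, IsSmoothCurve c ∧ ∀ n : ℕ, c =ᶠ[𝓝 ((1 / 2 : ℝ) ^ n)]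
      fun t => x n + ((1 / n.factorial) * (t - (1 / 2) ^ n) : ℝ) • v := by
  let b : ContDiffBump (0 : ℝ) := ⟨1 / 2, 1, by norm_num, by norm_num⟩
  have hb0 : ∀ y, 1 ≤ |y| → b y = 0 := fun y hy => b.zero_of_le_dist (by simpa using hy)
  have hb1 : ∀ y, |y| ≤ 1 / 2 → b y = 1 := fun y hy =>
    b.one_of_mem_closedBall (by rw [mem_closedBall_zero_iff]; exact hy)
  let w : ℕ → G := fun n => (1 / n.factorial * (1 / 4 ^ (n + 1)) : ℝ) • v
  have hw : ∀ n, ‖w n‖ ≤ ‖v‖ / n.factorial := fun n => by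
    have : (1 : ℝ) / 4 ^ (n + 1) ≤ 1 :=
      div_le_one_of_le₀ (one_le_pow₀ (by norm_num)) (by positivity)
    rw [norm_smul, Real.norm_of_nonneg (by positivity)]
    calc 1 / (n.factorial : ℝ) * (1 / 4 ^ (n + 1)) * ‖v‖ ≤ 1 / n.factorial * 1 * ‖v‖ := by gcongr
      _ = ‖v‖ / n.factorial := by ring
  have hsmooth := ((contDiff_const (c := x₀)).add
    (contDiff_tsum_bumps b.contDiff b.hasCompactSupport hx)).add
    (contDiff_tsum_bumps (contDiff_id.mul b.contDiff) (b.hasCompactSupport.mul_left) hw)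
  refine ⟨_, isSmoothCurve_iff_contDiff.2 hsmooth, fun n => ?_⟩
  have hnear : ∀ᶠ t in 𝓝 ((1 / 2 : ℝ) ^ n), |4 ^ (n + 1) * (t - (1 / 2 : ℝ) ^ n)| < 1 / 2 :=
    ContinuousAt.eventually_lt (by fun_prop) continuousAt_const (by simp)
  filter_upwards [tsum_bumps_eventuallyEq hb0 (fun n => x n - x₀) n,
    tsum_bumps_eventuallyEq (fun y hy => by rw [hb0 y hy, mul_zero] : ∀ y, 1 ≤ |y| → y * b y = 0)
      w n, hnear] with t hx hw ht
  simp only [id]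
  rw [hx, hw, hb1 _ ht.le, one_smul, add_sub_cancel, mul_one, smul_smul]
  congr 2
  field_simp

end SpecialCurve

/-! ### Iterated directional derivatives -/

/-- The `q`-th derivative of `f` at `x` along the line with direction `v`. -/
noncomputable def dirDeriv {G F : Type*} [AddCommGroup G] [Module ℝ G]
    [AddCommGroup F] [Module ℝ F] [TopologicalSpace F] (f : G → F) (v : G) (q : ℕ) (x : G) : F :=
  curveDeriv^[q] (fun t : ℝ => f (x + t • v)) 0

section Lines

variable {G F : Type*} [AddCommGroup G] [Module ℝ G] [TopologicalSpace G]
  [IsTopologicalAddGroup G] [ContinuousSMul ℝ G]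
  [AddCommGroup F] [Module ℝ F] [TopologicalSpace F] {f : G → F}

theorem IsSmoothMap.line (hf : IsSmoothMap f) (x v : G) :
    IsSmoothCurve (fun t : ℝ => f (x + t • v)) :=
  hf _ (IsSmoothCurve.line x v)

variable [ContinuousSMul ℝ F] [T2Space F]

theorem iterate_curveDeriv_line (hf : IsSmoothMap f) (x v : G) (q : ℕ) (a b t : ℝ) :
    curveDeriv^[q] (fun t : ℝ => f (x + (a * t + b) • v)) t
      = a ^ q • dirDeriv f v q (x + (a * t + b) • v) := by
  have hshift : (fun s : ℝ => f (x + (a * t + b) • v + s • v))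
      = fun s => f (x + (1 * s + (a * t + b)) • v) := by
    funext s
    rw [add_assoc, ← add_smul, one_mul, add_comm s]
  rw [dirDeriv, hshift, iterate_curveDeriv_comp_affine (hf.line x v) a b,
    iterate_curveDeriv_comp_affine (hf.line x v) 1 (a * t + b)]
  simp

theorem hasCurveDerivAt_dirDeriv_line (hf : IsSmoothMap f) (x v : G) (q : ℕ) (t : ℝ) :
    HasCurveDerivAt (fun t : ℝ => dirDeriv f v q (x + t • v))
      (dirDeriv f v (q + 1) (x + t • v)) t := by
  have hline : ∀ q, curveDeriv^[q] (fun t : ℝ => f (x + t • v))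
      = fun t => dirDeriv f v q (x + t • v) := fun q => by
    funext t
    simpa using iterate_curveDeriv_line hf x v q 1 0 t
  simpa only [hline] using (hf.line x v).hasCurveDerivAt_iterate q t

end Lines

/-! ### Convergence and growth in terms of seminorms -/

section Seminorms

variable {F : Type*} [AddCommGroup F] [Module ℝ F] {α : Type*} {l : Filter α}

theorem seminorm_sum_le {𝕜 F ι : Type*} [NormedField 𝕜] [AddCommGroup F] [Module 𝕜 F]
    (p : Seminorm 𝕜 F) (s : Finset ι) (g : ι → F) : p (∑ i ∈ s, g i) ≤ ∑ i ∈ s, p (g i) :=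
  Finset.le_sum_of_subadditive p (map_zero p).le (map_add_le_add p) s g

theorem seminorm_isBigO_sub {p : Seminorm ℝ F} {g g' : α → F} {b : α → ℝ}
    (h : (fun a => p (g a)) =O[l] b) (h' : (fun a => p (g' a)) =O[l] b) :
    (fun a => p (g a - g' a)) =O[l] b :=
  (IsBigO.of_bound 1 (Eventually.of_forall fun a => by
    simpa only [one_mul, Real.norm_of_nonneg (apply_nonneg p _),
      Real.norm_of_nonneg (add_nonneg (apply_nonneg p (g a)) (apply_nonneg p (g' a)))]
      using map_sub_le_add p (g a) (g' a))).trans (h.add h')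

theorem seminorm_isBigO_sum_smul {ι : Type*} {s : Finset ι} (w : ι → ℝ) {p : Seminorm ℝ F}
    {g : ι → α → F} {b : α → ℝ} (h : ∀ i ∈ s, (fun a => p (g i a)) =O[l] b) :
    (fun a => p (∑ i ∈ s, w i • g i a)) =O[l] b := by
  refine IsBigO.trans (IsBigO.of_bound 1 (Eventually.of_forall fun a => ?_))
    (IsBigO.sum fun i hi => (h i hi).const_mul_left |w i|)
  rw [one_mul, Real.norm_of_nonneg (apply_nonneg p _)]
  refine (seminorm_sum_le p s _).trans (le_of_eq_of_le ?_ (le_abs_self _))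
  simp only [Finset.sum_apply, map_smul_eq_mul, Real.norm_eq_abs]

variable [TopologicalSpace F] [IsTopologicalAddGroup F] [ContinuousSMul ℝ F]
  [LocallyConvexSpace ℝ F]

theorem tendsto_zero_of_forall_seminorm {g : α → F}
    (h : ∀ p : Seminorm ℝ F, Continuous p → Tendsto (fun a => p (g a)) l (𝓝 0)) :
    Tendsto g l (𝓝 0) := by
  rw [(PolynormableSpace.withSeminorms ℝ F).tendsto_nhds]
  exact fun p ε hε => by simpa only [sub_zero] using (h p.1 p.2).eventually_lt_const hε

theorem tendsto_inv_pow_smul_of_seminorm_isBigO {g : α → F} {r : α → ℝ} (hr : Tendsto r l (𝓝 0))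
    {k m : ℕ} (hkm : k < m)
    (h : ∀ p : Seminorm ℝ F, Continuous p → (fun a => p (g a)) =O[l] fun a => r a ^ m) :
    Tendsto (fun a => (r a ^ k)⁻¹ • g a) l (𝓝 0) := by
  refine tendsto_zero_of_forall_seminorm fun p hp => ?_
  have hlittle := ((h p hp).trans_isLittleO
    ((isLittleO_pow_pow hkm).comp_tendsto hr)).norm_right.tendsto_div_nhds_zero
  refine hlittle.congr fun a => ?_
  rw [map_smul_eq_mul, norm_inv, Function.comp_apply, div_eq_inv_mul]

omit [Module ℝ F] [ContinuousSMul ℝ F] [LocallyConvexSpace ℝ F] in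
theorem tendsto_of_tendsto_sub_of_eventually_tendsto {β : Type*} {l' : Filter β} [l'.NeBot]
    {T : β → α → F} {D : α → F} {t : β → F} {y : F}
    (h : Tendsto (fun z : β × α => T z.1 z.2 - D z.2) (l' ×ˢ l) (𝓝 0))
    (hT : ∀ᶠ k in l', Tendsto (T k) l (𝓝 (t k))) (ht : Tendsto t l' (𝓝 y)) :
    Tendsto D l (𝓝 y) := by
  let := IsTopologicalAddGroup.rightUniformSpace F
  have := isUniformAddGroup_of_addCommGroup (G := F)
  refine TendstoUniformlyOnFilter.tendsto_of_eventually_tendsto ?_ hT ht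
  rw [tendstoUniformlyOnFilter_iff_tendsto, uniformity_eq_comap_nhds_zero, tendsto_comap_iff]
  exact h

end Seminorms

/-! ### Coefficients of vector-valued polynomials -/

section Coefficients

variable {F : Type*} [AddCommGroup F] [Module ℝ F]

theorem exists_finite_difference_weights (q m : ℕ) : ∃ w : ℕ → ℝ, ∀ i < m,
    ∑ j ∈ Finset.range m, w j * (j : ℝ) ^ i = if i = q then (q.factorial : ℝ) else 0 := by
  let V : Matrix (Fin m) (Fin m) ℝ := Matrix.vandermonde fun j => (j : ℝ)
  have hV : IsUnit V.det := by
    rw [isUnit_iff_ne_zero, Matrix.det_vandermonde_ne_zero_iff]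
    exact fun a b hab => Fin.ext (Nat.cast_injective (R := ℝ) hab)
  let e : Fin m → ℝ := fun i => if (i : ℕ) = q then (q.factorial : ℝ) else 0
  let w : Fin m → ℝ := Matrix.vecMul e V⁻¹
  have hwV : Matrix.vecMul w V = e := by
    rw [Matrix.vecMul_vecMul, Matrix.nonsing_inv_mul _ hV, Matrix.vecMul_one]
  refine ⟨fun j => if h : j < m then w ⟨j, h⟩ else 0, fun i hi => ?_⟩
  rw [Finset.sum_range]
  simpa [Matrix.vecMul, dotProduct, V, Matrix.vandermonde_apply, e] using congrFun hwV ⟨i, hi⟩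

theorem sum_weights_smul_taylorSum {q m : ℕ} (hq : q < m) {w : ℕ → ℝ}
    (hw : ∀ i < m, ∑ j ∈ Finset.range m, w j * (j : ℝ) ^ i = if i = q then (q.factorial : ℝ) else 0)
    (c : ℕ → F) (t : ℝ) :
    ∑ j ∈ Finset.range m, w j • ∑ k ∈ Finset.range m, ((j * t) ^ k / k.factorial) • c k
      = t ^ q • c q := by
  have hcoeff : ∀ k ∈ Finset.range m, ∑ j ∈ Finset.range m, w j * ((j * t) ^ k / k.factorial)
      = if k = q then t ^ q else 0 := fun k hk => by
    calc ∑ j ∈ Finset.range m, w j * ((j * t) ^ k / k.factorial)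
        = (∑ j ∈ Finset.range m, w j * (j : ℝ) ^ k) * (t ^ k / k.factorial) := by
          rw [Finset.sum_mul]
          exact Finset.sum_congr rfl fun j _ => by rw [mul_pow]; ring
      _ = if k = q then t ^ q else 0 := by
          rw [hw k (Finset.mem_range.1 hk)]
          split_ifs with hkq
          · subst hkq
            field_simp
          · rw [zero_mul]
  simp only [Finset.smul_sum, smul_smul]
  rw [Finset.sum_comm]
  simp only [← Finset.sum_smul]
  rw [Finset.sum_congr rfl fun k hk => by rw [hcoeff k hk]]
  simp [hq]

variable [TopologicalSpace F] [IsTopologicalAddGroup F] [ContinuousSMul ℝ F] [T2Space F]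

theorem coeff_zero_eq_zero_of_tendsto {q : ℕ} {b : ℕ → F} {y : F}
    (h : Tendsto (fun r : ℝ => (r ^ (q + 1))⁻¹ • ∑ i ∈ Finset.range (q + 2), r ^ i • b i)
      (𝓝[≠] 0) (𝓝 y)) : b 0 = 0 := by
  have hid : Tendsto (fun r : ℝ => r) (𝓝[≠] 0) (𝓝 0) := nhdsWithin_le_nhds
  have hzero : Tendsto (fun r : ℝ => ∑ i ∈ Finset.range (q + 2), r ^ i • b i) (𝓝[≠] 0) (𝓝 0) := by
    have := (hid.pow (q + 1)).smul h
    rw [zero_pow (Nat.succ_ne_zero q), zero_smul] at this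
    refine this.congr' (eventually_mem_nhdsWithin.mono fun r hr => ?_)
    rw [smul_smul, mul_inv_cancel₀ (pow_ne_zero _ hr), one_smul]
  have hconst : Tendsto (fun r : ℝ => ∑ i ∈ Finset.range (q + 2), r ^ i • b i) (𝓝[≠] 0)
      (𝓝 (∑ i ∈ Finset.range (q + 2), (0 : ℝ) ^ i • b i)) :=
    tendsto_finsetSum _ fun i _ => (hid.pow i).smul tendsto_const_nhds
  simpa [Finset.sum_range_succ'] using tendsto_nhds_unique hconst hzero

theorem coeff_eq_of_tendsto {q : ℕ} {b : ℕ → F} {y : F}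
    (h : Tendsto (fun r : ℝ => (r ^ q)⁻¹ • ∑ i ∈ Finset.range (q + 1), r ^ i • b i) (𝓝[≠] 0)
      (𝓝 y)) : (∀ i < q, b i = 0) ∧ b q = y := by
  induction q generalizing b with
  | zero =>
    refine ⟨by simp, tendsto_nhds_unique tendsto_const_nhds (h.congr fun r => ?_)⟩
    simp
  | succ q ih =>
    have hb0 : b 0 = 0 := coeff_zero_eq_zero_of_tendsto h
    have hshift : Tendsto (fun r : ℝ => (r ^ q)⁻¹ • ∑ i ∈ Finset.range (q + 1), r ^ i • b (i + 1))
        (𝓝[≠] 0) (𝓝 y) := by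
      refine h.congr' (eventually_mem_nhdsWithin.mono fun r hr => ?_)
      have hr : r ≠ 0 := hr
      rw [Finset.sum_range_succ', hb0, smul_zero, add_zero]
      simp only [Finset.smul_sum, smul_smul]
      refine Finset.sum_congr rfl fun i _ => ?_
      congr 1
      field_simp
      ring
    obtain ⟨hlow, hq⟩ := ih hshift
    refine ⟨fun i hi => ?_, hq⟩
    cases i with
    | zero => exact hb0
    | succ i => exact hlow i (by omega)

theorem hasCurveDerivAt_of_pow_smul_expansion [LocallyConvexSpace ℝ F] {U : ℝ → F} {a : ℕ → F}
    {q : ℕ} (hU : ContinuousAt U 0)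
    (h : ∀ p : Seminorm ℝ F, Continuous p →
      (fun r : ℝ => p (r ^ q • U r - ∑ i ∈ Finset.range (q + 2), r ^ i • a i))
        =O[𝓝 0] fun r => r ^ (q + 2)) :
    HasCurveDerivAt U (a (q + 1)) 0 := by
  have hid : Tendsto (fun r : ℝ => r) (𝓝[≠] 0) (𝓝 0) := nhdsWithin_le_nhds
  have hrem : ∀ k < q + 2, Tendsto (fun r : ℝ => (r ^ k)⁻¹ •
      (r ^ q • U r - ∑ i ∈ Finset.range (q + 2), r ^ i • a i)) (𝓝[≠] 0) (𝓝 0) := fun k hk =>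
    tendsto_inv_pow_smul_of_seminorm_isBigO hid hk fun p hp => (h p hp).mono nhdsWithin_le_nhds
  obtain ⟨hlow, hq⟩ : (∀ i < q, a i = 0) ∧ a q = U 0 := by
    refine coeff_eq_of_tendsto ?_
    have hlim := ((hU.tendsto.mono_left nhdsWithin_le_nhds).sub
      (hid.smul (tendsto_const_nhds (x := a (q + 1))))).sub (hrem q (by omega))
    rw [zero_smul, sub_zero, sub_zero] at hlim
    refine hlim.congr' (eventually_mem_nhdsWithin.mono fun r hr => ?_)
    have hr : r ^ q ≠ 0 := pow_ne_zero _ hr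
    rw [smul_sub, smul_smul, inv_mul_cancel₀ hr, one_smul, Finset.sum_range_succ _ (q + 1),
      smul_add, smul_smul, pow_succ, ← mul_assoc, inv_mul_cancel₀ hr, one_mul]
    abel
  have hlim := (hrem (q + 1) (by omega)).add_const (a (q + 1))
  rw [zero_add] at hlim
  refine hlim.congr' (eventually_mem_nhdsWithin.mono fun r hr => ?_)
  have hr : r ≠ 0 := hr
  have hsum : ∑ i ∈ Finset.range (q + 2), r ^ i • a i = r ^ q • U 0 + r ^ (q + 1) • a (q + 1) := by
    rw [Finset.sum_range_succ, Finset.sum_range_succ, hq, Finset.sum_eq_zero, zero_add]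
    exact fun i hi => by rw [hlow i (Finset.mem_range.1 hi), smul_zero]
  have hpow : (r ^ (q + 1))⁻¹ * r ^ q = r⁻¹ := by
    rw [pow_succ]
    field_simp
  rw [hsum, ← sub_sub, ← smul_sub, smul_sub, smul_smul, smul_smul, hpow,
    inv_mul_cancel₀ (pow_ne_zero _ hr), one_smul, sub_add_cancel, slope, sub_zero, vsub_eq_sub]

end Coefficients

/-! ### Smoothness of directional derivatives -/

section DirDeriv

variable {G F : Type*} [NormedAddCommGroup G] [NormedSpace ℝ G] [CompleteSpace G]
  [AddCommGroup F] [Module ℝ F] [TopologicalSpace F] [IsTopologicalAddGroup F]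
  [ContinuousSMul ℝ F] [T2Space F] {f : G → F}

omit [NormedSpace ℝ G] [CompleteSpace G] in
theorem exists_seq_lt_of_not_eventually_le {g : G → ℝ} {x₀ : G}
    (hg : ¬ ∃ C, ∀ᶠ x in 𝓝 x₀, g x ≤ C) {r : ℕ → ℝ} (hr : ∀ n, 0 < r n) (b : ℕ → ℝ) :
    ∃ x : ℕ → G, ∀ n, ‖x n - x₀‖ ≤ r n ∧ b n < g (x n) := by
  push Not at hg
  have hexists : ∀ n, ∃ x, ‖x - x₀‖ ≤ r n ∧ b n < g x := fun n => by
    obtain ⟨x, hlt, hx⟩ := ((hg (b n)).and_eventually (Metric.ball_mem_nhds x₀ (hr n))).exists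
    exact ⟨x, (dist_eq_norm x x₀).symm.le.trans (Metric.mem_ball.1 hx).le, hlt⟩
  choose x hx using hexists
  exact ⟨x, hx⟩

omit [CompleteSpace G] [IsTopologicalAddGroup F] in
theorem iterate_curveDeriv_comp_of_eventuallyEq_segment (hf : IsSmoothMap f) {c : ℝ → G}
    {x v : G} {r s : ℝ} (hc : c =ᶠ[𝓝 s] fun t => x + (r * (t - s)) • v) (q : ℕ) :
    curveDeriv^[q] (f ∘ c) s = r ^ q • dirDeriv f v q x := by
  have hfc : (f ∘ c) =ᶠ[𝓝 s] fun t : ℝ => f (x + (r * t + -(r * s)) • v) :=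
    hc.mono fun t ht => by simp only [Function.comp, ht, mul_sub, ← sub_eq_add_neg]
  rw [(iterate_curveDeriv_congr hfc q).eq_of_nhds, iterate_curveDeriv_line hf]
  simp

/-- If the derivatives were unbounded, then a smooth curve running through points `xₙ → x₀` with
velocities `v / n!` would be mapped to a curve with an unbounded derivative. -/
theorem dirDeriv_locally_bounded (hf : IsSmoothMap f) {p : Seminorm ℝ F} (hp : Continuous p)
    (v : G) (q : ℕ) (x₀ : G) : ∃ C, ∀ᶠ x in 𝓝 x₀, p (dirDeriv f v q x) ≤ C := by
  by_contra hunbounded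
  obtain ⟨x, hx⟩ := exists_seq_lt_of_not_eventually_le hunbounded
    (r := fun n => 1 / n.factorial) (fun n => by positivity)
    (fun n => n / (1 / n.factorial) ^ q)
  obtain ⟨c, hc, hcx⟩ := exists_isSmoothCurve_through_segments x₀ v fun n => (hx n).1
  have hlim : Tendsto (fun n : ℕ => p (curveDeriv^[q] (f ∘ c) ((1 / 2) ^ n))) atTop
      (𝓝 (p (curveDeriv^[q] (f ∘ c) 0))) :=
    ((hp.comp ((hf c hc).iterate q).continuous).tendsto 0).comp
      (tendsto_pow_atTop_nhds_zero_of_lt_one (by norm_num) (by norm_num))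
  refine not_tendsto_atTop_of_tendsto_nhds hlim
    (tendsto_atTop_mono (fun n => ?_) tendsto_natCast_atTop_atTop)
  rw [iterate_curveDeriv_comp_of_eventuallyEq_segment hf (hcx n), map_smul_eq_mul,
    Real.norm_of_nonneg (by positivity), mul_comm]
  exact ((div_lt_iff₀ (by positivity)).1 (hx n).2).le

variable [LocallyConvexSpace ℝ F]

theorem dirDeriv_taylor (hf : IsSmoothMap f) {p : Seminorm ℝ F} (hp : Continuous p)
    (v : G) (m : ℕ) (x₀ : G) :
    (fun z : G × ℝ => p (f (z.1 + z.2 • v)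
      - ∑ k ∈ Finset.range m, (z.2 ^ k / k.factorial) • dirDeriv f v k z.1))
      =O[𝓝 (x₀, 0)] fun z => z.2 ^ m := by
  obtain ⟨C, hC⟩ := dirDeriv_locally_bounded hf hp v m x₀
  obtain ⟨r, hr, hball⟩ := Metric.eventually_nhds_iff.1 hC
  have hnear : ∀ᶠ z : G × ℝ in 𝓝 (x₀, 0), ‖z.1 - x₀‖ + |z.2| * ‖v‖ < r :=
    ContinuousAt.eventually_lt (by fun_prop) continuousAt_const (by simpa using hr)
  refine IsBigO.of_bound C (hnear.mono fun z hz => ?_)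
  have hseg : ∀ t, |t| ≤ |z.2| → p (dirDeriv f v m (z.1 + t • v)) ≤ C := fun t ht => by
    refine hball ?_
    rw [dist_eq_norm, add_sub_right_comm]
    refine (norm_add_le _ _).trans_lt (lt_of_le_of_lt ?_ hz)
    rw [norm_smul, Real.norm_eq_abs]
    gcongr
  rw [Real.norm_of_nonneg (apply_nonneg p _), norm_pow, Real.norm_eq_abs]
  simpa [dirDeriv] using seminorm_sub_taylorSum_le hp m
    (fun k t => hasCurveDerivAt_dirDeriv_line hf z.1 v k t) hseg

theorem dirDeriv_finite_difference (hf : IsSmoothMap f) {p : Seminorm ℝ F} (hp : Continuous p)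
    (v : G) {q m : ℕ} (hq : q < m) {w : ℕ → ℝ}
    (hw : ∀ i < m, ∑ j ∈ Finset.range m, w j * (j : ℝ) ^ i = if i = q then (q.factorial : ℝ) else 0)
    (x₀ : G) :
    (fun z : G × ℝ => p (∑ j ∈ Finset.range m, w j • f (z.1 + (j * z.2) • v)
      - z.2 ^ q • dirDeriv f v q z.1)) =O[𝓝 (x₀, 0)] fun z => z.2 ^ m := by
  have hscale : ∀ j : ℕ, Tendsto (fun z : G × ℝ => (z.1, (j : ℝ) * z.2)) (𝓝 (x₀, 0)) (𝓝 (x₀, 0)) :=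
    fun j => by
      have : Continuous (fun z : G × ℝ => (z.1, (j : ℝ) * z.2)) := by fun_prop
      simpa using this.tendsto (x₀, 0)
  have htaylor := seminorm_isBigO_sum_smul (s := Finset.range m) w fun j _ =>
    ((dirDeriv_taylor hf hp v m x₀).comp_tendsto (hscale j)).trans
      (IsBigO.of_bound (g := fun z : G × ℝ => z.2 ^ m) ((j : ℝ) ^ m)
        (Eventually.of_forall fun z => by simp [mul_pow]))
  refine htaylor.congr_left fun z => ?_
  simp only [smul_sub, Finset.sum_sub_distrib]
  rw [sum_weights_smul_taylorSum hq hw (fun k => dirDeriv f v k z.1)]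

/-- `dirDeriv f v q` is the locally uniform limit of its finite difference approximations, which are
continuous along lines. -/
theorem continuousAt_dirDeriv_line (hf : IsSmoothMap f) (v e x₀ : G) (q : ℕ) :
    ContinuousAt (fun h : ℝ => dirDeriv f v q (x₀ + h • e)) 0 := by
  obtain ⟨w, hw⟩ := exists_finite_difference_weights q (q + 1)
  let S : ℝ → ℝ → F := fun k h => ∑ j ∈ Finset.range (q + 1), w j • f (x₀ + h • e + (j * k) • v)
  let D : ℝ → F := fun h => dirDeriv f v q (x₀ + h • e)
  have hS : ∀ k, Continuous (S k) := fun k => continuous_finsetSum _ fun j _ =>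
    ((hf.line (x₀ + (j * k) • v) e).continuous.congr fun h => by
      rw [add_right_comm]).const_smul (w j)
  have happrox : Tendsto (fun z : ℝ × ℝ => (z.1 ^ q)⁻¹ • S z.1 z.2 - D z.2) (𝓝[≠] 0 ×ˢ 𝓝 0)
      (𝓝 0) := by
    have hpath : Tendsto (fun z : ℝ × ℝ => (x₀ + z.2 • e, z.1)) (𝓝[≠] 0 ×ˢ 𝓝 0) (𝓝 (x₀, 0)) := by
      have : Continuous (fun z : ℝ × ℝ => (x₀ + z.2 • e, z.1)) := by fun_prop
      refine Tendsto.mono_left ?_ (Filter.prod_mono_left (𝓝 0) nhdsWithin_le_nhds)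
      simpa [nhds_prod_eq] using this.tendsto (0, 0)
    refine (tendsto_inv_pow_smul_of_seminorm_isBigO (tendsto_fst.mono_right nhdsWithin_le_nhds)
      (Nat.lt_succ_self q) fun p hp => (dirDeriv_finite_difference hf hp v (Nat.lt_succ_self q) hw
        x₀).comp_tendsto hpath).congr' ?_
    filter_upwards [tendsto_fst.eventually self_mem_nhdsWithin] with z hz
    change (z.1 ^ q)⁻¹ • (S z.1 z.2 - z.1 ^ q • D z.2) = _
    rw [smul_sub, smul_smul, inv_mul_cancel₀ (pow_ne_zero _ hz), one_smul]
  have hat : Tendsto (fun k : ℝ => (k ^ q)⁻¹ • S k 0) (𝓝[≠] 0) (𝓝 (D 0)) := by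
    have hpath : Tendsto (fun k : ℝ => (k, (0 : ℝ))) (𝓝[≠] 0) (𝓝[≠] 0 ×ˢ 𝓝 0) :=
      tendsto_id.prodMk tendsto_const_nhds
    simpa using (happrox.comp hpath).add_const (D 0)
  exact tendsto_of_tendsto_sub_of_eventually_tendsto happrox
    (Eventually.of_forall fun k => ((hS k).tendsto 0).const_smul _) hat

theorem dirDeriv_line_expansion (hf : IsSmoothMap f) {p : Seminorm ℝ F} (hp : Continuous p)
    (v e : G) {q m : ℕ} (hq : q < m) {w : ℕ → ℝ}
    (hw : ∀ i < m, ∑ j ∈ Finset.range m, w j * (j : ℝ) ^ i = if i = q then (q.factorial : ℝ) else 0)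
    (x₀ : G) :
    (fun h : ℝ => p (h ^ q • dirDeriv f v q (x₀ + h • e) - ∑ i ∈ Finset.range m, h ^ i •
      ∑ j ∈ Finset.range m, (w j / i.factorial) • dirDeriv f (e + (j : ℝ) • v) i x₀))
      =O[𝓝 0] fun h => h ^ m := by
  have hpath : Tendsto (fun h : ℝ => (x₀ + h • e, h)) (𝓝 0) (𝓝 (x₀, 0)) := by
    have : Continuous (fun h : ℝ => (x₀ + h • e, h)) := by fun_prop
    simpa using this.tendsto 0
  have hconst : Tendsto (fun h : ℝ => (x₀, h)) (𝓝 0) (𝓝 (x₀, 0)) :=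
    (Continuous.prodMk_right x₀).tendsto 0
  have hdiff := (dirDeriv_finite_difference hf hp v hq hw x₀).comp_tendsto hpath
  have htaylor := seminorm_isBigO_sum_smul (s := Finset.range m) w fun j _ =>
    (dirDeriv_taylor hf hp (e + (j : ℝ) • v) m x₀).comp_tendsto hconst
  refine (seminorm_isBigO_sub htaylor hdiff).congr_left fun h => ?_
  have hpoint : ∀ j : ℕ, x₀ + h • e + ((j : ℝ) * h) • v = x₀ + h • (e + (j : ℝ) • v) := fun j => by
    rw [smul_add, smul_smul, add_assoc, mul_comm]
  have hswap : ∑ i ∈ Finset.range m, h ^ i •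
      ∑ j ∈ Finset.range m, (w j / i.factorial) • dirDeriv f (e + (j : ℝ) • v) i x₀
      = ∑ j ∈ Finset.range m, w j • ∑ k ∈ Finset.range m, (h ^ k / k.factorial) •
          dirDeriv f (e + (j : ℝ) • v) k x₀ := by
    simp only [Finset.smul_sum, smul_smul]
    rw [Finset.sum_comm]
    refine Finset.sum_congr rfl fun j _ => Finset.sum_congr rfl fun i _ => ?_
    congr 1
    ring
  simp only [hswap, hpoint, smul_sub, Finset.sum_sub_distrib]
  congr 1
  abel

theorem exists_hasCurveDerivAt_dirDeriv (hf : IsSmoothMap f) (v e : G) (q : ℕ) :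
    ∃ a : ℕ → ℝ, ∀ x₀ : G, HasCurveDerivAt (fun h : ℝ => dirDeriv f v q (x₀ + h • e))
      (∑ j ∈ Finset.range (q + 2), a j • dirDeriv f (e + (j : ℝ) • v) (q + 1) x₀) 0 := by
  obtain ⟨w, hw⟩ := exists_finite_difference_weights q (q + 2)
  exact ⟨fun j => w j / (q + 1).factorial, fun x₀ => hasCurveDerivAt_of_pow_smul_expansion
    (a := fun i => ∑ j ∈ Finset.range (q + 2),
      (w j / i.factorial) • dirDeriv f (e + (j : ℝ) • v) i x₀)
    (continuousAt_dirDeriv_line hf v e x₀ q)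
    fun p hp => dirDeriv_line_expansion hf hp v e (by omega) hw x₀⟩

theorem isSmoothCurve_dirDeriv (hf : IsSmoothMap f) (v e x₀ : G) (q : ℕ) :
    IsSmoothCurve (fun t : ℝ => dirDeriv f v q (x₀ + t • e)) := by
  refine isSmoothCurve_of_mem_span_of_derivClosed (S := {c | ∃ (v : G) (q : ℕ),
    c = fun t : ℝ => dirDeriv f v q (x₀ + t • e)}) ?_ (Submodule.subset_span ⟨v, q, rfl⟩)
  rintro _ ⟨v, q, rfl⟩
  obtain ⟨a, ha⟩ := exists_hasCurveDerivAt_dirDeriv hf v e q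
  refine ⟨∑ j ∈ Finset.range (q + 2), a j • fun t : ℝ =>
    dirDeriv f (e + (j : ℝ) • v) (q + 1) (x₀ + t • e), Submodule.sum_mem _ fun j _ =>
      Submodule.smul_mem _ _ (Submodule.subset_span ⟨_, _, rfl⟩), fun t => ?_⟩
  have hshift := HasCurveDerivAt.comp (γ := fun s => s - t) (t := t)
    (by simpa using ha (x₀ + t • e)) ((hasDerivAt_id t).sub_const t)
  have hline : ∀ s : ℝ, x₀ + t • e + (s - t) • e = x₀ + s • e := fun s => by
    rw [add_assoc, ← add_smul, add_sub_cancel]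
  simpa only [hline, one_smul, Finset.sum_apply, Pi.smul_apply] using hshift

end DirDeriv

theorem IsSmoothMap.curveDeriv_line {E F : Type*} [AddCommGroup E] [Module ℝ E]
    [TopologicalSpace E] [IsTopologicalAddGroup E] [ContinuousSMul ℝ E]
    [AddCommGroup F] [Module ℝ F] [TopologicalSpace F] [IsTopologicalAddGroup F]
    [ContinuousSMul ℝ F] [T2Space F] [LocallyConvexSpace ℝ F] {f : E → F} (hf : IsSmoothMap f)
    (v : E) : IsSmoothMap fun x => curveDeriv (fun t : ℝ => f (x + t • v)) 0 := by
  intro c hc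
  let g : ℝ × ℝ → F := fun z => f (c z.1 + z.2 • v)
  have hg : IsSmoothMap g := fun γ hγ => by
    have h₁ := isSmoothCurve_iff_contDiff.1 (hγ.map (ContinuousLinearMap.fst ℝ ℝ ℝ))
    have h₂ := isSmoothCurve_iff_contDiff.1 (hγ.map (ContinuousLinearMap.snd ℝ ℝ ℝ))
    exact hf _ ((hc.comp h₁).add ((IsSmoothCurve.const v).smul_comp h₂ h₁))
  convert isSmoothCurve_dirDeriv hg (0, 1) (1, 0) 0 1 using 1
  funext s
  simp [dirDeriv, g]

/-! ### Iterated differentials of smooth maps -/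

section IterDifferential

variable {E E' F G : Type*}
  [AddCommGroup E] [Module ℝ E]
  [AddCommGroup E'] [Module ℝ E']
  [AddCommGroup G] [Module ℝ G] [TopologicalSpace G]

theorem iterDifferential_congr {f : E → G} {g : E' → G} : ∀ {l : ℕ} {x : E} {x' : E'}
    {v : Fin l → E} {v' : Fin l → E'},
    (∀ t : Fin l → ℝ, f (x + ∑ i, t i • v i) = g (x' + ∑ i, t i • v' i)) →
    iterDifferential f l x v = iterDifferential g l x' v'
  | 0, x, x', v, v', h => by simpa [iterDifferential] using h 0
  | l + 1, x, x', v, v', h => by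
    unfold iterDifferential
    congr 1
    funext s
    refine iterDifferential_congr fun t => ?_
    have := h (Fin.cons s t)
    simpa [Fin.sum_univ_succ, Fin.tail, add_assoc] using this

theorem iterDifferential_comp_linearMap (f : E → G) (L : E' →ₗ[ℝ] E) (l : ℕ) (x : E')
    (v : Fin l → E') :
    iterDifferential (fun y => f (L y)) l x v = iterDifferential f l (L x) (fun i => L (v i)) :=
  iterDifferential_congr fun t => by simp only [map_add, map_sum, map_smul]

variable [TopologicalSpace E] [IsTopologicalAddGroup E] [ContinuousSMul ℝ E]
  [AddCommGroup F] [Module ℝ F] [TopologicalSpace F] [IsTopologicalAddGroup F]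
  [ContinuousSMul ℝ F] [T2Space F] [LocallyConvexSpace ℝ F] {f g : E → F}

theorem IsSmoothMap.iterDifferential (hf : IsSmoothMap f) : ∀ (l : ℕ) (v : Fin l → E),
    IsSmoothMap (fun x => iterDifferential f l x v)
  | 0, _ => hf
  | l + 1, v => (IsSmoothMap.iterDifferential hf l (Fin.tail v)).curveDeriv_line (v 0)

theorem IsSmoothMap.hasCurveDerivAt_iterDifferential (hf : IsSmoothMap f) (l : ℕ) (x : E)
    (v : Fin (l + 1) → E) : HasCurveDerivAt
      (fun t : ℝ => NonlinearExt.iterDifferential f l (x + t • v 0) (Fin.tail v))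
      (NonlinearExt.iterDifferential f (l + 1) x v) 0 :=
  ((hf.iterDifferential l (Fin.tail v)).line x (v 0)).hasCurveDerivAt 0

theorem iterDifferential_add (hf : IsSmoothMap f) (hg : IsSmoothMap g) :
    ∀ (l : ℕ) (x : E) (v : Fin l → E),
      iterDifferential (f + g) l x v = iterDifferential f l x v + iterDifferential g l x v
  | 0, _, _ => rfl
  | l + 1, x, v => by
    have h := (hf.hasCurveDerivAt_iterDifferential l x v).add
      (hg.hasCurveDerivAt_iterDifferential l x v)
    rw [← h.curveDeriv_eq, iterDifferential]
    congr 1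
    funext t
    exact iterDifferential_add hf hg l _ _

omit [TopologicalSpace E] [IsTopologicalAddGroup E] [ContinuousSMul ℝ E]
  [IsTopologicalAddGroup F] [ContinuousSMul ℝ F] [LocallyConvexSpace ℝ F] in
theorem iterDifferential_zero : ∀ (l : ℕ) (x : E) (v : Fin l → E),
      iterDifferential (0 : E → F) l x v = 0
  | 0, _, _ => rfl
  | l + 1, x, v => by
    rw [← (HasCurveDerivAt.const (0 : F) 0).curveDeriv_eq, iterDifferential]
    congr 1
    funext t
    exact iterDifferential_zero l _ _

omit [IsTopologicalAddGroup E] [ContinuousSMul ℝ E] [ContinuousSMul ℝ F]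
  [T2Space F] [LocallyConvexSpace ℝ F] in
theorem IsSmoothMap.sum {ι : Type*} (s : Finset ι) {f : ι → E → F}
    (hf : ∀ i ∈ s, IsSmoothMap (f i)) : IsSmoothMap (∑ i ∈ s, f i) :=
  Finset.sum_induction f IsSmoothMap (fun _ _ => IsSmoothMap.add) IsSmoothMap.zero hf

theorem iterDifferential_sum {ι : Type*} (s : Finset ι) {f : ι → E → F}
    (hf : ∀ i ∈ s, IsSmoothMap (f i)) (l : ℕ) (x : E) (v : Fin l → E) :
    iterDifferential (∑ i ∈ s, f i) l x v = ∑ i ∈ s, iterDifferential (f i) l x v := by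
  classical
  induction s using Finset.induction_on with
  | empty => simpa using iterDifferential_zero l x v
  | insert i s hi ih =>
    have hs : ∀ j ∈ s, IsSmoothMap (f j) := fun j hj => hf j (Finset.mem_insert_of_mem hj)
    rw [Finset.sum_insert hi, Finset.sum_insert hi,
      iterDifferential_add (hf i (Finset.mem_insert_self i s)) (IsSmoothMap.sum s hs), ih hs]

theorem iterDifferential_map [T2Space G] (hf : IsSmoothMap f) (L : F →L[ℝ] G) :
    ∀ (l : ℕ) (x : E) (v : Fin l → E),
      iterDifferential (fun x => L (f x)) l x v = L (iterDifferential f l x v)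
  | 0, _, _ => rfl
  | l + 1, x, v => by
    have h := (hf.hasCurveDerivAt_iterDifferential l x v).map L
    rw [← h.curveDeriv_eq, iterDifferential]
    congr 1
    funext t
    exact iterDifferential_map hf L l _ _

omit [IsTopologicalAddGroup E] [ContinuousSMul ℝ E] [IsTopologicalAddGroup F] [ContinuousSMul ℝ F]
  [T2Space F] [LocallyConvexSpace ℝ F] in
theorem IsSmoothMap.map (hf : IsSmoothMap f) (L : F →L[ℝ] G) :
    IsSmoothMap (fun x => L (f x)) :=
  fun c hc => (hf c hc).map L

omit [IsTopologicalAddGroup E] [ContinuousSMul ℝ E] [IsTopologicalAddGroup F] [ContinuousSMul ℝ F]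
  [T2Space F] [LocallyConvexSpace ℝ F] in
theorem IsSmoothMap.comp_clm [TopologicalSpace E'] (hf : IsSmoothMap f) (L : E' →L[ℝ] E) :
    IsSmoothMap (fun x => f (L x)) :=
  fun c hc => hf (fun s => L (c s)) (hc.map L)

end IterDifferential

instance continuousSMul_real {E : Type*} [AddCommGroup E] [Module ℂ E] [TopologicalSpace E]
    [ContinuousSMul ℂ E] : ContinuousSMul ℝ E :=
  IsScalarTower.continuousSMul ℂ

theorem iterDifferential_smul {E F : Type*} [AddCommGroup E] [Module ℝ E] [TopologicalSpace E]
    [IsTopologicalAddGroup E] [ContinuousSMul ℝ E]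
    [AddCommGroup F] [Module ℂ F] [TopologicalSpace F] [IsTopologicalAddGroup F]
    [ContinuousSMul ℂ F] [T2Space F] [LocallyConvexSpace ℝ F] {f : E → F} (hf : IsSmoothMap f)
    (a : ℂ) : ∀ (l : ℕ) (x : E) (v : Fin l → E),
      iterDifferential (a • f) l x v = a • iterDifferential f l x v
  | 0, _, _ => rfl
  | l + 1, x, v => by
    have h := (hf.hasCurveDerivAt_iterDifferential l x v).smul a
    rw [← h.curveDeriv_eq, iterDifferential]
    congr 1
    funext t
    exact iterDifferential_smul hf a l _ _

/-! ### Bounds of nets and approximations -/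

/-- A class of nets of real numbers that is stable under sums and domination. -/
structure IsBoundClass (P : (Eps → ℝ) → Prop) : Prop where
  zero : P 0
  add : ∀ f g, P f → P g → P (fun ε => ‖f ε‖ + ‖g ε‖)
  mono : ∀ f g, P g → f =O[epsZero] g → P f

/-- The nets bounded by a member of the growth scale. -/
def growthBound (A : Set (Eps → ℝ≥0)) (f : Eps → ℝ) : Prop :=
  ∃ a ∈ A, f =O[epsZero] (fun ε => (a ε : ℝ))

/-- The nets bounded by all members of the decay scale. -/
def decayBound (D : Set (Eps → ℝ≥0)) (f : Eps → ℝ) : Prop :=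
  ∀ a ∈ D, f =O[epsZero] (fun ε => (a ε : ℝ))

theorem isBoundClass_growthBound {A : Set (Eps → ℝ≥0)} (hne : A.Nonempty)
    (hadd : ∀ l ∈ A, ∀ m ∈ A, ∃ n ∈ A, BigO (fun ε => l ε + m ε) n) :
    IsBoundClass (growthBound A) where
  zero := hne.imp fun _ ha => ⟨ha, isBigO_zero _ _⟩
  add := by
    have isBigO_of_le : ∀ {a b : Eps → ℝ≥0}, a ≤ b → BigO a b := fun h =>
      IsBigO.of_norm_le fun ε => by
        simpa only [Real.norm_of_nonneg (NNReal.coe_nonneg _)] using NNReal.coe_le_coe.2 (h ε)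
    rintro f g ⟨a, ha, hfa⟩ ⟨b, hb, hgb⟩
    obtain ⟨n, hn, hO⟩ := hadd a ha b hb
    have han : BigO a n := (isBigO_of_le fun ε => le_self_add).trans hO
    have hbn : BigO b n := (isBigO_of_le fun ε => le_add_self).trans hO
    exact ⟨n, hn, (hfa.trans han).norm_left.add (hgb.trans hbn).norm_left⟩
  mono := fun f g ⟨a, ha, hga⟩ hfg => ⟨a, ha, hfg.trans hga⟩

theorem isBoundClass_decayBound (D : Set (Eps → ℝ≥0)) : IsBoundClass (decayBound D) where
  zero := fun _ _ => isBigO_zero _ _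
  add := fun _ _ hf hg a ha => (hf a ha).norm_left.add (hg a ha).norm_left
  mono := fun _ _ hg hfg a ha => hfg.trans (hg a ha)

theorem growthBound_of_decayBound {A D : Set (Eps → ℝ≥0)} (h : ∃ l ∈ A, ∃ m ∈ D, BigO m l)
    {f : Eps → ℝ} (hf : decayBound D f) : growthBound A f := by
  obtain ⟨l, hl, m, hm, hO⟩ := h
  exact ⟨l, hl, (hf m hm).trans hO⟩

theorem IsBoundClass.sum {P : (Eps → ℝ) → Prop} (hP : IsBoundClass P) {ι : Type*} (s : Finset ι)
    {f : ι → Eps → ℝ} (hf : ∀ i ∈ s, P (f i)) : P (fun ε => ∑ i ∈ s, ‖f i ε‖) := by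
  classical
  induction s using Finset.induction_on with
  | empty => simp only [Finset.sum_empty]; exact hP.zero
  | insert i s hi ih =>
    refine hP.mono _ _ (hP.add _ _ (hf i (Finset.mem_insert_self i s))
      (ih fun j hj => hf j (Finset.mem_insert_of_mem hj))) (IsBigO.of_bound 1
        (Eventually.of_forall fun ε => ?_))
    rw [Finset.sum_insert hi, one_mul,
      Real.norm_of_nonneg (Finset.sum_nonneg fun j _ => norm_nonneg (f j ε))]

section Nets

variable {F G : Type*}
  [AddCommGroup F] [Module ℂ F] [TopologicalSpace F]
  [AddCommGroup G] [Module ℂ G] [TopologicalSpace G]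
  {P : (Eps → ℝ) → Prop}

/-- All continuous seminorms of the net `x` are bounded in the sense of `P`. -/
def NetBound (P : (Eps → ℝ) → Prop) (x : Eps → F) : Prop :=
  ∀ p : Seminorm ℂ F, Continuous p → P (fun ε => p (x ε))

theorem NetBound.mono {Q : (Eps → ℝ) → Prop} (h : ∀ f, P f → Q f) {x : Eps → F}
    (hx : NetBound P x) : NetBound Q x :=
  fun p hp => h _ (hx p hp)

theorem NetBound.map {x : Eps → F} (hx : NetBound P x) (L : F →L[ℂ] G) :
    NetBound P (fun ε => L (x ε)) :=
  fun p hp => hx (p.comp (L : F →ₗ[ℂ] G)) (hp.comp L.continuous)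

theorem NetBound.congr (hP : IsBoundClass P) {x y : Eps → F} (hx : NetBound P x)
    (h : x =ᶠ[epsZero] y) : NetBound P y := fun p hp =>
  hP.mono _ _ (hx p hp) (EventuallyEq.isBigO (h.mono fun ε hε => by simp only [hε]))

theorem NetBound.zero (hP : IsBoundClass P) : NetBound P (fun _ => (0 : F)) := fun p _ => by
  simp only [map_zero]; exact hP.zero

theorem NetBound.add (hP : IsBoundClass P) {x y : Eps → F} (hx : NetBound P x)
    (hy : NetBound P y) : NetBound P (fun ε => x ε + y ε) := fun p hp =>
  hP.mono _ _ (hP.add _ _ (hx p hp) (hy p hp)) (IsBigO.of_bound 1 (Eventually.of_forall fun ε => by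
    rw [one_mul, Real.norm_of_nonneg (apply_nonneg p _), Real.norm_of_nonneg (apply_nonneg p _),
      Real.norm_of_nonneg (apply_nonneg p _),
      Real.norm_of_nonneg (add_nonneg (apply_nonneg p _) (apply_nonneg p _))]
    exact map_add_le_add p _ _))

theorem NetBound.smul (hP : IsBoundClass P) {x : Eps → F} (hx : NetBound P x) (a : ℂ) :
    NetBound P (fun ε => a • x ε) := fun p hp =>
  hP.mono _ _ (hx p hp) (IsBigO.of_bound ‖a‖ (Eventually.of_forall fun ε => by
    rw [map_smul_eq_mul, norm_mul, norm_norm]))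

theorem NetBound.neg (hP : IsBoundClass P) {x : Eps → F} (hx : NetBound P x) :
    NetBound P (fun ε => -x ε) := by
  simpa using hx.smul hP (-1)

theorem NetBound.sub (hP : IsBoundClass P) {x y : Eps → F} (hx : NetBound P x)
    (hy : NetBound P y) : NetBound P (fun ε => x ε - y ε) := by
  simpa [sub_eq_add_neg] using hx.add hP (hy.neg hP)

theorem NetBound.sum (hP : IsBoundClass P) {ι : Type*} (s : Finset ι) {x : ι → Eps → F}
    (hx : ∀ i ∈ s, NetBound P (x i)) : NetBound P (fun ε => ∑ i ∈ s, x i ε) := fun p hp =>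
  hP.mono _ _ (hP.sum s fun i hi => hx i hi p hp) (IsBigO.of_bound 1 (Eventually.of_forall
    fun ε => by
      rw [one_mul, Real.norm_of_nonneg (apply_nonneg p _),
        Real.norm_of_nonneg (Finset.sum_nonneg fun _ _ => norm_nonneg _)]
      refine (seminorm_sum_le p s _).trans (Finset.sum_le_sum fun i _ => le_abs_self _)))

open scoped ComplexOrder in
theorem polynormableSpace_complex [IsTopologicalAddGroup F] [ContinuousSMul ℂ F]
    [LocallyConvexSpace ℝ F] : PolynormableSpace ℂ F := by
  have : LocallyConvexSpace ℂ F := ⟨fun x => by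
    refine (LocallyConvexSpace.convex_basis (𝕜 := ℝ) x).to_hasBasis (fun s hs => ⟨s, ⟨hs.1, ?_⟩,
      le_rfl⟩) fun s hs => ⟨s, ⟨hs.1, hs.2.lift ℝ⟩, le_rfl⟩
    exact convex_of_nonneg_surjective_algebraMap _
      (fun z hz => by
        obtain ⟨r, hr, h⟩ := (RCLike.nonneg_iff_exists_ofReal (K := ℂ)).1 hz
        exact ⟨r, hr, h⟩) hs.2⟩
  infer_instance

section InducedFamily

variable {ι : Type*} {H : Type*} [AddCommGroup H] [Module ℂ H] [tH : TopologicalSpace H]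
  {G : ι → Type*} [∀ i, AddCommGroup (G i)] [∀ i, Module ℂ (G i)] [tG : ∀ i, TopologicalSpace (G i)]
  [∀ i, IsTopologicalAddGroup (G i)] [∀ i, ContinuousSMul ℂ (G i)]
  [∀ i, LocallyConvexSpace ℝ (G i)]

theorem exists_seminorm_le_mul_sum (L : ∀ i, H →ₗ[ℂ] G i)
    (htop : tH = ⨅ i, (tG i).induced (L i)) {p : Seminorm ℂ H} (hp : Continuous p) :
    ∃ (s : Finset (Σ i, {q : Seminorm ℂ (G i) // Continuous q})) (C : ℝ≥0),
      ∀ x, p x ≤ C * ∑ k ∈ s, k.2.1 (L k.1 x) := by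
  have hpoly : ∀ i, PolynormableSpace ℂ (G i) := fun i => polynormableSpace_complex
  have hw := withSeminorms_iInf (t := fun i => (tG i).induced (L i))
    (p := fun i => SeminormFamily.comp
      (fun p : {p : Seminorm ℂ (G i) // Continuous p} => p.1) (L i))
    fun i => (L i).withSeminorms_induced (PolynormableSpace.withSeminorms ℂ (G i))
  rw [← htop] at hw
  obtain ⟨s, C, -, hC⟩ := Seminorm.bound_of_continuous hw p hp
  refine ⟨s, C, fun x => (hC x).trans ?_⟩
  rw [smul_apply, NNReal.smul_def, smul_eq_mul]
  refine mul_le_mul_of_nonneg_left ?_ C.coe_nonneg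
  exact Seminorm.finset_sup_apply_le (Finset.sum_nonneg fun k _ => apply_nonneg k.2.1 _)
    fun k hk => Finset.single_le_sum (f := fun k : Σ i, {q : Seminorm ℂ (G i) // Continuous q} =>
      k.2.1 (L k.1 x)) (fun k _ => apply_nonneg k.2.1 _) hk

theorem NetBound.of_induced_iInf (hP : IsBoundClass P) (L : ∀ i, H →ₗ[ℂ] G i)
    (htop : tH = ⨅ i, (tG i).induced (L i)) {x : Eps → H}
    (hx : ∀ i, NetBound P (fun ε => L i (x ε))) : NetBound P x := by
  intro p hp
  obtain ⟨s, C, hC⟩ := exists_seminorm_le_mul_sum L htop hp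
  refine hP.mono _ _ (hP.sum s (f := fun k ε => k.2.1 (L k.1 (x ε))) fun k _ => hx k.1 k.2.1 k.2.2)
    (IsBigO.of_bound C (Eventually.of_forall fun ε => ?_))
  simpa only [Real.norm_of_nonneg (apply_nonneg _ _),
    Real.norm_of_nonneg (Finset.sum_nonneg fun _ _ => apply_nonneg _ _)] using hC (x ε)

end InducedFamily

end Nets

section Approximation

variable {E : Type v} {F : Type w}
  [AddCommGroup E] [Module ℂ E] [TopologicalSpace E]
  [AddCommGroup F] [Module ℂ F] [TopologicalSpace F] [IsTopologicalAddGroup F]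

theorem netBound_pointwise_iff [ContinuousSMul ℂ E] [ContinuousSMul ℂ F]
    [LocallyConvexSpace ℝ F] {P : (Eps → ℝ) → Prop} (hP : IsBoundClass P)
    (Φ : Eps → (E →L[ℂ] F)) :
    (∀ p : Seminorm ℂ (E →Lₚₜ[ℂ] F), Continuous p → P (fun ε =>
      p (ContinuousLinearMap.toPointwiseConvergenceCLM ℂ (RingHom.id ℂ) E F (Φ ε)))) ↔
    ∀ x : E, NetBound P (fun ε => Φ ε x) := by
  constructor
  · intro h x
    have hbound : NetBound P (fun ε =>
        ContinuousLinearMap.toPointwiseConvergenceCLM ℂ (RingHom.id ℂ) E F (Φ ε)) := h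
    exact hbound.map (PointwiseConvergenceCLM.evalCLM (RingHom.id ℂ) F x)
  · intro h
    refine NetBound.of_induced_iInf hP (fun x : E =>
      (PointwiseConvergenceCLM.evalCLM (RingHom.id ℂ) F x : (E →Lₚₜ[ℂ] F) →ₗ[ℂ] F)) ?_ h
    refine
      (PointwiseConvergenceCLM.isEmbedding_coeFn (RingHom.id ℂ) E F).isInducing.eq_induced.trans ?_
    rw [Pi.topologicalSpace, induced_iInf]
    simp only [induced_compose]
    rfl

/-- The net `Φ` of operators `E → F` approximates the pair of operators `k` on `F` and `K` on `E`
relative to the scales `A` and `D`; here `j : F → E` is the inclusion. The test objects are the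
approximations of `(id, id)` and the `0`-test objects those of `(0, 0)`. -/
structure IsApproximation (j : F →L[ℂ] E) (A D : Set (Eps → ℝ≥0)) (k : F →L[ℂ] F) (K : E →L[ℂ] E)
    (Φ : Eps → (E →L[ℂ] F)) : Prop where
  moderate : ∀ x, NetBound (growthBound A) (fun ε => Φ ε x)
  approx : ∀ s, NetBound (decayBound D) (fun ε => Φ ε (j s) - k s)
  tendsto : ∀ x, Tendsto (fun ε => j (Φ ε x)) epsZero (𝓝 (K x))

namespace IsApproximation

variable {A D : Set (Eps → ℝ≥0)} {j : F →L[ℂ] E} {k k₁ k₂ : F →L[ℂ] F} {K K₁ K₂ : E →L[ℂ] E}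
  {Φ Ψ : Eps → (E →L[ℂ] F)}

omit [IsTopologicalAddGroup F] in
theorem conj {E' F' : Type*} [AddCommGroup E'] [Module ℂ E'] [TopologicalSpace E']
    [AddCommGroup F'] [Module ℂ F'] [TopologicalSpace F']
    {j' : F' →L[ℂ] E'} {c : F' →L[ℂ] F} {C : E' →L[ℂ] E} {l : F →L[ℂ] F'} {L : E →L[ℂ] E'}
    (hc : C.comp j' = j.comp c) (hl : j'.comp l = L.comp j) (hΦ : IsApproximation j A D k K Φ) :
    IsApproximation j' A D (l.comp (k.comp c)) (L.comp (K.comp C))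
      (fun ε => l.comp ((Φ ε).comp C)) where
  moderate x := (hΦ.moderate (C x)).map l
  approx s := by
    have hcs : C (j' s) = j (c s) := DFunLike.congr_fun hc s
    simpa only [ContinuousLinearMap.comp_apply, hcs, map_sub] using (hΦ.approx (c s)).map l
  tendsto x := by
    have hls : ∀ y, j' (l y) = L (j y) := DFunLike.congr_fun hl
    simpa only [ContinuousLinearMap.comp_apply, hls, Function.comp_def]
      using L.continuous.continuousAt.tendsto.comp (hΦ.tendsto (C x))

variable [IsTopologicalAddGroup E]

theorem add (hA : IsBoundClass (growthBound A)) (hΦ : IsApproximation j A D k₁ K₁ Φ)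
    (hΨ : IsApproximation j A D k₂ K₂ Ψ) :
    IsApproximation j A D (k₁ + k₂) (K₁ + K₂) (fun ε => Φ ε + Ψ ε) where
  moderate x := (hΦ.moderate x).add hA (hΨ.moderate x)
  approx s := by
    simpa only [add_apply, add_sub_add_comm]
      using (hΦ.approx s).add (isBoundClass_decayBound D) (hΨ.approx s)
  tendsto x := by
    simpa only [add_apply, map_add] using (hΦ.tendsto x).add (hΨ.tendsto x)

theorem sub (hA : IsBoundClass (growthBound A)) (hΦ : IsApproximation j A D k₁ K₁ Φ)
    (hΨ : IsApproximation j A D k₂ K₂ Ψ) :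
    IsApproximation j A D (k₁ - k₂) (K₁ - K₂) (fun ε => Φ ε - Ψ ε) where
  moderate x := (hΦ.moderate x).sub hA (hΨ.moderate x)
  approx s := by
    simpa only [sub_apply, sub_sub_sub_comm]
      using (hΦ.approx s).sub (isBoundClass_decayBound D) (hΨ.approx s)
  tendsto x := by
    simpa only [sub_apply, map_sub] using (hΦ.tendsto x).sub (hΨ.tendsto x)

end IsApproximation

variable [IsTopologicalAddGroup E] [ContinuousSMul ℂ E] [ContinuousSMul ℂ F]
  [LocallyConvexSpace ℝ F]

theorem isTestObject_iff_isApproximation {A D : Set (Eps → ℝ≥0)}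
    (hA : IsBoundClass (growthBound A)) (j : F →L[ℂ] E) (Φ : Eps → (E →L[ℂ] F)) :
    IsTestObject j A D Φ ↔ IsApproximation j A D (.id ℂ F) (.id ℂ E) Φ := by
  have hmod := netBound_pointwise_iff hA Φ
  have happrox := netBound_pointwise_iff (isBoundClass_decayBound D) fun ε => (Φ ε).comp j - .id ℂ F
  have htend := PointwiseConvergenceCLM.tendsto_iff_forall_tendsto (p := epsZero)
    (a := fun ε => ContinuousLinearMap.toPointwiseConvergenceCLM ℂ (RingHom.id ℂ) E E
      (j.comp (Φ ε))) (a₀ := ContinuousLinearMap.toPointwiseConvergenceCLM ℂ (RingHom.id ℂ) E E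
      (ContinuousLinearMap.id ℂ E))
  exact ⟨fun h => ⟨hmod.1 h.moderate, happrox.1 h.approx, htend.1 h.tendsto_id⟩,
    fun h => ⟨hmod.2 h.moderate, happrox.2 h.approx, htend.2 h.tendsto⟩⟩

theorem isZeroTestObject_iff_isApproximation {A D : Set (Eps → ℝ≥0)}
    (hA : IsBoundClass (growthBound A)) (j : F →L[ℂ] E) (Φ : Eps → (E →L[ℂ] F)) :
    IsZeroTestObject j A D Φ ↔ IsApproximation j A D 0 0 Φ := by
  have hmod := netBound_pointwise_iff hA Φ
  have happrox := netBound_pointwise_iff (isBoundClass_decayBound D) fun ε => (Φ ε).comp j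
  have htend := PointwiseConvergenceCLM.tendsto_iff_forall_tendsto (p := epsZero)
    (a := fun ε => ContinuousLinearMap.toPointwiseConvergenceCLM ℂ (RingHom.id ℂ) E E
      (j.comp (Φ ε))) (a₀ := 0)
  refine ⟨fun h => ⟨hmod.1 h.moderate, fun s => ?_, htend.1 h.tendsto_zero⟩,
    fun h => ⟨hmod.2 h.moderate, happrox.2 fun s => ?_, htend.2 h.tendsto⟩⟩
  · simpa only [zero_apply, sub_zero, ContinuousLinearMap.comp_apply] using happrox.1 h.approx s
  · simpa only [zero_apply, sub_zero, ContinuousLinearMap.comp_apply] using h.approx s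

end Approximation

theorem exists_forall_lt_iff_eventually {Q : Eps → Prop} :
    (∃ ε₀ : Eps, ∀ ε < ε₀, Q ε) ↔ ∀ᶠ ε in epsZero, Q ε := by
  unfold epsZero
  rw [eventually_comap]
  constructor
  · rintro ⟨ε₀, h⟩
    filter_upwards [Ioo_mem_nhdsGT ε₀.2.1] with b hb a hab
    exact h a (by rw [← Subtype.coe_lt_coe, hab]; exact hb.2)
  · intro h
    obtain ⟨b, hb, hb'⟩ := (mem_nhdsGT_iff_exists_Ioo_subset' (zero_lt_one' ℝ)).1 h
    refine ⟨⟨min b 1, lt_min hb one_pos, min_le_right _ _⟩, fun ε hε => ?_⟩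
    exact hb' ⟨ε.2.1, (Subtype.coe_lt_coe.2 hε).trans_le (min_le_left _ _)⟩ ε rfl

/-! ### Sheaves, their endomorphisms and extension by zero -/

variable {X : Type u} [TopologicalSpace X]

/-- The covering of `V ⊔ W` by `V` and `W`, with an index type in the universe that the sheaf axioms
ask for. -/
def pairCover (V W : Opens X) (b : ULift.{u} Bool) : Opens X :=
  cond b.down V W

theorem iSup_pairCover (V W : Opens X) : ⨆ b, pairCover V W b = V ⊔ W := by
  simp only [pairCover, iSup_ulift, iSup_bool_eq, cond]

theorem pairCover_le {U V W : Opens X} (hV : V ≤ U) (hW : W ≤ U) : ∀ b, pairCover V W b ≤ U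
  | ⟨true⟩ => hV
  | ⟨false⟩ => hW

section LCSheafLemmas

variable (S : LCSheaf.{u, v} X)

namespace LCSheaf

theorem res_self_apply {U : Opens X} (s : S.Sec U) : S.res U U le_rfl s = s :=
  S.isSheaf.res_self U s

theorem res_res_apply {U V W : Opens X} (hVU : V ≤ U) (hWV : W ≤ V) (s : S.Sec U) :
    S.res V W hWV (S.res U V hVU s) = S.res U W (hWV.trans hVU) s :=
  S.isSheaf.res_res U V W hVU hWV s

theorem res_eq_zero_mono {U V W : Opens X} {s : S.Sec U} (hVU : V ≤ U) (hWV : W ≤ V)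
    (h : S.res U V hVU s = 0) : S.res U W (hWV.trans hVU) s = 0 := by
  rw [← S.res_res_apply hVU hWV, h, map_zero]

theorem eq_zero_of_locally {U : Opens X} (s : S.Sec U)
    (h : ∀ x ∈ U, ∃ (V : Opens X) (hV : V ≤ U), x ∈ V ∧ S.res U V hV s = 0) : s = 0 := by
  refine S.isSheaf.separated U {V : Opens X // ∃ hV : V ≤ U, S.res U V hV s = 0} (fun V => V.1)
    (fun V => V.2.1) ?_ s fun V => V.2.2
  intro x hx
  obtain ⟨V, hV, hxV, hs⟩ := h x hx
  exact Opens.mem_iSup.2 ⟨⟨V, hV, hs⟩, hxV⟩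

theorem ext_of_cover {U : Opens X} {ι : Type u} {c : ι → Opens X} (hc : ∀ i, c i ≤ U)
    (hU : U ≤ ⨆ i, c i) {s t : S.Sec U}
    (h : ∀ i, S.res U (c i) (hc i) s = S.res U (c i) (hc i) t) : s = t :=
  sub_eq_zero.1 (S.isSheaf.separated U ι c hc hU _ fun i =>
    ((S.res U (c i) (hc i)).map_sub s t).trans (sub_eq_zero.2 (h i)))

theorem ext_of_locally {U : Opens X} {s t : S.Sec U}
    (h : ∀ x ∈ U, ∃ (V : Opens X) (hV : V ≤ U), x ∈ V ∧ S.res U V hV s = S.res U V hV t) :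
    s = t := by
  refine sub_eq_zero.1 (S.eq_zero_of_locally _ fun x hx => ?_)
  obtain ⟨V, hV, hxV, hst⟩ := h x hx
  exact ⟨V, hV, hxV, by rw [map_sub, hst, sub_self]⟩

theorem exists_glue_clm {H : Type*} [AddCommGroup H] [Module ℂ H] [TopologicalSpace H]
    {U : Opens X} {ι : Type u} {c : ι → Opens X} (hc : ∀ i, c i ≤ U) (hU : U ≤ ⨆ i, c i)
    (L : ∀ i, H →L[ℂ] S.Sec (c i))
    (hL : ∀ i j h, S.res (c i) (c i ⊓ c j) inf_le_left (L i h)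
      = S.res (c j) (c i ⊓ c j) inf_le_right (L j h)) :
    ∃ M : H →L[ℂ] S.Sec U, ∀ i h, S.res U (c i) (hc i) (M h) = L i h := by
  choose M hM using fun h : H => S.isSheaf.glue U ι c hc hU (fun i => L i h) fun i j => hL i j h
  have hM' : ∀ h i, S.res U (c i) (hc i) (M h) = L i h := hM
  refine ⟨⟨⟨⟨M, fun a b => S.ext_of_cover hc hU fun i => ?_⟩,
    fun a b => S.ext_of_cover hc hU fun i => ?_⟩, ?_⟩, fun i h => hM' h i⟩
  · rw [map_add, hM', hM', hM', map_add]
  · change S.res U (c i) (hc i) (M (a • b)) = S.res U (c i) (hc i) (a • M b)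
    rw [map_smul, hM', hM', map_smul]
  · change Continuous M
    rw [S.projective U ι c hc hU, continuous_iInf_rng]
    intro i
    rw [continuous_induced_rng]
    exact (L i).continuous.congr fun h => (hM' h i).symm

theorem exists_glue_clm_two {H : Type*} [AddCommGroup H] [Module ℂ H] [TopologicalSpace H]
    {U V W : Opens X} (hV : V ≤ U) (hW : W ≤ U) (hU : U ≤ V ⊔ W)
    (L : H →L[ℂ] S.Sec V) (L' : H →L[ℂ] S.Sec W)
    (hL : ∀ h, S.res V (V ⊓ W) inf_le_left (L h) = S.res W (V ⊓ W) inf_le_right (L' h)) :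
    ∃ M : H →L[ℂ] S.Sec U, (∀ h, S.res U V hV (M h) = L h) ∧ ∀ h, S.res U W hW (M h) = L' h := by
  have hswap : ∀ h, S.res W (W ⊓ V) inf_le_left (L' h) = S.res V (W ⊓ V) inf_le_right (L h) := by
    intro h
    have := congrArg (S.res (V ⊓ W) (W ⊓ V) (inf_comm W V).le) (hL h)
    rw [S.res_res_apply, S.res_res_apply] at this
    exact this.symm
  obtain ⟨M, hM⟩ := S.exists_glue_clm (c := pairCover V W) (pairCover_le hV hW)
    (hU.trans (iSup_pairCover V W).ge)
    (fun | ⟨true⟩ => L | ⟨false⟩ => L')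
    (by
      rintro ⟨_ | _⟩ ⟨_ | _⟩ h
      exacts [rfl, hswap h, hL h, rfl])
  exact ⟨M, hM ⟨true⟩, hM ⟨false⟩⟩

theorem netBound_of_cover {P : (Eps → ℝ) → Prop} (hP : IsBoundClass P) {U : Opens X} {ι : Type u}
    {c : ι → Opens X} (hc : ∀ i, c i ≤ U) (hU : U ≤ ⨆ i, c i) {s : Eps → S.Sec U}
    (h : ∀ i, NetBound P (fun ε => S.res U (c i) (hc i) (s ε))) : NetBound P s :=
  NetBound.of_induced_iInf hP (fun i => (S.res U (c i) (hc i) : S.Sec U →ₗ[ℂ] S.Sec (c i)))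
    (S.projective U ι c hc hU) h

theorem tendsto_of_cover {α : Type*} {l : Filter α} {U : Opens X} {ι : Type u}
    {c : ι → Opens X} (hc : ∀ i, c i ≤ U) (hU : U ≤ ⨆ i, c i) {s : α → S.Sec U} {t : S.Sec U}
    (h : ∀ i, Tendsto (fun a => S.res U (c i) (hc i) (s a)) l (𝓝 (S.res U (c i) (hc i) t))) :
    Tendsto s l (𝓝 t) := by
  have hnhds : 𝓝 t = ⨅ i, comap (S.res U (c i) (hc i)) (𝓝 (S.res U (c i) (hc i) t)) := by
    refine (congrArg (fun τ => @nhds _ τ t) (S.projective U ι c hc hU)).trans ?_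
    simp only [nhds_iInf, nhds_induced]
  rw [hnhds, tendsto_iInf]
  exact fun i => tendsto_comap_iff.2 (h i)

theorem netBound_of_locally {P : (Eps → ℝ) → Prop} (hP : IsBoundClass P) {U : Opens X}
    {s : Eps → S.Sec U}
    (h : ∀ x ∈ U, ∃ (V : Opens X) (hV : V ≤ U), x ∈ V ∧ NetBound P (fun ε => S.res U V hV (s ε))) :
    NetBound P s := by
  refine S.netBound_of_cover hP (ι := {V : Opens X // ∃ hV : V ≤ U,
    NetBound P (fun ε => S.res U V hV (s ε))}) (c := Subtype.val) (fun V => V.2.1) ?_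
    fun V => V.2.2
  intro x hx
  obtain ⟨V, hV, hxV, hs⟩ := h x hx
  exact Opens.mem_iSup.2 ⟨⟨V, hV, hs⟩, hxV⟩

theorem hasCurveDerivAt_res {V W : Opens X} (hWV : W ≤ V) {a : ℝ → S.Sec V} {b : S.Sec V} {t : ℝ}
    (h : HasCurveDerivAt a b t) :
    HasCurveDerivAt (fun s => S.res V W hWV (a s)) (S.res V W hWV b) t :=
  h.map ((S.res V W hWV).restrictScalars ℝ)

theorem hasCurveDerivAt_of_cover {U : Opens X} {ι : Type u} {c : ι → Opens X}
    (hc : ∀ i, c i ≤ U) (hU : U ≤ ⨆ i, c i) {a : ℝ → S.Sec U} {b : S.Sec U} {t : ℝ}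
    (h : ∀ i, HasCurveDerivAt (fun s => S.res U (c i) (hc i) (a s)) (S.res U (c i) (hc i) b) t) :
    HasCurveDerivAt a b t := by
  refine S.tendsto_of_cover hc hU fun i => Tendsto.congr (fun s => ?_) (h i)
  simp only [slope, vsub_eq_sub, ← map_sub]
  exact (((S.res U (c i) (hc i)).restrictScalars ℝ).map_smul _ _).symm

theorem res_inf_eq_of_hasCurveDerivAt {ι : Type*} {c : ι → Opens X}
    {d : ∀ i, ℕ → ℝ → S.Sec (c i)}
    (hd : ∀ i n t, HasCurveDerivAt (d i n) (d i (n + 1) t) t)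
    (h0 : ∀ t i j, S.res (c i) (c i ⊓ c j) inf_le_left (d i 0 t)
      = S.res (c j) (c i ⊓ c j) inf_le_right (d j 0 t)) (n : ℕ) :
    ∀ t i j, S.res (c i) (c i ⊓ c j) inf_le_left (d i n t)
      = S.res (c j) (c i ⊓ c j) inf_le_right (d j n t) := by
  induction n with
  | zero => exact h0
  | succ n ih =>
    intro t i j
    have hres := S.hasCurveDerivAt_res (inf_le_left : c i ⊓ c j ≤ c i) (hd i n t)
    rw [funext fun s => ih s i j] at hres
    exact hres.unique (S.hasCurveDerivAt_res (inf_le_right : c i ⊓ c j ≤ c j) (hd j n t))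

theorem isSmoothCurve_of_cover {U : Opens X} {ι : Type u} {c : ι → Opens X}
    (hc : ∀ i, c i ≤ U) (hU : U ≤ ⨆ i, c i) {γ : ℝ → S.Sec U}
    (h : ∀ i, IsSmoothCurve (fun t => S.res U (c i) (hc i) (γ t))) : IsSmoothCurve γ := by
  choose d hd0 hd using h
  have hcompat := S.res_inf_eq_of_hasCurveDerivAt hd fun t i j => by
    simp only [hd0, S.res_res_apply]
  choose e he using fun n t => S.isSheaf.glue U ι c hc hU (fun i => d i n t) (hcompat n t)
  have hres : ∀ n t i, S.res U (c i) (hc i) (e n t) = d i n t := he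
  refine ⟨e, funext fun t => S.ext_of_cover hc hU fun i => ?_, fun n t =>
    S.hasCurveDerivAt_of_cover hc hU fun i => ?_⟩
  · rw [hres, hd0]
  · simpa only [hres] using hd i n t

theorem isSmoothMap_of_cover {H : Type*} [AddCommGroup H] [Module ℝ H] [TopologicalSpace H]
    {U : Opens X} {f : H → S.Sec U} {ι : Type u} {c : ι → Opens X} (hc : ∀ i, c i ≤ U)
    (hU : U ≤ ⨆ i, c i) (h : ∀ i, IsSmoothMap (fun y => S.res U (c i) (hc i) (f y))) :
    IsSmoothMap f :=
  fun γ hγ => S.isSmoothCurve_of_cover hc hU fun i => h i γ hγ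

end LCSheaf

namespace SheafEnd

variable {S} {U : Opens X} (θ : SheafEnd S U)

/-- The largest open subset of `U` on which an endomorphism of `S|_U` vanishes. -/
def zeroSet : Opens X := sSup {V | V ≤ U ∧ θ.VanishesOn V}

theorem mem_zeroSet_iff {x : X} : x ∈ θ.zeroSet ↔ x ∈ U ∧ x ∉ θ.supp := by
  constructor
  · intro hx
    obtain ⟨V, ⟨hVU, hV⟩, hxV⟩ := Opens.mem_sSup.1 hx
    exact ⟨hVU hxV, fun hs => hs.2 V hVU hV hxV⟩
  · rintro ⟨hxU, hx⟩
    have : ¬ ∀ V : Opens X, V ≤ U → θ.VanishesOn V → x ∉ V := fun h => hx ⟨hxU, h⟩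
    push Not at this
    obtain ⟨V, hVU, hV, hxV⟩ := this
    exact Opens.mem_sSup.2 ⟨V, ⟨hVU, hV⟩, hxV⟩

theorem le_sup_zeroSet {V : Opens X} (h : θ.supp ⊆ V) : U ≤ V ⊔ θ.zeroSet := fun _ hx =>
  (em _).imp_right fun hxV => θ.mem_zeroSet_iff.2 ⟨hx, fun hs => hxV (h hs)⟩

theorem le_zeroSet_of_disjoint {V : Opens X} (hVU : V ≤ U) (h : Disjoint θ.supp V) :
    V ≤ θ.zeroSet := fun _ hx =>
  θ.mem_zeroSet_iff.2 ⟨hVU hx, fun hs => Set.disjoint_left.1 h hs hx⟩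

theorem map_eq_zero_of_le {W : Opens X} (hWU : W ≤ U) (hW : W ≤ θ.zeroSet) (s : S.Sec W) :
    θ.map W hWU s = 0 := by
  refine S.eq_zero_of_locally _ fun x hx => ?_
  obtain ⟨V, ⟨-, hV⟩, hxV⟩ := Opens.mem_sSup.1 (hW hx)
  refine ⟨W ⊓ V, inf_le_left, ⟨hx, hxV⟩, ?_⟩
  rw [θ.comm, hV (W ⊓ V) (inf_le_left.trans hWU) inf_le_right]
  rfl

theorem exists_extension {O Q : Opens X} (hO : O ≤ U) (h : O ≤ Q ⊔ θ.zeroSet) :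
    ∃ M : S.Sec Q →L[ℂ] S.Sec O,
      (∀ s, S.res O (O ⊓ Q) inf_le_left (M s)
        = θ.map (O ⊓ Q) (inf_le_left.trans hO) (S.res Q (O ⊓ Q) inf_le_right s)) ∧
      ∀ s, S.res O (O ⊓ θ.zeroSet) inf_le_left (M s) = 0 := by
  refine S.exists_glue_clm_two (U := O) (V := O ⊓ Q) (W := O ⊓ θ.zeroSet) inf_le_left inf_le_left
    (by rw [← inf_sup_left]; exact le_inf le_rfl h)
    ((θ.map (O ⊓ Q) (inf_le_left.trans hO)).comp (S.res Q (O ⊓ Q) inf_le_right)) 0 fun s => ?_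
  rw [ContinuousLinearMap.comp_apply, θ.comm, zero_apply, map_zero]
  exact θ.map_eq_zero_of_le _ (inf_le_right.trans inf_le_right) _

/-- Apply an endomorphism with support (within `O`) in `Q` to a section over `Q` and extend the
result by zero to `O`. -/
noncomputable def extend {O Q : Opens X} (hO : O ≤ U) (h : O ≤ Q ⊔ θ.zeroSet) :
    S.Sec Q →L[ℂ] S.Sec O :=
  Classical.choose (θ.exists_extension hO h)

variable {θ} {O Q : Opens X} {hO : O ≤ U} {h : O ≤ Q ⊔ θ.zeroSet}

theorem res_extend (s : S.Sec Q) {W : Opens X} (hWO : W ≤ O) (hWQ : W ≤ Q) :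
    S.res O W hWO (θ.extend hO h s) = θ.map W (hWO.trans hO) (S.res Q W hWQ s) := by
  have hspec := (Classical.choose_spec (θ.exists_extension hO h)).1 s
  have hres := congrArg (S.res (O ⊓ Q) W (le_inf hWO hWQ)) hspec
  rwa [S.res_res_apply, θ.comm, S.res_res_apply] at hres

theorem res_extend_zero (s : S.Sec Q) {W : Opens X} (hWO : W ≤ O) (hW : W ≤ θ.zeroSet) :
    S.res O W hWO (θ.extend hO h s) = 0 := by
  have hspec := (Classical.choose_spec (θ.exists_extension hO h)).2 s
  have hres := congrArg (S.res (O ⊓ θ.zeroSet) W (le_inf hWO hW)) hspec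
  rwa [S.res_res_apply, map_zero] at hres

theorem extend_unique {s : S.Sec Q} {t : S.Sec O}
    (hQ : S.res O (O ⊓ Q) inf_le_left t
      = θ.map (O ⊓ Q) (inf_le_left.trans hO) (S.res Q (O ⊓ Q) inf_le_right s))
    (hZ : S.res O (O ⊓ θ.zeroSet) inf_le_left t = 0) : t = θ.extend hO h s := by
  refine S.ext_of_locally fun x hx => ?_
  rcases h hx with hxQ | hxZ
  · exact ⟨O ⊓ Q, inf_le_left, ⟨hx, hxQ⟩, by rw [hQ, res_extend _ inf_le_left inf_le_right]⟩
  · exact ⟨O ⊓ θ.zeroSet, inf_le_left, ⟨hx, hxZ⟩, by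
      rw [hZ, res_extend_zero _ inf_le_left inf_le_right]⟩

theorem res_extend_eq_zero {s : S.Sec Q} {W Q' : Opens X} (hWO : W ≤ O) (hQ' : Q' ≤ Q)
    (hW : W ≤ Q' ⊔ θ.zeroSet) (hs : S.res Q Q' hQ' s = 0) :
    S.res O W hWO (θ.extend hO h s) = 0 := by
  refine S.eq_zero_of_locally _ fun x hx => ?_
  rcases hW hx with hxQ | hxZ
  · refine ⟨W ⊓ Q', inf_le_left, ⟨hx, hxQ⟩, ?_⟩
    rw [S.res_res_apply, res_extend s (inf_le_left.trans hWO) (inf_le_right.trans hQ'),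
      S.res_eq_zero_mono hQ' inf_le_right hs, map_zero]
  · refine ⟨W ⊓ θ.zeroSet, inf_le_left, ⟨hx, hxZ⟩, ?_⟩
    rw [S.res_res_apply, res_extend_zero s _ inf_le_right]

theorem res_extend_eq_zero_of_inf {s : S.Sec Q} {W : Opens X} (hWO : W ≤ O)
    (hs : S.res Q (W ⊓ Q) inf_le_right s = 0) : S.res O W hWO (θ.extend hO h s) = 0 := by
  refine res_extend_eq_zero hWO inf_le_right ?_ hs
  calc W ≤ W ⊓ (Q ⊔ θ.zeroSet) := le_inf le_rfl (hWO.trans h)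
    _ = W ⊓ Q ⊔ W ⊓ θ.zeroSet := inf_sup_left _ _ _
    _ ≤ W ⊓ Q ⊔ θ.zeroSet := sup_le_sup_left inf_le_right _

theorem res_extend_res {s : S.Sec Q} {W Q' : Opens X} (hWO : W ≤ O) (hQ' : Q' ≤ Q)
    (hW : W ≤ Q' ⊔ θ.zeroSet) :
    S.res O W hWO (θ.extend hO h s)
      = θ.extend (hWO.trans hO) hW (S.res Q Q' hQ' s) := by
  refine extend_unique ?_ ?_
  · rw [S.res_res_apply, res_extend s _ (inf_le_right.trans hQ'), S.res_res_apply]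
  · rw [S.res_res_apply, res_extend_zero s _ inf_le_right]

theorem map_eq_extend {t : S.Sec O} {V : Opens X} {r : S.Sec V} (hOV : O ≤ V) (hQV : Q ≤ V)
    (hr : S.res V O hOV r = t) :
    θ.map O hO t = θ.extend hO h (S.res V Q hQV r) := by
  subst hr
  refine extend_unique ?_ ?_
  · rw [θ.comm, S.res_res_apply, S.res_res_apply]
  · rw [θ.comm]
    exact θ.map_eq_zero_of_le _ inf_le_right _

end SheafEnd

end LCSheafLemmas

theorem CompactlyIn.mono {V U U' : Opens X} (h : CompactlyIn V U) (hU : U ≤ U') :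
    CompactlyIn V U' :=
  ⟨h.1.trans hU, h.2⟩

theorem CompactlyIn.sup {V W U : Opens X} (hV : CompactlyIn V U) (hW : CompactlyIn W U) :
    CompactlyIn (V ⊔ W) U := by
  rw [CompactlyIn, Opens.coe_sup, closure_union]
  exact ⟨Set.union_subset hV.1 hW.1, hV.2.union hW.2⟩

theorem CompactlyIn.finset_sup {ι : Type*} {W : ι → Opens X} {U : Opens X} {J : Finset ι}
    (h : ∀ i ∈ J, CompactlyIn (W i) U) : CompactlyIn (J.sup W) U :=
  Finset.sup_induction (p := fun V => CompactlyIn V U)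
    ⟨by simp only [Opens.coe_bot, closure_empty, Set.empty_subset],
      by simp only [Opens.coe_bot, closure_empty, isCompact_empty]⟩
    (fun _ hV _ hW => hV.sup hW) h

theorem exists_compactlyIn_of_isCompact [T2Space X] [LocallyCompactSpace X] {K : Set X}
    (hK : IsCompact K) {U : Opens X} (hKU : K ⊆ U) : ∃ W : Opens X, K ⊆ W ∧ CompactlyIn W U := by
  obtain ⟨L, hL, hKL, hLU⟩ := exists_compact_between hK U.isOpen hKU
  have hcl : closure (interior L) ⊆ L := hL.isClosed.closure_subset_iff.2 interior_subset
  exact ⟨⟨interior L, isOpen_interior⟩, hKL, hcl.trans hLU,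
    hL.of_isClosed_subset isClosed_closure hcl⟩

theorem CompactlyIn.exists_between [T2Space X] [LocallyCompactSpace X] {V U : Opens X}
    (h : CompactlyIn V U) : ∃ W : Opens X, CompactlyIn V W ∧ CompactlyIn W U := by
  obtain ⟨W, hVW, hWU⟩ := exists_compactlyIn_of_isCompact h.2 h.1
  exact ⟨W, ⟨hVW, h.2⟩, hWU⟩

theorem CompactlyIn.exists_le_sup [T2Space X] [LocallyCompactSpace X] {W B N Z : Opens X}
    (h : CompactlyIn W B) (hB : B ≤ N ⊔ Z) :
    ∃ W' : Opens X, CompactlyIn W' (N ⊓ B) ∧ W ≤ W' ⊔ Z := by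
  obtain ⟨W', hW', hW'N⟩ := exists_compactlyIn_of_isCompact (U := N ⊓ B)
    (h.2.diff Z.isOpen) fun x hx => ⟨(hB (h.1 hx.1)).resolve_right hx.2, h.1 hx.1⟩
  exact ⟨W', hW'N, fun x hx => or_iff_not_imp_right.2 fun hxZ => hW' ⟨subset_closure hx, hxZ⟩⟩

theorem exists_compactlyIn_of_mem [T2Space X] [LocallyCompactSpace X] {x : X} {U : Opens X}
    (hx : x ∈ U) : ∃ W : Opens X, x ∈ W ∧ CompactlyIn W U := by
  obtain ⟨W, hxW, hWU⟩ := exists_compactlyIn_of_isCompact isCompact_singleton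
    (Set.singleton_subset_iff.2 hx : {x} ⊆ (U : Set X))
  exact ⟨W, Set.singleton_subset_iff.1 hxW, hWU⟩

/-! ### Cutoffs and the transfer of test objects -/

namespace TestPair

variable {E : LCSheaf.{u, v} X} {F : LCSheaf.{u, w} X} (T : TestPair E F)

/-- `θ` is the restriction of `η` to the subsheaf `F`. -/
def Restricts {U : Opens X} (η : SheafEnd E U) (θ : SheafEnd F U) : Prop :=
  ∀ (V : Opens X) (hVU : V ≤ U) (s : F.Sec V),
    T.incl V (θ.map V hVU s) = η.map V hVU (T.incl V s)

variable {T} in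
theorem Restricts.zeroSet_le {U : Opens X} {η : SheafEnd E U} {θ : SheafEnd F U}
    (h : T.Restricts η θ) : η.zeroSet ≤ θ.zeroSet := by
  refine sSup_le fun V hV => le_sSup ⟨hV.1, fun W hWU hWV => ?_⟩
  ext s
  apply T.incl_injective
  rw [h, hV.2 W hWU hWV, zero_apply, zero_apply, map_zero]

variable {T} in
theorem Restricts.incl_extend {U : Opens X} {η : SheafEnd E U} {θ : SheafEnd F U}
    (h : T.Restricts η θ) {O Q : Opens X} (hO : O ≤ U) (hη : O ≤ Q ⊔ η.zeroSet)
    (hθ : O ≤ Q ⊔ θ.zeroSet) (s : F.Sec Q) :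
    T.incl O (θ.extend hO hθ s) = η.extend hO hη (T.incl Q s) := by
  refine SheafEnd.extend_unique ?_ ?_
  · rw [T.incl_res, SheafEnd.res_extend s inf_le_left inf_le_right, h, T.incl_res]
  · rw [T.incl_res, SheafEnd.res_extend_zero s inf_le_left (inf_le_right.trans h.zeroSet_le),
      map_zero]

theorem exists_partition_pair {A B C : Opens X} (hAB : A ≤ B) (hCB : C ≤ B) (hB : B ≤ A ⊔ C) :
    ∃ (η η' : SheafEnd E B) (θ : SheafEnd F B), T.Restricts η θ ∧ η.supp ⊆ A ∧ η'.supp ⊆ C ∧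
      ∀ (W : Opens X) (hW : W ≤ B), W ≤ η'.zeroSet → ∀ s, η.map W hW s = s := by
  obtain ⟨η, hη, hsupp, -, hsum⟩ := T.partition B (ULift.{u} Bool) (pairCover A C)
    (pairCover_le hAB hCB) (hB.trans (iSup_pairCover A C).ge)
  obtain ⟨θ, hθ⟩ := hη ⟨true⟩
  refine ⟨η ⟨true⟩, η ⟨false⟩, θ, hθ, hsupp ⟨true⟩, hsupp ⟨false⟩, fun W hW hWz s => ?_⟩
  refine (Finset.sum_singleton _ _).symm.trans (hsum W hW {⟨true⟩} ?_ s)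
  rintro ⟨_ | _⟩ hb
  · exact Set.disjoint_left.2 fun x hx hxW => ((η ⟨false⟩).mem_zeroSet_iff.1 (hWz hxW)).2 hx
  · exact absurd (Finset.mem_singleton_self _) hb

/-- Multiplication of sections over `A` by a cutoff function that is `1` on `N` and has support in
`A`, with values in the sections over `B`. -/
structure Cutoff (A B N : Opens X) where
  le : A ≤ B
  subset : N ≤ A
  mapE : E.Sec A →L[ℂ] E.Sec B
  mapF : F.Sec A →L[ℂ] F.Sec B
  incl_map : ∀ s, T.incl B (mapF s) = mapE (T.incl A s)
  res_mapE : ∀ s, E.res B N (subset.trans le) (mapE s) = E.res A N subset s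
  res_mapF : ∀ s, F.res B N (subset.trans le) (mapF s) = F.res A N subset s
  localE : ∀ (O : Opens X) (hO : O ≤ B) (s : E.Sec A), E.res A (O ⊓ A) inf_le_right s = 0 →
    E.res B O hO (mapE s) = 0
  localF : ∀ (O : Opens X) (hO : O ≤ B) (s : F.Sec A), F.res A (O ⊓ A) inf_le_right s = 0 →
    F.res B O hO (mapF s) = 0

theorem exists_cutoff {A B C : Opens X} (hAB : A ≤ B) (hCB : C ≤ B) (hB : B ≤ A ⊔ C) :
    ∃ N : Opens X, B ≤ N ⊔ C ∧ Nonempty (T.Cutoff A B N) := by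
  obtain ⟨η, η', θ, hθ, hη, hη', hid⟩ := T.exists_partition_pair hAB hCB hB
  have hA : B ≤ A ⊔ η.zeroSet := η.le_sup_zeroSet hη
  have hAθ : B ≤ A ⊔ θ.zeroSet := hA.trans (sup_le_sup_left hθ.zeroSet_le _)
  have hN : A ⊓ η'.zeroSet ≤ B := inf_le_left.trans hAB
  refine ⟨A ⊓ η'.zeroSet, ?_, ⟨{
    le := hAB
    subset := inf_le_left
    mapE := η.extend le_rfl hA
    mapF := θ.extend le_rfl hAθ
    incl_map := fun s => hθ.incl_extend _ _ _ s
    res_mapE := fun s => ?_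
    res_mapF := fun s => T.incl_injective _ ?_
    localE := fun O hO s hs => SheafEnd.res_extend_eq_zero_of_inf hO hs
    localF := fun O hO s hs => SheafEnd.res_extend_eq_zero_of_inf hO hs }⟩⟩
  · rw [sup_inf_right, sup_comm η'.zeroSet]
    exact le_inf hB (η'.le_sup_zeroSet hη')
  · rw [SheafEnd.res_extend s hN inf_le_left, hid _ hN inf_le_right]
  · rw [SheafEnd.res_extend s hN inf_le_left, hθ, hid _ hN inf_le_right]

theorem exists_cutoff_of_isCompact [T2Space X] {A B : Opens X} (hAB : A ≤ B) {K : Set X}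
    (hK : IsCompact K) (hKA : K ⊆ A) :
    ∃ N : Opens X, K ⊆ N ∧ Nonempty (T.Cutoff A B N) := by
  obtain ⟨N, hN, hc⟩ := T.exists_cutoff (C := ⟨B ∩ Kᶜ, B.isOpen.inter hK.isClosed.isOpen_compl⟩)
    hAB (fun x hx => hx.1) fun x hx => (em (x ∈ K)).imp (@hKA x) fun hxK => ⟨hx, hxK⟩
  exact ⟨N, fun x hx => (hN (hAB (hKA hx))).resolve_right fun h => h.2 hx, hc⟩

section Truncation

variable {T} {A B N U : Opens X} (e : T.Cutoff A B N) (hAU : A ≤ U)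

/-- The product of a section over `U ⊇ A` of `E` with a cutoff function supported in `A`, as a
section over `B`. -/
noncomputable def Cutoff.truncE : E.Sec U →L[ℂ] E.Sec B :=
  e.mapE.comp (E.res U A hAU)

/-- The product of a section over `U ⊇ A` of `F` with a cutoff function supported in `A`, as a
section over `B`. -/
noncomputable def Cutoff.truncF : F.Sec U →L[ℂ] F.Sec B :=
  e.mapF.comp (F.res U A hAU)

namespace Cutoff

theorem incl_comp_truncF : (T.incl B).comp (e.truncF hAU) = (e.truncE hAU).comp (T.incl U) :=
  ContinuousLinearMap.ext fun s =>
    (e.incl_map _).trans (congrArg e.mapE (T.incl_res U A hAU s).symm)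

theorem res_truncE {W : Opens X} (hWN : W ≤ N) (s : E.Sec U) :
    E.res B W (hWN.trans (e.subset.trans e.le)) (e.truncE hAU s)
      = E.res U W (hWN.trans (e.subset.trans hAU)) s := by
  rw [← E.res_res_apply (e.subset.trans e.le) hWN, truncE, ContinuousLinearMap.comp_apply,
    e.res_mapE, E.res_res_apply, E.res_res_apply]

theorem res_truncF {W : Opens X} (hWN : W ≤ N) (s : F.Sec U) :
    F.res B W (hWN.trans (e.subset.trans e.le)) (e.truncF hAU s)
      = F.res U W (hWN.trans (e.subset.trans hAU)) s := by
  rw [← F.res_res_apply (e.subset.trans e.le) hWN, truncF, ContinuousLinearMap.comp_apply,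
    e.res_mapF, F.res_res_apply, F.res_res_apply]

theorem res_truncE_eq_zero {O : Opens X} (hO : O ≤ B) {s : E.Sec U}
    (hs : E.res U (O ⊓ A) (inf_le_right.trans hAU) s = 0) : E.res B O hO (e.truncE hAU s) = 0 :=
  e.localE O hO _ ((E.res_res_apply hAU inf_le_right s).trans hs)

theorem res_truncF_eq_zero {O : Opens X} (hO : O ≤ B) {s : F.Sec U}
    (hs : F.res U (O ⊓ A) (inf_le_right.trans hAU) s = 0) : F.res B O hO (e.truncF hAU s) = 0 :=
  e.localF O hO _ ((F.res_res_apply hAU inf_le_right s).trans hs)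

variable {A' N' V : Opens X} (e' : T.Cutoff A' U N') (hA'V : A' ≤ V) (hAN' : A ≤ N')

theorem truncE_comp_truncE : (e.truncE (hAN'.trans (e'.subset.trans e'.le))).comp (e'.truncE hA'V)
    = e.truncE (hAN'.trans (e'.subset.trans hA'V)) :=
  ContinuousLinearMap.ext fun s => congrArg e.mapE (e'.res_truncE hA'V hAN' s)

theorem truncF_comp_truncF : (e.truncF (hAN'.trans (e'.subset.trans e'.le))).comp (e'.truncF hA'V)
    = e.truncF (hAN'.trans (e'.subset.trans hA'V)) :=
  ContinuousLinearMap.ext fun s => congrArg e.mapF (e'.res_truncF hA'V hAN' s)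

end Cutoff

end Truncation

theorem isLocalizing_iff {U : Opens X} {Φ : Eps → T.RO U} : T.IsLocalizing U Φ ↔
    ∀ (V V₀ : Opens X) (hV : CompactlyIn V V₀) (hV₀ : CompactlyIn V₀ U),
      ∀ᶠ ε in epsZero, ∀ s : E.Sec U, E.res U V₀ hV₀.le s = 0 →
        F.res U V (hV.le.trans hV₀.le) (Φ ε s) = 0 :=
  forall₄_congr fun _ _ _ _ => exists_forall_lt_iff_eventually

theorem IsLocalizing.add {U : Opens X} {Φ Ψ : Eps → T.RO U} (hΦ : T.IsLocalizing U Φ)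
    (hΨ : T.IsLocalizing U Ψ) : T.IsLocalizing U (fun ε => Φ ε + Ψ ε) := by
  rw [isLocalizing_iff] at *
  intro V V₀ hV hV₀
  filter_upwards [hΦ V V₀ hV hV₀, hΨ V V₀ hV hV₀] with ε hΦε hΨε s hs
  rw [add_apply, map_add, hΦε s hs, hΨε s hs, add_zero]

/-- The nets `Φ` over `U` and `Ψ` over `V` agree on `W` for sections that agree near `W`. -/
def AgreeOn (U V W : Opens X) (Φ : Eps → T.RO U) (Ψ : Eps → T.RO V) : Prop :=
  ∀ (W' W₀ : Opens X) (_ : W' ≤ W) (h : CompactlyIn W' W₀) (hU : W₀ ≤ U) (hV : W₀ ≤ V),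
    ∀ᶠ ε in epsZero, ∀ (a : E.Sec U) (b : E.Sec V), E.res U W₀ hU a = E.res V W₀ hV b →
      F.res U W' (h.le.trans hU) (Φ ε a) = F.res V W' (h.le.trans hV) (Ψ ε b)

/-- The cutoffs that turn an operator over `U` into one over `V` without changing it on
`W ⋐ U ⊓ V`: `inner` is applied to the values of the operator and `outer` to its arguments. -/
structure Transfer (U V W : Opens X) where
  (W₁ N₁ N₂ : Opens X)
  inner : T.Cutoff W₁ V N₁
  outer : T.Cutoff (U ⊓ V) U N₂
  compactlyIn : CompactlyIn W W₁
  compactlyIn_inf : CompactlyIn W₁ (U ⊓ V)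
  le_one_inner : W ≤ N₁
  le_one_outer : W₁ ≤ N₂

theorem nonempty_transfer [T2Space X] [LocallyCompactSpace X] {U V W : Opens X}
    (hW : CompactlyIn W (U ⊓ V)) : Nonempty (T.Transfer U V W) := by
  obtain ⟨W₁, hWW₁, hW₁⟩ := hW.exists_between
  obtain ⟨N₁, hN₁, ⟨inner⟩⟩ :=
    T.exists_cutoff_of_isCompact (hW₁.le.trans inf_le_right) hWW₁.2 hWW₁.1
  obtain ⟨N₂, hN₂, ⟨outer⟩⟩ := T.exists_cutoff_of_isCompact (B := U) inf_le_left hW₁.2 hW₁.1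
  exact ⟨⟨W₁, N₁, N₂, inner, outer, hWW₁, hW₁, fun x hx => hN₁ (subset_closure hx),
    fun x hx => hN₂ (subset_closure hx)⟩⟩

namespace Transfer

variable {T} {U V W : Opens X} (τ : T.Transfer U V W)

theorem le_left : τ.W₁ ≤ U :=
  τ.compactlyIn_inf.le.trans inf_le_left

theorem le_right : τ.W₁ ≤ V :=
  τ.compactlyIn_inf.le.trans inf_le_right

/-- The operator over `V` obtained from an operator over `U` by means of the cutoffs. -/
noncomputable def transport (Φ : T.RO U) : T.RO V :=
  (τ.inner.truncF τ.le_left).comp (Φ.comp (τ.outer.truncE inf_le_right))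

/-- The part of an operator over `V` away from the set where the inner cutoff is `1`. -/
noncomputable def awayPart (Θ : T.RO V) : T.RO V :=
  Θ - (τ.inner.truncF τ.le_right).comp Θ

theorem isLocalizing_awayPart {Θ : Eps → T.RO V} (hΘ : T.IsLocalizing V Θ) :
    T.IsLocalizing V (fun ε => τ.awayPart (Θ ε)) := by
  rw [isLocalizing_iff] at *
  intro V₁ V₀ hV hV₀
  filter_upwards [hΘ V₁ V₀ hV hV₀] with ε hε s hs
  rw [awayPart, sub_apply, map_sub, hε s hs, ContinuousLinearMap.comp_apply,
    τ.inner.res_truncF_eq_zero τ.le_right _ (F.res_eq_zero_mono _ inf_le_left (hε s hs)), sub_zero]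

theorem res_awayPart (Θ : T.RO V) (s : E.Sec V) :
    F.res V τ.N₁ (τ.inner.subset.trans τ.inner.le) (τ.awayPart Θ s) = 0 := by
  rw [awayPart, sub_apply, map_sub, ContinuousLinearMap.comp_apply,
    τ.inner.res_truncF τ.le_right le_rfl, sub_self]

theorem isLocalizing_transport [T2Space X] [LocallyCompactSpace X] {Φ : Eps → T.RO U}
    (hΦ : T.IsLocalizing U Φ) : T.IsLocalizing V (fun ε => τ.transport (Φ ε)) := by
  rw [isLocalizing_iff] at *
  intro V₁ V₀ hV hV₀
  have hK : IsCompact (closure (V₁ : Set X) ∩ closure (τ.W₁ : Set X)) :=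
    hV.2.inter τ.compactlyIn_inf.2
  obtain ⟨A₀, hKA₀, hA₀⟩ := exists_compactlyIn_of_isCompact (U := V₀ ⊓ (U ⊓ V)) hK
    (Set.inter_subset_inter hV.1 τ.compactlyIn_inf.1)
  obtain ⟨A₁, hKA₁, hA₁⟩ := exists_compactlyIn_of_isCompact hK hKA₀
  have hA₀U : CompactlyIn A₀ U := hA₀.mono (inf_le_right.trans inf_le_left)
  filter_upwards [hΦ A₁ A₀ hA₁ hA₀U] with ε hε s hs
  have houter : E.res U A₀ hA₀U.le (τ.outer.truncE inf_le_right s) = 0 :=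
    τ.outer.res_truncE_eq_zero _ _
      (E.res_eq_zero_mono hV₀.le (inf_le_left.trans (hA₀.le.trans inf_le_left)) hs)
  have hV₁A₁ : V₁ ⊓ τ.W₁ ≤ A₁ := fun x hx => hKA₁ ⟨subset_closure hx.1, subset_closure hx.2⟩
  exact τ.inner.res_truncF_eq_zero τ.le_left _ (F.res_eq_zero_mono _ hV₁A₁ (hε _ houter))

theorem agreeOn_transport [T2Space X] [LocallyCompactSpace X] {Φ : Eps → T.RO U}
    (hΦ : T.IsLocalizing U Φ) : T.AgreeOn U V W Φ (fun ε => τ.transport (Φ ε)) := by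
  intro W' W₀ hW'W hW'W₀ hU hV
  obtain ⟨W₂, hW₂, hW₂'⟩ := exists_compactlyIn_of_isCompact (U := W₀ ⊓ τ.W₁) hW'W₀.2
    (Set.subset_inter hW'W₀.1 ((closure_mono hW'W).trans τ.compactlyIn.1))
  filter_upwards [T.isLocalizing_iff.1 hΦ W' W₂ ⟨hW₂, hW'W₀.2⟩
    (hW₂'.mono (inf_le_left.trans hU))] with ε hε a b hab
  have hargs : E.res U W₂ (hW₂'.le.trans (inf_le_left.trans hU))
      (a - τ.outer.truncE inf_le_right b) = 0 := by
    have hab₂ := congrArg (E.res W₀ W₂ (hW₂'.le.trans inf_le_left)) hab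
    rw [E.res_res_apply, E.res_res_apply] at hab₂
    rw [map_sub, hab₂, τ.outer.res_truncE inf_le_right
      (hW₂'.le.trans (inf_le_right.trans τ.le_one_outer)), sub_self]
  have hvalues := hε _ hargs
  rw [map_sub, map_sub, sub_eq_zero] at hvalues
  exact hvalues.trans (τ.inner.res_truncF τ.le_left (hW'W.trans τ.le_one_inner) _).symm

theorem isApproximation_transport {A D : Set (Eps → ℝ≥0)} {k : F.Sec U →L[ℂ] F.Sec U}
    {K : E.Sec U →L[ℂ] E.Sec U} {Φ : Eps → T.RO U} (hΦ : IsApproximation (T.incl U) A D k K Φ) :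
    IsApproximation (T.incl V) A D
      ((τ.inner.truncF τ.le_left).comp (k.comp (τ.outer.truncF inf_le_right)))
      ((τ.inner.truncE τ.le_left).comp (K.comp (τ.outer.truncE inf_le_right)))
      (fun ε => τ.transport (Φ ε)) :=
  hΦ.conj (τ.outer.incl_comp_truncF inf_le_right).symm (τ.inner.incl_comp_truncF τ.le_left)

theorem isApproximation_awayPart {A D : Set (Eps → ℝ≥0)} (hA : IsBoundClass (growthBound A))
    {k : F.Sec V →L[ℂ] F.Sec V} {K : E.Sec V →L[ℂ] E.Sec V} {Θ : Eps → T.RO V}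
    (hΘ : IsApproximation (T.incl V) A D k K Θ) :
    IsApproximation (T.incl V) A D (k - (τ.inner.truncF τ.le_right).comp k)
      (K - (τ.inner.truncE τ.le_right).comp K) (fun ε => τ.awayPart (Θ ε)) :=
  hΘ.sub hA (hΘ.conj (c := .id ℂ _) (C := .id ℂ _) rfl (τ.inner.incl_comp_truncF τ.le_right))

end Transfer

variable {T} in
theorem AgreeOn.add_of_res_eq_zero {U V W N : Opens X} {Φ : Eps → T.RO U} {Ψ Θ : Eps → T.RO V}
    (h : T.AgreeOn U V W Φ Ψ) (hWN : W ≤ N) (hNV : N ≤ V)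
    (hΘ : ∀ ε s, F.res V N hNV (Θ ε s) = 0) : T.AgreeOn U V W Φ (fun ε => Ψ ε + Θ ε) := by
  intro W' W₀ hW'W hW'W₀ hU hV
  filter_upwards [h W' W₀ hW'W hW'W₀ hU hV] with ε hε a b hab
  rw [hε a b hab, add_apply, map_add,
    F.res_eq_zero_mono hNV (hW'W.trans hWN) (hΘ ε b), add_zero]

section Exists

variable {A D : Set (Eps → ℝ≥0)} [T2Space X] [LocallyCompactSpace X] {U V W : Opens X}

theorem exists_mem_TOloc_agreeOn (hA : IsBoundClass (growthBound A))
    (hTO : (T.TOloc A D V).Nonempty) (hW : CompactlyIn W (U ⊓ V)) {Φ : Eps → T.RO U}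
    (hΦ : Φ ∈ T.TOloc A D U) : ∃ Φ' ∈ T.TOloc A D V, T.AgreeOn U V W Φ Φ' := by
  obtain ⟨τ⟩ := T.nonempty_transfer hW
  obtain ⟨Θ, hΘ, hΘl⟩ := hTO
  rw [isTestObject_iff_isApproximation hA] at hΘ
  have hΦa := (isTestObject_iff_isApproximation hA _ _).1 hΦ.1
  refine ⟨fun ε => τ.transport (Φ ε) + τ.awayPart (Θ ε), ⟨?_, ?_⟩, ?_⟩
  · rw [isTestObject_iff_isApproximation hA]
    convert (τ.isApproximation_transport hΦa).add hA (τ.isApproximation_awayPart hA hΘ) using 1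
    · rw [ContinuousLinearMap.id_comp, ContinuousLinearMap.comp_id,
        τ.inner.truncF_comp_truncF τ.outer inf_le_right τ.le_one_outer, add_sub_cancel]
    · rw [ContinuousLinearMap.id_comp, ContinuousLinearMap.comp_id,
        τ.inner.truncE_comp_truncE τ.outer inf_le_right τ.le_one_outer, add_sub_cancel]
  · exact (τ.isLocalizing_transport hΦ.2).add T (τ.isLocalizing_awayPart hΘl)
  · exact (τ.agreeOn_transport hΦ.2).add_of_res_eq_zero τ.le_one_inner _
      fun ε => τ.res_awayPart (Θ ε)

theorem exists_mem_TOzloc_agreeOn (hA : IsBoundClass (growthBound A))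
    (hW : CompactlyIn W (U ⊓ V)) {Ψ : Eps → T.RO U} (hΨ : Ψ ∈ T.TOzloc A D U) :
    ∃ Ψ' ∈ T.TOzloc A D V, T.AgreeOn U V W Ψ Ψ' := by
  obtain ⟨τ⟩ := T.nonempty_transfer hW
  refine ⟨fun ε => τ.transport (Ψ ε), ⟨?_, τ.isLocalizing_transport hΨ.2⟩,
    τ.agreeOn_transport hΨ.2⟩
  rw [isZeroTestObject_iff_isApproximation hA]
  have hΨa := (isZeroTestObject_iff_isApproximation hA _ _).1 hΨ.1
  simpa only [ContinuousLinearMap.zero_comp, ContinuousLinearMap.comp_zero]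
    using τ.isApproximation_transport hΨa

end Exists

end TestPair

/-! ### Local smooth maps and their restrictions -/

namespace TestPair

variable {E : LCSheaf.{u, v} X} {F : LCSheaf.{u, w} X} {T : TestPair E F}

namespace LocBasic

variable {U : Opens X}

theorem smooth (R : T.LocBasic U) : IsSmoothMap R.toFun :=
  (Subtype.property (p := fun R => R ∈ T.locSubmodule U) R).1

theorem isLocal (R : T.LocBasic U) : T.IsLocal U R.toFun :=
  (Subtype.property (p := fun R => R ∈ T.locSubmodule U) R).2

theorem res_toFun_congr (R : T.LocBasic U) {V : Opens X} (hVU : V ≤ U) {Φ₁ Φ₂ : T.RO U}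
    (h : ∀ s, F.res U V hVU (Φ₁ s) = F.res U V hVU (Φ₂ s)) :
    F.res U V hVU (R.toFun Φ₁) = F.res U V hVU (R.toFun Φ₂) :=
  R.isLocal V hVU Φ₁ Φ₂ (ContinuousLinearMap.ext h)

/-- The element of `LocBasic U` given by a smooth local map. -/
def ofMap (f : T.RO U → F.Sec U) (hf : IsSmoothMap f) (hf' : T.IsLocal U f) : T.LocBasic U :=
  Subtype.mk (p := fun R => R ∈ T.locSubmodule U) f ⟨hf, hf'⟩

theorem toFun_injective : Function.Injective (toFun : T.LocBasic U → T.RO U → F.Sec U) :=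
  Subtype.val_injective

theorem toFun_add (R S : T.LocBasic U) : (R + S).toFun = R.toFun + S.toFun := rfl

theorem toFun_smul (a : ℂ) (R : T.LocBasic U) : (a • R).toFun = a • R.toFun := rfl

theorem toFun_zero : (0 : T.LocBasic U).toFun = 0 := rfl

theorem exists_glue {ι : Type u} {c : ι → Opens X} (hc : ∀ i, c i ≤ U) (hU : U ≤ ⨆ i, c i)
    (f : ∀ i, T.RO U → F.Sec (c i)) (hf : ∀ i, IsSmoothMap (f i))
    (hf' : ∀ i (O : Opens X) (hO : O ≤ c i) (Φ₁ Φ₂ : T.RO U),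
      (∀ s, F.res U O (hO.trans (hc i)) (Φ₁ s) = F.res U O (hO.trans (hc i)) (Φ₂ s)) →
        F.res (c i) O hO (f i Φ₁) = F.res (c i) O hO (f i Φ₂))
    (hcompat : ∀ Φ i j, F.res (c i) (c i ⊓ c j) inf_le_left (f i Φ)
      = F.res (c j) (c i ⊓ c j) inf_le_right (f j Φ)) :
    ∃ S : T.LocBasic U, ∀ i Φ, F.res U (c i) (hc i) (S.toFun Φ) = f i Φ := by
  choose g hg using fun Φ : T.RO U =>
    F.isSheaf.glue U ι c hc hU (fun i => f i Φ) (hcompat Φ)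
  have hres : ∀ Φ i, F.res U (c i) (hc i) (g Φ) = f i Φ := hg
  refine ⟨ofMap g (F.isSmoothMap_of_cover hc hU fun i => ?_) fun O hO Φ₁ Φ₂ h => ?_,
    fun i Φ => hres Φ i⟩
  · simpa only [hres] using hf i
  · refine F.ext_of_locally fun x hx => ?_
    obtain ⟨i, hi⟩ := Opens.mem_iSup.1 (hU (hO hx))
    refine ⟨O ⊓ c i, inf_le_left, ⟨hx, hi⟩, ?_⟩
    have hO' : ∀ Φ, F.res O (O ⊓ c i) inf_le_left (F.res U O hO (g Φ))
        = F.res (c i) (O ⊓ c i) inf_le_right (f i Φ) := fun Φ => by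
      rw [← hres, F.res_res_apply, F.res_res_apply]
    rw [hO', hO']
    refine hf' i _ _ _ _ fun s => ?_
    rw [← F.res_res_apply hO inf_le_left, ← F.res_res_apply hO inf_le_left]
    exact congrArg (F.res O (O ⊓ c i) inf_le_left) (DFunLike.congr_fun h s)

end LocBasic

variable (T) in
/-- The linear map `Φ ↦ m ∘ Φ ∘ r` between spaces of regularization operators. -/
noncomputable def sandwich {U V : Opens X} (m : F.Sec U →L[ℂ] F.Sec V)
    (r : E.Sec V →L[ℂ] E.Sec U) : T.RO U →L[ℝ] T.RO V :=
  ((ContinuousLinearMap.precomp (F.Sec V) r).comp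
    (ContinuousLinearMap.postcomp (E.Sec U) m)).restrictScalars ℝ

theorem sandwich_apply {U V : Opens X} (m : F.Sec U →L[ℂ] F.Sec V)
    (r : E.Sec V →L[ℂ] E.Sec U) (Φ : T.RO U) (s : E.Sec V) :
    T.sandwich m r Φ s = m (Φ (r s)) := rfl

/-- The operator `Φ'` over `U` extends the operator `Φ` over `V ⊆ U` when values are only compared
on `W ⊆ V`. -/
def ExtendsOn {U V W : Opens X} (hVU : V ≤ U) (hWV : W ≤ V) (Φ : T.RO V) (Φ' : T.RO U) : Prop :=
  ∀ s : E.Sec U, F.res V W hWV (Φ (E.res U V hVU s)) = F.res U W (hWV.trans hVU) (Φ' s)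

section ExtendsOn

variable {U V W O : Opens X} {hVU : V ≤ U} {hWV : W ≤ V}

theorem isLocRestriction_iff {r : T.LocBasic U →ₗ[ℂ] T.LocBasic V} :
    T.IsLocRestriction U V hVU r ↔ ∀ (R : T.LocBasic U) (W : Opens X) (hW : CompactlyIn W V)
      (Φ : T.RO V) (Φ' : T.RO U), ExtendsOn hVU hW.le Φ Φ' →
        F.res V W hW.le ((r R).toFun Φ) = F.res U W (hW.le.trans hVU) (R.toFun Φ') :=
  forall₅_congr fun _ _ _ _ _ => imp_congr_left ContinuousLinearMap.ext_iff

theorem ExtendsOn.mono {Φ : T.RO V} {Φ' : T.RO U} (h : ExtendsOn hVU hWV Φ Φ') (hOW : O ≤ W) :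
    ExtendsOn hVU (hOW.trans hWV) Φ Φ' := fun s => by
  rw [← F.res_res_apply hWV hOW, h s, F.res_res_apply]

theorem ExtendsOn.trans {hOW : O ≤ W} {Φ : T.RO W} {Φ' : T.RO V} {Φ'' : T.RO U}
    (h : ExtendsOn hWV hOW Φ Φ') (h' : ExtendsOn hVU (hOW.trans hWV) Φ' Φ'') :
    ExtendsOn (hWV.trans hVU) hOW Φ Φ'' := fun s => by
  rw [← h' s, ← h, E.res_res_apply]

theorem ExtendsOn.res_toFun_eq (R : T.LocBasic U) {Φ₁ Φ₂ : T.RO V} {Φ₁' Φ₂' : T.RO U}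
    (h₁ : ExtendsOn hVU hWV Φ₁ Φ₁') (h₂ : ExtendsOn hVU hWV Φ₂ Φ₂')
    (h : ∀ s, F.res V W hWV (Φ₁ s) = F.res V W hWV (Φ₂ s)) :
    F.res U W (hWV.trans hVU) (R.toFun Φ₁') = F.res U W (hWV.trans hVU) (R.toFun Φ₂') :=
  R.res_toFun_congr _ fun s => (h₁ s).symm.trans ((h _).trans (h₂ s))

end ExtendsOn

section Restriction

variable [T2Space X]

variable (T) in
theorem exists_extension_operator {U V W : Opens X} (hVU : V ≤ U) (hW : CompactlyIn W V) :
    ∃ e : T.RO V →L[ℝ] T.RO U, ∀ Φ, ExtendsOn hVU hW.le Φ (e Φ) := by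
  obtain ⟨N, hN, ⟨c⟩⟩ := T.exists_cutoff_of_isCompact hVU hW.2 hW.1
  have hWN : W ≤ N := fun x hx => hN (subset_closure hx)
  refine ⟨T.sandwich c.mapF (E.res U V hVU), fun Φ s => ?_⟩
  rw [sandwich_apply, ← F.res_res_apply (c.subset.trans c.le) hWN, c.res_mapF, F.res_res_apply]

variable [LocallyCompactSpace X]

theorem le_iSup_compactlyIn (V : Opens X) : V ≤ ⨆ W : {W : Opens X // CompactlyIn W V}, W.1 := by
  intro x hx
  obtain ⟨W, hxW, hW⟩ := exists_compactlyIn_of_mem hx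
  exact Opens.mem_iSup.2 ⟨⟨W, hW⟩, hxW⟩

theorem IsLocRestriction.unique {U V : Opens X} {hVU : V ≤ U}
    {r r' : T.LocBasic U →ₗ[ℂ] T.LocBasic V} (hr : T.IsLocRestriction U V hVU r)
    (hr' : T.IsLocRestriction U V hVU r') : r = r' := by
  rw [isLocRestriction_iff] at hr hr'
  ext R
  refine LocBasic.toFun_injective (funext fun Φ => ?_)
  refine F.ext_of_cover (fun W => W.2.le) (le_iSup_compactlyIn V) fun W => ?_
  obtain ⟨e, he⟩ := T.exists_extension_operator hVU W.2
  rw [hr R W.1 W.2 Φ _ (he Φ), hr' R W.1 W.2 Φ _ (he Φ)]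

theorem LocBasic.exists_restriction {U V : Opens X} (hVU : V ≤ U)
    {e : {W : Opens X // CompactlyIn W V} → T.RO V →L[ℝ] T.RO U}
    (he : ∀ W Φ, ExtendsOn hVU W.2.le Φ (e W Φ)) (R : T.LocBasic U) :
    ∃ S : T.LocBasic V, ∀ (W : {W : Opens X // CompactlyIn W V}) Φ,
      F.res V W.1 W.2.le (S.toFun Φ) = F.res U W.1 (W.2.le.trans hVU) (R.toFun (e W Φ)) := by
  refine exists_glue (fun W => W.2.le) (le_iSup_compactlyIn V) _ (fun W => ?_)
    (fun W O hO Φ₁ Φ₂ h => ?_) fun Φ W W' => ?_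
  · exact (R.smooth.comp_clm (e W)).map ((F.res U W.1 (W.2.le.trans hVU)).restrictScalars ℝ)
  · rw [F.res_res_apply, F.res_res_apply]
    exact ((he W Φ₁).mono hO).res_toFun_eq R ((he W Φ₂).mono hO) h
  · rw [F.res_res_apply, F.res_res_apply]
    exact ((he W Φ).mono inf_le_left).res_toFun_eq R ((he W' Φ).mono inf_le_right) fun _ => rfl

variable (T) in
theorem exists_isLocRestriction {U V : Opens X} (hVU : V ≤ U) :
    ∃ r : T.LocBasic U →ₗ[ℂ] T.LocBasic V, T.IsLocRestriction U V hVU r := by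
  choose e he using fun W : {W : Opens X // CompactlyIn W V} =>
    T.exists_extension_operator hVU W.2
  choose r hr using LocBasic.exists_restriction hVU he
  have hext : ∀ S S' : T.LocBasic V, (∀ (W : {W : Opens X // CompactlyIn W V}) Φ,
      F.res V W.1 W.2.le (S.toFun Φ) = F.res V W.1 W.2.le (S'.toFun Φ)) → S = S' :=
    fun S S' h => LocBasic.toFun_injective (funext fun Φ =>
      F.ext_of_cover (fun W => W.2.le) (le_iSup_compactlyIn V) fun W => h W Φ)
  refine ⟨⟨⟨r, fun R S => hext _ _ fun W Φ => ?_⟩, fun a R => hext _ _ fun W Φ => ?_⟩,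
    isLocRestriction_iff.2 fun R W hW Φ Φ' h => ?_⟩
  · simp only [hr, LocBasic.toFun_add, Pi.add_apply, map_add]
  · simp only [hr, LocBasic.toFun_smul, Pi.smul_apply, map_smul, RingHom.id_apply]
  · exact (hr R ⟨W, hW⟩ Φ).trans ((he ⟨W, hW⟩ Φ).res_toFun_eq R h fun _ => rfl)

variable (T) in
/-- The restriction map of local smooth maps. -/
noncomputable def locRes (U V : Opens X) (hVU : V ≤ U) : T.LocBasic U →ₗ[ℂ] T.LocBasic V :=
  Classical.choose (T.exists_isLocRestriction hVU)

variable (T) in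
theorem isLocRestriction_locRes (U V : Opens X) (hVU : V ≤ U) :
    T.IsLocRestriction U V hVU (T.locRes U V hVU) :=
  Classical.choose_spec (T.exists_isLocRestriction hVU)

theorem ExtendsOn.res_locRes {U V W : Opens X} {hVU : V ≤ U} (hW : CompactlyIn W V)
    {Φ : T.RO V} {Φ' : T.RO U} (h : ExtendsOn hVU hW.le Φ Φ') (R : T.LocBasic U) :
    F.res V W hW.le ((T.locRes U V hVU R).toFun Φ)
      = F.res U W (hW.le.trans hVU) (R.toFun Φ') :=
  isLocRestriction_iff.1 (T.isLocRestriction_locRes U V hVU) R W hW Φ Φ' h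

theorem locRes_self (U : Opens X) : T.locRes U U le_rfl = LinearMap.id := by
  refine (T.isLocRestriction_locRes U U le_rfl).unique
    (isLocRestriction_iff.2 fun R W hW Φ Φ' h => R.res_toFun_congr _ fun s => ?_)
  rw [← h s, E.res_self_apply]

theorem locRes_locRes {U V W : Opens X} (hVU : V ≤ U) (hWV : W ≤ V) (R : T.LocBasic U) :
    T.locRes V W hWV (T.locRes U V hVU R) = T.locRes U W (hWV.trans hVU) R := by
  suffices h : (T.locRes V W hWV).comp (T.locRes U V hVU) = T.locRes U W (hWV.trans hVU) from
    LinearMap.congr_fun h R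
  refine IsLocRestriction.unique (hVU := hWV.trans hVU)
    (isLocRestriction_iff.2 fun R O hO Φ Φ' h => ?_) (T.isLocRestriction_locRes U W _)
  obtain ⟨e, he⟩ := T.exists_extension_operator hWV hO
  obtain ⟨e', he'⟩ := T.exists_extension_operator hVU (hO.mono hWV)
  rw [LinearMap.comp_apply, (he Φ).res_locRes hO, (he' (e Φ)).res_locRes (hO.mono hWV)]
  exact ((he Φ).trans (he' (e Φ))).res_toFun_eq R h fun _ => rfl

end Restriction

/-! ### Differentials along agreeing nets -/

section Agree

theorem AgreeOn.symm {U V W : Opens X} {Φ : Eps → T.RO U} {Ψ : Eps → T.RO V}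
    (h : T.AgreeOn U V W Φ Ψ) : T.AgreeOn V U W Ψ Φ :=
  fun W' W₀ hW' hW₀ hV hU => (h W' W₀ hW' hW₀ hU hV).mono fun _ hε a b hab => (hε b a hab.symm).symm

theorem AgreeOn.mono {U V W W' : Opens X} {Φ : Eps → T.RO U} {Ψ : Eps → T.RO V}
    (h : T.AgreeOn U V W Φ Ψ) (hW : W' ≤ W) : T.AgreeOn U V W' Φ Ψ :=
  fun O W₀ hO => h O W₀ (hO.trans hW)

theorem AgreeOn.eventually_affine {U V W : Opens X} {Φ : Eps → T.RO U} {Φ' : Eps → T.RO V} {l : ℕ}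
    {Ψ : Fin l → Eps → T.RO U} {Ψ' : Fin l → Eps → T.RO V} (hΦ : T.AgreeOn U V W Φ Φ')
    (hΨ : ∀ i, T.AgreeOn U V W (Ψ i) (Ψ' i)) {W₀ : Opens X}
    (h : CompactlyIn W W₀) (hU : W₀ ≤ U) (hV : W₀ ≤ V) :
    ∀ᶠ ε in epsZero, ∀ (t : Fin l → ℝ) (a : E.Sec U) (b : E.Sec V),
      E.res U W₀ hU a = E.res V W₀ hV b →
      F.res U W (h.le.trans hU) ((Φ ε + ∑ i, t i • Ψ i ε) a)
        = F.res V W (h.le.trans hV) ((Φ' ε + ∑ i, t i • Ψ' i ε) b) := by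
  filter_upwards [hΦ W W₀ le_rfl h hU hV,
    eventually_all.2 fun i => hΨ i W W₀ le_rfl h hU hV] with ε hΦε hΨε t a b hab
  have hsmul : ∀ (O : Opens X) (r : ℝ) (Θ : T.RO O) (s : E.Sec O), (r • Θ) s = (r : ℂ) • Θ s :=
    fun _ _ _ _ => rfl
  simp only [add_apply, sum_apply, map_add, map_sum, hsmul, map_smul, hΦε a b hab, hΨε _ a b hab]

theorem res_iterDifferential_eq {U V W : Opens X} (R : T.LocBasic U) (S : T.LocBasic V)
    (hU : W ≤ U) (hV : W ≤ V) {l : ℕ} {Φ : T.RO U} {Ψ : Fin l → T.RO U} {Φ' : T.RO V}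
    {Ψ' : Fin l → T.RO V}
    (h : ∀ t : Fin l → ℝ, F.res U W hU (R.toFun (Φ + ∑ i, t i • Ψ i))
      = F.res V W hV (S.toFun (Φ' + ∑ i, t i • Ψ' i))) :
    F.res U W hU (iterDifferential R.toFun l Φ Ψ)
      = F.res V W hV (iterDifferential S.toFun l Φ' Ψ') := by
  have hR := iterDifferential_map R.smooth ((F.res U W hU).restrictScalars ℝ) l Φ Ψ
  have hS := iterDifferential_map S.smooth ((F.res V W hV).restrictScalars ℝ) l Φ' Ψ'
  exact hR.symm.trans ((iterDifferential_congr h).trans hS)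

variable [T2Space X] [LocallyCompactSpace X]

theorem AgreeOn.eventually_iterDifferential_locRes {U V W : Opens X} (hVU : V ≤ U)
    (hW : CompactlyIn W V) (R : T.LocBasic U) {Φ : Eps → T.RO U} {Φ' : Eps → T.RO V} {l : ℕ}
    {Ψ : Fin l → Eps → T.RO U} {Ψ' : Fin l → Eps → T.RO V} (hΦ : T.AgreeOn U V W Φ Φ')
    (hΨ : ∀ i, T.AgreeOn U V W (Ψ i) (Ψ' i)) :
    ∀ᶠ ε in epsZero, F.res U W (hW.le.trans hVU)
        (iterDifferential R.toFun l (Φ ε) (fun i => Ψ i ε))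
      = F.res V W hW.le
        (iterDifferential (T.locRes U V hVU R).toFun l (Φ' ε) (fun i => Ψ' i ε)) := by
  filter_upwards [hΦ.eventually_affine hΨ hW hVU le_rfl] with ε hε
  refine res_iterDifferential_eq R _ _ _ fun t => (ExtendsOn.res_locRes hW (fun a => ?_) R).symm
  exact (hε t a (E.res U V hVU a) (E.res_self_apply _).symm).symm

theorem exists_testObjects_agreeOn {A D : Set (Eps → ℝ≥0)} (hA : IsBoundClass (growthBound A))
    {U V W : Opens X} (hTO : (T.TOloc A D V).Nonempty) (hW : CompactlyIn W (U ⊓ V))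
    {Φ : Eps → T.RO U} (hΦ : Φ ∈ T.TOloc A D U) {l : ℕ} {Ψ : Fin l → Eps → T.RO U}
    (hΨ : ∀ i, Ψ i ∈ T.TOzloc A D U) :
    ∃ Φ' ∈ T.TOloc A D V, ∃ Ψ' : Fin l → Eps → T.RO V, (∀ i, Ψ' i ∈ T.TOzloc A D V) ∧
      T.AgreeOn U V W Φ Φ' ∧ ∀ i, T.AgreeOn U V W (Ψ i) (Ψ' i) := by
  obtain ⟨Φ', hΦ', hΦΦ'⟩ := T.exists_mem_TOloc_agreeOn hA hTO hW hΦ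
  choose Ψ' hΨ' hΨΨ' using fun i => T.exists_mem_TOzloc_agreeOn hA hW (hΨ i)
  exact ⟨Φ', hΦ', Ψ', hΨ', hΦΦ', hΨΨ'⟩

end Agree

/-! ### Moderate and negligible maps -/

section Bound

variable (T) in
/-- All differentials of `R` along localizing test objects are bounded in the sense of `P`. This
notion covers moderate and negligible maps at the same time. -/
def IsBoundLoc (A D : Set (Eps → ℝ≥0)) (P : (Eps → ℝ) → Prop) (U : Opens X)
    (R : T.LocBasic U) : Prop :=
  ∀ l : ℕ, ∀ Φ ∈ T.TOloc A D U, ∀ Ψ : Fin l → Eps → T.RO U, (∀ i, Ψ i ∈ T.TOzloc A D U) →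
    NetBound P (fun ε => iterDifferential R.toFun l (Φ ε) (fun i => Ψ i ε))

variable {A D : Set (Eps → ℝ≥0)} {P : (Eps → ℝ) → Prop} {U : Opens X}

theorem isModerateLoc_iff {R : T.LocBasic U} :
    T.IsModerateLoc A D U R ↔ T.IsBoundLoc A D (growthBound A) U R :=
  ⟨fun h l Φ hΦ Ψ hΨ p hp => h p hp l Φ hΦ Ψ hΨ, fun h p hp l Φ hΦ Ψ hΨ => h l Φ hΦ Ψ hΨ p hp⟩

theorem isNegligibleLoc_iff {R : T.LocBasic U} :
    T.IsNegligibleLoc A D U R ↔ T.IsBoundLoc A D (decayBound D) U R :=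
  ⟨fun h l Φ hΦ Ψ hΨ p hp => h p hp l Φ hΦ Ψ hΨ, fun h p hp l Φ hΦ Ψ hΨ => h l Φ hΦ Ψ hΨ p hp⟩

theorem IsBoundLoc.mono {Q : (Eps → ℝ) → Prop} {R : T.LocBasic U} (h : T.IsBoundLoc A D P U R)
    (hPQ : ∀ f, P f → Q f) : T.IsBoundLoc A D Q U R :=
  fun l Φ hΦ Ψ hΨ => (h l Φ hΦ Ψ hΨ).mono hPQ

variable (T A D) in
/-- The subspace of maps whose differentials along test objects are bounded in the sense of `P`. -/
def boundSubmodule (hP : IsBoundClass P) (U : Opens X) : Submodule ℂ (T.LocBasic U) where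
  carrier := {R | T.IsBoundLoc A D P U R}
  zero_mem' := fun l Φ _ Ψ _ => by
    simp only [LocBasic.toFun_zero, iterDifferential_zero]
    exact NetBound.zero hP
  add_mem' := fun {R S} hR hS l Φ hΦ Ψ hΨ => by
    simp only [LocBasic.toFun_add, iterDifferential_add R.smooth S.smooth]
    exact (hR l Φ hΦ Ψ hΨ).add hP (hS l Φ hΦ Ψ hΨ)
  smul_mem' := fun a R hR l Φ hΦ Ψ hΨ => by
    simp only [LocBasic.toFun_smul, iterDifferential_smul R.smooth]
    exact (hR l Φ hΦ Ψ hΨ).smul hP a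

variable [T2Space X] [LocallyCompactSpace X]

theorem IsBoundLoc.locRes (hP : IsBoundClass P) (hA : IsBoundClass (growthBound A))
    (hTO : (T.TOloc A D U).Nonempty) {V : Opens X} (hVU : V ≤ U)
    {R : T.LocBasic U} (hR : T.IsBoundLoc A D P U R) :
    T.IsBoundLoc A D P V (T.locRes U V hVU R) := by
  intro l Φ hΦ Ψ hΨ
  refine F.netBound_of_locally hP fun x hx => ?_
  obtain ⟨W, hxW, hW⟩ := exists_compactlyIn_of_mem hx
  obtain ⟨Φ', hΦ', Ψ', hΨ', hΦΦ', hΨΨ'⟩ :=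
    exists_testObjects_agreeOn hA hTO (hW.mono (le_inf le_rfl hVU)) hΦ hΨ
  exact ⟨W, hW.le, hxW, ((hR l Φ' hΦ' Ψ' hΨ').map (F.res U W (hW.le.trans hVU))).congr hP
    (hΦΦ'.symm.eventually_iterDifferential_locRes hVU hW R fun i => (hΨΨ' i).symm)⟩

theorem isBoundLoc_of_cover (hP : IsBoundClass P) (hA : IsBoundClass (growthBound A))
    {ι : Type*} {c : ι → Opens X} (hTO : ∀ i, (T.TOloc A D (c i)).Nonempty)
    (hc : ∀ i, c i ≤ U) (hU : U ≤ ⨆ i, c i) {R : T.LocBasic U}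
    (hR : ∀ i, T.IsBoundLoc A D P (c i) (T.locRes U (c i) (hc i) R)) :
    T.IsBoundLoc A D P U R := by
  intro l Φ hΦ Ψ hΨ
  refine F.netBound_of_locally hP fun x hx => ?_
  obtain ⟨i, hi⟩ := Opens.mem_iSup.1 (hU hx)
  obtain ⟨W, hxW, hW⟩ := exists_compactlyIn_of_mem hi
  obtain ⟨Φ', hΦ', Ψ', hΨ', hΦΦ', hΨΨ'⟩ :=
    exists_testObjects_agreeOn hA (hTO i) (hW.mono (le_inf (hc i) le_rfl)) hΦ hΨ
  exact ⟨W, hW.le.trans (hc i), hxW,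
    ((hR i l Φ' hΦ' Ψ' hΨ').map (F.res (c i) W hW.le)).congr hP
      ((hΦΦ'.eventually_iterDifferential_locRes (hc i) hW R hΨΨ').mono fun _ => Eq.symm)⟩

end Bound

end TestPair

/-! ### Gluing of local smooth maps -/

namespace TestPair

variable {E : LCSheaf.{u, v} X} {F : LCSheaf.{u, w} X} {T : TestPair E F}

namespace LocBasic

variable {U C : Opens X} {ι : Type u}

theorem iterDifferential_toFun_sub (R S : T.LocBasic U) (l : ℕ) (Φ : T.RO U)
    (Ψ : Fin l → T.RO U) : iterDifferential (R - S).toFun l Φ Ψ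
      = iterDifferential R.toFun l Φ Ψ - iterDifferential S.toFun l Φ Ψ := by
  rw [sub_eq_add_neg R S, ← neg_one_smul ℂ S, toFun_add,
    iterDifferential_add R.smooth (smooth ((-1 : ℂ) • S)), toFun_smul,
    iterDifferential_smul S.smooth, neg_one_smul, sub_eq_add_neg]

theorem exists_locallyFinite_sum (g : ι → T.LocBasic U) (Z : ι → Opens X)
    (hg : ∀ i (V : Opens X) (hV : V ≤ U), V ≤ Z i → ∀ Φ, F.res U V hV ((g i).toFun Φ) = 0)
    (hfin : ∀ x ∈ U, ∃ V ≤ U, x ∈ V ∧ ∃ J : Finset ι, ∀ i ∉ J, V ≤ Z i) :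
    ∃ S : T.LocBasic U, ∀ (V : Opens X) (hV : V ≤ U) (J : Finset ι), (∀ i ∉ J, V ≤ Z i) →
      ∀ Φ, F.res U V hV (S.toFun Φ) = ∑ i ∈ J, F.res U V hV ((g i).toFun Φ) := by
  classical
  have hsub : ∀ (V : Opens X) (hV : V ≤ U) (J J' : Finset ι), (∀ i ∉ J, V ≤ Z i) →
      (∀ i ∉ J', V ≤ Z i) → ∀ Φ,
      ∑ i ∈ J, F.res U V hV ((g i).toFun Φ) = ∑ i ∈ J', F.res U V hV ((g i).toFun Φ) := by
    intro V hV J J' hJ hJ' Φ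
    rw [Finset.sum_subset (Finset.subset_union_left : J ⊆ J ∪ J')
        fun i _ hi => hg i V hV (hJ i hi) Φ,
      Finset.sum_subset (Finset.subset_union_right : J' ⊆ J ∪ J')
        fun i _ hi => hg i V hV (hJ' i hi) Φ]
  let κ : Type u := {V : Opens X // V ≤ U ∧ ∃ J : Finset ι, ∀ i ∉ J, V ≤ Z i}
  choose J hJ using fun V : κ => V.2.2
  have hκ : U ≤ ⨆ V : κ, V.1 := fun x hx => by
    obtain ⟨V, hVU, hxV, hV⟩ := hfin x hx
    exact Opens.mem_iSup.2 ⟨⟨V, hVU, hV⟩, hxV⟩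
  refine (exists_glue (T := T) (c := Subtype.val) (fun V : κ => V.2.1) hκ
    (fun V Φ => ∑ i ∈ J V, F.res U V.1 V.2.1 ((g i).toFun Φ)) (fun V => ?_)
    (fun V O hO Φ₁ Φ₂ h => ?_) fun Φ V V' => ?_).imp fun S hS V hV J' hJ' Φ =>
      (hS ⟨V, hV, J', hJ'⟩ Φ).trans (hsub V hV _ _ (hJ _) hJ' Φ)
  · convert IsSmoothMap.sum (J V) fun i _ =>
      (g i).smooth.map ((F.res U V.1 V.2.1).restrictScalars ℝ) using 1
    funext Φ
    rw [Finset.sum_apply]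
    rfl
  · simp only [map_sum, F.res_res_apply, (g _).res_toFun_congr (hO.trans V.2.1) h]
  · simp only [map_sum, F.res_res_apply]
    exact hsub _ _ _ _ (fun i hi => inf_le_left.trans (hJ V i hi))
      (fun i hi => inf_le_right.trans (hJ V' i hi)) Φ

/-- The local smooth map `Φ ↦ θ (R (res ∘ Φ ∘ e))` over `U` obtained from a local smooth map `R`
over `C`, a sheaf endomorphism `θ` with support in `C` and an extension operator `e`. -/
noncomputable def spread (R : T.LocBasic C) (hC : C ≤ U) (θ : SheafEnd F U)
    (hθ : U ≤ C ⊔ θ.zeroSet) (e : E.Sec C →L[ℂ] E.Sec U) : T.LocBasic U :=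
  ofMap (fun Φ => θ.extend le_rfl hθ (R.toFun (T.sandwich (F.res U C hC) e Φ)))
    ((R.smooth.comp_clm (T.sandwich (F.res U C hC) e)).map
      ((θ.extend le_rfl hθ).restrictScalars ℝ))
    fun O hO Φ₁ Φ₂ h => by
      rw [← sub_eq_zero, ← map_sub, ← map_sub]
      refine SheafEnd.res_extend_eq_zero_of_inf hO ?_
      rw [map_sub, sub_eq_zero]
      refine R.res_toFun_congr _ fun s => ?_
      rw [sandwich_apply, sandwich_apply, F.res_res_apply, F.res_res_apply,
        ← F.res_res_apply hO inf_le_left, ← F.res_res_apply hO inf_le_left]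
      exact congrArg (F.res O (O ⊓ C) inf_le_left) (DFunLike.congr_fun h (e s))

theorem iterDifferential_spread (R : T.LocBasic C) (hC : C ≤ U) {θ : SheafEnd F U}
    (hθ : U ≤ C ⊔ θ.zeroSet) (e : E.Sec C →L[ℂ] E.Sec U) (l : ℕ) (Φ : T.RO U)
    (Ψ : Fin l → T.RO U) :
    iterDifferential (R.spread hC θ hθ e).toFun l Φ Ψ
      = θ.extend le_rfl hθ (iterDifferential R.toFun l (T.sandwich (F.res U C hC) e Φ)
          fun i => T.sandwich (F.res U C hC) e (Ψ i)) :=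
  (iterDifferential_map (R.smooth.comp_clm (T.sandwich (F.res U C hC) e))
    ((θ.extend le_rfl hθ).restrictScalars ℝ) l Φ Ψ).trans
      (congrArg (θ.extend le_rfl hθ)
        (iterDifferential_comp_linearMap R.toFun (T.sandwich (F.res U C hC) e).toLinearMap l Φ Ψ))

theorem res_iterDifferential_eq_sum {W : Opens X} (hW : W ≤ U) {S : T.LocBasic U} {J : Finset ι}
    {g : ι → T.LocBasic U}
    (h : ∀ Φ, F.res U W hW (S.toFun Φ) = ∑ i ∈ J, F.res U W hW ((g i).toFun Φ)) (l : ℕ)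
    (Φ : T.RO U) (Ψ : Fin l → T.RO U) : F.res U W hW (iterDifferential S.toFun l Φ Ψ)
      = ∑ i ∈ J, F.res U W hW (iterDifferential (g i).toFun l Φ Ψ) := by
  have hres : ∀ R : T.LocBasic U, F.res U W hW (iterDifferential R.toFun l Φ Ψ)
      = iterDifferential (fun Φ => F.res U W hW (R.toFun Φ)) l Φ Ψ := fun R =>
    (iterDifferential_map R.smooth ((F.res U W hW).restrictScalars ℝ) l Φ Ψ).symm
  simp only [hres]
  refine (iterDifferential_congr fun t => ?_).trans (iterDifferential_sum J
    (fun i _ => (g i).smooth.map ((F.res U W hW).restrictScalars ℝ)) l Φ Ψ)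
  rw [h, Finset.sum_apply]
  rfl

end LocBasic

variable (T) in
/-- A partition of unity `θ` of `F|_U` subordinate to `c`, together with cutoffs in the members of
`c` that are `1` on the supports of the `θ i`. Local finiteness and the sum condition are expressed
by a common neighbourhood `V` of each point, on which only the `θ i` with `i ∈ J` are nonzero. -/
structure Patching (U : Opens X) {ι : Type u} (c : ι → Opens X) where
  θ : ι → SheafEnd F U
  N : ι → Opens X
  cutoff : ∀ i, T.Cutoff (c i) U (N i)
  le_sup : ∀ i, U ≤ N i ⊔ (θ i).zeroSet
  exists_finset : ∀ x ∈ U, ∃ (V : Opens X) (hVU : V ≤ U), x ∈ V ∧ ∃ J : Finset ι,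
    (∀ i ∉ J, V ≤ (θ i).zeroSet) ∧
      ∀ (W : Opens X) (hW : W ≤ V) (s : F.Sec W), ∑ i ∈ J, (θ i).map W (hW.trans hVU) s = s

variable (T) in
theorem nonempty_patching {U : Opens X} {ι : Type u} {c : ι → Opens X} (hc : ∀ i, c i ≤ U)
    (hU : U ≤ ⨆ i, c i) : Nonempty (T.Patching U c) := by
  obtain ⟨η, hη, hsupp, hfin, hsum⟩ := T.partition U ι c hc hU
  choose θ hθ using hη
  have hzero : ∀ i, (η i).zeroSet ≤ (θ i).zeroSet := fun i => Restricts.zeroSet_le (hθ i)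
  choose N hN e using fun i => T.exists_cutoff (hc i)
    (fun x hx => ((η i).mem_zeroSet_iff.1 hx).1) ((η i).le_sup_zeroSet (hsupp i))
  refine ⟨⟨θ, N, fun i => (e i).some, fun i => (hN i).trans (sup_le_sup_left (hzero i) _),
    fun x hx => ?_⟩⟩
  obtain ⟨V, hxV, hV⟩ := hfin x hx
  have hdisj : ∀ i ∉ hV.toFinset, Disjoint (η i).supp (V : Set X) := fun i hi => by
    rw [Set.disjoint_iff_inter_eq_empty, ← Set.not_nonempty_iff_eq_empty]
    exact fun h => hi (hV.mem_toFinset.2 h)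
  refine ⟨U ⊓ V, inf_le_left, ⟨hx, hxV⟩, hV.toFinset, fun i hi => ?_, fun W hW s => ?_⟩
  · exact ((η i).le_zeroSet_of_disjoint inf_le_left
      ((hdisj i hi).mono_right Set.inter_subset_right)).trans (hzero i)
  · apply T.incl_injective
    simp only [map_sum, hθ]
    exact hsum W (hW.trans inf_le_left) _
      (fun i hi => (hdisj i hi).mono_right (hW.trans inf_le_right)) _

namespace Patching

variable {U : Opens X} {ι : Type u} {c : ι → Opens X} (π : T.Patching U c)

theorem le_sup_zeroSet (i : ι) : U ≤ c i ⊔ (π.θ i).zeroSet :=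
  (π.le_sup i).trans (sup_le_sup_right (π.cutoff i).subset _)

theorem exists_sum_spread (R : ∀ i, T.LocBasic (c i)) :
    ∃ S : T.LocBasic U, ∀ (W : Opens X) (hW : W ≤ U) (J : Finset ι),
      (∀ i ∉ J, W ≤ (π.θ i).zeroSet) → ∀ Φ, F.res U W hW (S.toFun Φ) = ∑ i ∈ J, F.res U W hW
        (((R i).spread (π.cutoff i).le (π.θ i) (π.le_sup_zeroSet i) (π.cutoff i).mapE).toFun Φ) :=
  LocBasic.exists_locallyFinite_sum _ (fun i => (π.θ i).zeroSet)
    (fun _ _ hV h _ => SheafEnd.res_extend_zero _ hV h) fun x hx => by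
      obtain ⟨V, hVU, hxV, J, hJ, -⟩ := π.exists_finset x hx
      exact ⟨V, hVU, hxV, J, hJ⟩

theorem sum_extend_res {J : Finset ι} {B W : Opens X} (hWB : W ≤ B) (hWU : W ≤ U)
    {W₁ : ι → Opens X} (hW₁ : ∀ i, W₁ i ≤ B) (hWW₁ : ∀ i, W ≤ W₁ i ⊔ (π.θ i).zeroSet)
    (hJ : ∀ s : F.Sec W, ∑ i ∈ J, (π.θ i).map W hWU s = s) (r : F.Sec B) :
    ∑ i ∈ J, (π.θ i).extend hWU (hWW₁ i) (F.res B (W₁ i) (hW₁ i) r) = F.res B W hWB r :=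
  (Finset.sum_congr rfl fun i _ => (SheafEnd.map_eq_extend hWB (hW₁ i) rfl).symm).trans
    (hJ (F.res B W hWB r))

end Patching

namespace Cutoff

variable {A D : Set (Eps → ℝ≥0)} {P : (Eps → ℝ) → Prop} {U B C N W : Opens X} (e : T.Cutoff C U N)

theorem eventually_extendsOn_sandwich (hB : B ≤ U) (hW : CompactlyIn W (N ⊓ B)) {l : ℕ}
    {Φ : Eps → T.RO B} {Φ' : Eps → T.RO U} {Θ : Eps → T.RO (C ⊓ B)} {Ψ : Fin l → Eps → T.RO B}
    {Ψ' : Fin l → Eps → T.RO U} {Ξ : Fin l → Eps → T.RO (C ⊓ B)}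
    (hΦ : T.AgreeOn B U W Φ Φ') (hΨ : ∀ i, T.AgreeOn B U W (Ψ i) (Ψ' i))
    (hΘ : T.AgreeOn B (C ⊓ B) W Φ Θ) (hΞ : ∀ i, T.AgreeOn B (C ⊓ B) W (Ψ i) (Ξ i)) :
    ∀ᶠ ε in epsZero, ∀ t : Fin l → ℝ,
      ExtendsOn inf_le_left (hW.le.trans (inf_le_inf_right B e.subset))
        (Θ ε + ∑ i, t i • Ξ i ε)
        (T.sandwich (F.res U C e.le) e.mapE (Φ' ε)
          + ∑ i, t i • T.sandwich (F.res U C e.le) e.mapE (Ψ' i ε)) := by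
  filter_upwards [hΦ.eventually_affine hΨ (hW.mono inf_le_right) le_rfl hB,
    hΘ.eventually_affine hΞ hW inf_le_right (inf_le_inf_right B e.subset)] with ε hU hC t s
  have hcut : E.res B (N ⊓ B) inf_le_right (E.res U B hB (e.mapE s))
      = E.res (C ⊓ B) (N ⊓ B) (inf_le_inf_right B e.subset)
        (E.res C (C ⊓ B) inf_le_left s) := by
    rw [E.res_res_apply, E.res_res_apply, ← E.res_res_apply (e.subset.trans e.le) inf_le_left,
      e.res_mapE, E.res_res_apply]
  have hlin : T.sandwich (F.res U C e.le) e.mapE (Φ' ε)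
      + ∑ i, t i • T.sandwich (F.res U C e.le) e.mapE (Ψ' i ε)
      = T.sandwich (F.res U C e.le) e.mapE (Φ' ε + ∑ i, t i • Ψ' i ε) := by
    simp only [map_add, map_sum, map_smul]
  rw [hlin, sandwich_apply, F.res_res_apply, ← hC t _ _ hcut]
  exact hU t _ _ (E.res_self_apply _)

variable [T2Space X] [LocallyCompactSpace X]

theorem netBound_res_iterDifferential_sub (hP : IsBoundClass P)
    (hA : IsBoundClass (growthBound A)) (hTO : (T.TOloc A D (C ⊓ B)).Nonempty) (hB : B ≤ U)
    (hW : CompactlyIn W (N ⊓ B)) {R : T.LocBasic C} {S : T.LocBasic B}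
    (hRS : T.IsBoundLoc A D P (C ⊓ B)
      (T.locRes C (C ⊓ B) inf_le_left R - T.locRes B (C ⊓ B) inf_le_right S)) {l : ℕ}
    {Φ : Eps → T.RO B} {Φ' : Eps → T.RO U} {Ψ : Fin l → Eps → T.RO B}
    {Ψ' : Fin l → Eps → T.RO U} (hΦ : Φ ∈ T.TOloc A D B) (hΨ : ∀ i, Ψ i ∈ T.TOzloc A D B)
    (hΦΦ' : T.AgreeOn B U W Φ Φ') (hΨΨ' : ∀ i, T.AgreeOn B U W (Ψ i) (Ψ' i)) :
    NetBound P fun ε => F.res C W (hW.le.trans (inf_le_left.trans e.subset))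
        (iterDifferential R.toFun l (T.sandwich (F.res U C e.le) e.mapE (Φ' ε))
          fun i => T.sandwich (F.res U C e.le) e.mapE (Ψ' i ε))
      - F.res B W (hW.le.trans inf_le_right)
        (iterDifferential S.toFun l (Φ ε) fun i => Ψ i ε) := by
  have hWCB : CompactlyIn W (C ⊓ B) := hW.mono (inf_le_inf_right B e.subset)
  obtain ⟨Θ, hΘ, Ξ, hΞ, hΦΘ, hΨΞ⟩ :=
    exists_testObjects_agreeOn hA hTO (hWCB.mono (le_inf inf_le_right le_rfl)) hΦ hΨ
  refine ((hRS l Θ hΘ Ξ hΞ).map (F.res (C ⊓ B) W hWCB.le)).congr hP ?_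
  filter_upwards [hΦΘ.eventually_iterDifferential_locRes inf_le_right hWCB S hΨΞ,
    e.eventually_extendsOn_sandwich hB hW hΦΦ' hΨΨ' hΦΘ hΨΞ] with ε hS hR
  rw [LocBasic.iterDifferential_toFun_sub, map_sub, hS]
  congr 1
  exact res_iterDifferential_eq _ R _ _ fun t => (hR t).res_locRes hWCB R

end Cutoff

theorem exists_glue_locBasic [T2Space X] [LocallyCompactSpace X] {A D : Set (Eps → ℝ≥0)}
    {P : (Eps → ℝ) → Prop} (hP : IsBoundClass P) (hA : IsBoundClass (growthBound A))
    (hTO : ∀ U : Opens X, (T.TOloc A D U).Nonempty) {U : Opens X} {ι : Type u} {c : ι → Opens X}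
    (hc : ∀ i, c i ≤ U) (hU : U ≤ ⨆ i, c i) (R : ∀ i, T.LocBasic (c i))
    (hR : ∀ i j, T.IsBoundLoc A D P (c i ⊓ c j)
      (T.locRes (c i) (c i ⊓ c j) inf_le_left (R i)
        - T.locRes (c j) (c i ⊓ c j) inf_le_right (R j))) :
    ∃ S : T.LocBasic U, ∀ j, T.IsBoundLoc A D P (c j) (T.locRes U (c j) (hc j) S - R j) := by
  obtain ⟨π⟩ := T.nonempty_patching hc hU
  obtain ⟨S, hS⟩ := π.exists_sum_spread R
  refine ⟨S, fun j l Φ hΦ Ψ hΨ => F.netBound_of_locally hP fun x hx => ?_⟩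
  obtain ⟨V, hVU, hxV, J, hJ, hsum⟩ := π.exists_finset x (hc j hx)
  obtain ⟨W, hxW, hW⟩ := exists_compactlyIn_of_mem (U := c j ⊓ V) (x := x) ⟨hx, hxV⟩
  have hWj : CompactlyIn W (c j) := hW.mono inf_le_left
  have hWV : W ≤ V := hW.le.trans inf_le_right
  choose W₁ hW₁ hWW₁ using fun i => hWj.exists_le_sup ((hc j).trans (π.le_sup i))
  have hW₁i : ∀ i, W₁ i ≤ c i := fun i => (hW₁ i).le.trans (inf_le_left.trans (π.cutoff i).subset)
  have hW₁j : ∀ i, CompactlyIn (W₁ i) (c j) := fun i => (hW₁ i).mono inf_le_right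
  obtain ⟨Φ', -, Ψ', -, hΦΦ', hΨΨ'⟩ := exists_testObjects_agreeOn hA (hTO U)
    ((hWj.sup (CompactlyIn.finset_sup fun i (_ : i ∈ J) => hW₁j i)).mono (le_inf le_rfl (hc j)))
    hΦ hΨ
  refine ⟨W, hWj.le, hxW, (NetBound.sum hP J fun i hi =>
    ((π.cutoff i).netBound_res_iterDifferential_sub hP hA (hTO _) (hc j) (hW₁ i) (hR i j) hΦ hΨ
      (hΦΦ'.mono (le_sup_of_le_right (Finset.le_sup hi)))
      fun k => (hΨΨ' k).mono (le_sup_of_le_right (Finset.le_sup hi))).map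
    ((π.θ i).extend (hWV.trans hVU) (hWW₁ i))).congr hP ?_⟩
  filter_upwards [(hΦΦ'.mono le_sup_left).symm.eventually_iterDifferential_locRes (hc j) hWj S
    fun k => ((hΨΨ' k).mono le_sup_left).symm] with ε hε
  rw [LocBasic.iterDifferential_toFun_sub, map_sub, ← hε,
    LocBasic.res_iterDifferential_eq_sum _ (hS W (hWV.trans hVU) J fun i hi => hWV.trans (hJ i hi)),
    ← π.sum_extend_res hWj.le (hWV.trans hVU) (fun i => (hW₁j i).le) hWW₁ (hsum W hWV),
    ← Finset.sum_sub_distrib]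
  refine Finset.sum_congr rfl fun i _ => ?_
  rw [LocBasic.iterDifferential_spread, SheafEnd.res_extend_res _ (hW₁i i) (hWW₁ i), map_sub]

end TestPair

/-! ### Quotients of presheaves -/

theorem isVectorSheaf_quotient {S : Opens X → Type v} [∀ U, AddCommGroup (S U)]
    [∀ U, Module ℂ (S U)] (res : ∀ U V : Opens X, V ≤ U → (S U →ₗ[ℂ] S V))
    (res_self : ∀ U s, res U U le_rfl s = s)
    (res_res : ∀ (U V W : Opens X) (hVU : V ≤ U) (hWV : W ≤ V) (s : S U),
      res V W hWV (res U V hVU s) = res U W (hWV.trans hVU) s)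
    {M N : ∀ U, Submodule ℂ (S U)} (hNM : ∀ U, N U ≤ M U)
    (hM : ∀ U V h, ∀ s ∈ M U, res U V h s ∈ M V) (hN : ∀ U V h, ∀ s ∈ N U, res U V h s ∈ N V)
    (hMloc : ∀ (U : Opens X) (ι : Type u) (c : ι → Opens X) (hc : ∀ i, c i ≤ U),
      U ≤ ⨆ i, c i → ∀ s : S U, (∀ i, res U (c i) (hc i) s ∈ M (c i)) → s ∈ M U)
    (hNloc : ∀ (U : Opens X) (ι : Type u) (c : ι → Opens X) (hc : ∀ i, c i ≤ U),
      U ≤ ⨆ i, c i → ∀ s : S U, (∀ i, res U (c i) (hc i) s ∈ N (c i)) → s ∈ N U)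
    (hglue : ∀ (U : Opens X) (ι : Type u) (c : ι → Opens X) (hc : ∀ i, c i ≤ U),
      U ≤ ⨆ i, c i → ∀ s : ∀ i, S (c i),
        (∀ i j, res (c i) (c i ⊓ c j) inf_le_left (s i)
          - res (c j) (c i ⊓ c j) inf_le_right (s j) ∈ N (c i ⊓ c j)) →
        ∃ t : S U, ∀ i, res U (c i) (hc i) t - s i ∈ N (c i)) :
    IsVectorSheaf (fun U => M U ⧸ (N U).submoduleOf (M U)) fun U V h =>
      Submodule.mapQ _ _ ((res U V h).restrict (hM U V h)) fun s hs => hN U V h s hs where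
  res_self U s := by
    obtain ⟨s, rfl⟩ := Submodule.Quotient.mk_surjective _ s
    exact congrArg Submodule.Quotient.mk (Subtype.ext (res_self U s))
  res_res U V W hVU hWV s := by
    obtain ⟨s, rfl⟩ := Submodule.Quotient.mk_surjective _ s
    exact congrArg Submodule.Quotient.mk (Subtype.ext (res_res U V W hVU hWV s))
  separated U ι c hc hU s hs := by
    obtain ⟨s, rfl⟩ := Submodule.Quotient.mk_surjective _ s
    exact (Submodule.Quotient.mk_eq_zero _).2
      (hNloc U ι c hc hU s fun i =>
        (Submodule.Quotient.mk_eq_zero ((N (c i)).submoduleOf (M (c i)))).1 (hs i))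
  glue U ι c hc hU s hs := by
    choose r hr using fun i => Submodule.Quotient.mk_surjective _ (s i)
    obtain rfl : (fun i => Submodule.Quotient.mk (r i)) = s := funext hr
    obtain ⟨t, ht⟩ := hglue U ι c hc hU (fun i => (r i).1) fun i j =>
      (Submodule.Quotient.eq ((N (c i ⊓ c j)).submoduleOf (M (c i ⊓ c j)))).1 (hs i j)
    have htM : t ∈ M U := hMloc U ι c hc hU t fun i => by
      simpa only [sub_add_cancel] using add_mem (hNM _ (ht i)) (r i).2
    exact ⟨Submodule.Quotient.mk ⟨t, htM⟩, fun i => (Submodule.Quotient.eq _).2 (ht i)⟩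

/-! ### The sheaf of generalized functions -/

theorem mainTheorem3_general [T2Space X] [LocallyCompactSpace X] (E : LCSheaf.{u, v} X)
    (F : LCSheaf.{u, w} X) (T : TestPair E F) (A D : Set (Eps → ℝ≥0))
    (hadd : ∀ l ∈ A, ∀ m ∈ A, ∃ n ∈ A, BigO (fun ε => l ε + m ε) n)
    (hcmp : ∃ l ∈ A, ∃ m ∈ D, BigO m l) (hTO : ∀ U : Opens X, (T.TOloc A D U).Nonempty) :
    ∃ M N : ∀ U : Opens X, Submodule ℂ (T.LocBasic U),
      (∀ U R, R ∈ M U ↔ T.IsModerateLoc A D U R) ∧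
      (∀ U R, R ∈ N U ↔ T.IsNegligibleLoc A D U R) ∧
      (∀ U, N U ≤ M U) ∧
      ∃ ρ : ∀ U V : Opens X, V ≤ U → (T.LocBasic U →ₗ[ℂ] T.LocBasic V),
        (∀ U V h, T.IsLocRestriction U V h (ρ U V h)) ∧
        (∀ U V h r, T.IsLocRestriction U V h r → r = ρ U V h) ∧
        ∃ ρG : ∀ U V : Opens X, V ≤ U →
            ((M U ⧸ (N U).submoduleOf (M U)) →ₗ[ℂ] (M V ⧸ (N V).submoduleOf (M V))),
          (∀ U V h (R : M U), ∃ hR : ρ U V h R ∈ M V,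
            ρG U V h (Submodule.Quotient.mk R) = Submodule.Quotient.mk ⟨ρ U V h R, hR⟩) ∧
          IsVectorSheaf (fun U => M U ⧸ (N U).submoduleOf (M U)) ρG := by
  have hA : IsBoundClass (growthBound A) := isBoundClass_growthBound (hcmp.imp fun _ h => h.1) hadd
  have hD := isBoundClass_decayBound D
  have hNM : ∀ U, T.boundSubmodule A D hD U ≤ T.boundSubmodule A D hA U :=
    fun U R hR => TestPair.IsBoundLoc.mono hR fun _ => growthBound_of_decayBound hcmp
  have hM : ∀ U V h, ∀ R ∈ T.boundSubmodule A D hA U,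
      T.locRes U V h R ∈ T.boundSubmodule A D hA V :=
    fun U V h R hR => TestPair.IsBoundLoc.locRes hA hA (hTO U) h hR
  have hN : ∀ U V h, ∀ R ∈ T.boundSubmodule A D hD U,
      T.locRes U V h R ∈ T.boundSubmodule A D hD V :=
    fun U V h R hR => TestPair.IsBoundLoc.locRes hD hA (hTO U) h hR
  exact ⟨T.boundSubmodule A D hA, T.boundSubmodule A D hD,
    fun U R => TestPair.isModerateLoc_iff.symm, fun U R => TestPair.isNegligibleLoc_iff.symm, hNM,
    T.locRes, T.isLocRestriction_locRes,
    fun U V h r hr => hr.unique (T.isLocRestriction_locRes U V h),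
    _, fun U V h R => ⟨hM U V h R R.2, rfl⟩,
    isVectorSheaf_quotient T.locRes (fun U => LinearMap.congr_fun (TestPair.locRes_self U))
      (fun _ _ _ => TestPair.locRes_locRes) hNM hM hN
      (fun _ _ _ hc hU _ => TestPair.isBoundLoc_of_cover hA hA (fun _ => hTO _) hc hU)
      (fun _ _ _ hc hU _ => TestPair.isBoundLoc_of_cover hD hA (fun _ => hTO _) hc hU)
      fun _ _ _ => TestPair.exists_glue_locBasic hD hA hTO⟩

end NonlinearExt

theorem mainTheorem3 {X : Type u} [TopologicalSpace X] [T2Space X] [LocallyCompactSpace X]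
    [ParacompactSpace X] (E : NonlinearExt.LCSheaf.{u, v} X) (F : NonlinearExt.LCSheaf.{u, w} X)
    (T : NonlinearExt.TestPair E F) (A D : Set (NonlinearExt.Eps → ℝ≥0))
    (hAD : NonlinearExt.IsAdmissible A D) (hTO : ∀ U : Opens X, (T.TOloc A D U).Nonempty) :
    -- the moderate and the negligible local smooth maps form subspaces `N U ≤ M U`
    ∃ M N : ∀ U : Opens X, Submodule ℂ (T.LocBasic U),
      (∀ U R, R ∈ M U ↔ T.IsModerateLoc A D U R) ∧
      (∀ U R, R ∈ N U ↔ T.IsNegligibleLoc A D U R) ∧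
      (∀ U, N U ≤ M U) ∧
      -- the restriction maps of local smooth maps exist and are unique
      ∃ ρ : ∀ U V : Opens X, V ≤ U → (T.LocBasic U →ₗ[ℂ] T.LocBasic V),
        (∀ U V h, T.IsLocRestriction U V h (ρ U V h)) ∧
        (∀ U V h r, T.IsLocRestriction U V h r → r = ρ U V h) ∧
        -- they induce restriction maps `[R] ↦ [ρ R]` on the quotients `M U / N U`
        ∃ ρG : ∀ U V : Opens X, V ≤ U →
            ((M U ⧸ (N U).submoduleOf (M U)) →ₗ[ℂ] (M V ⧸ (N V).submoduleOf (M V))),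
          (∀ U V h (R : M U), ∃ hR : ρ U V h R ∈ M V,
            ρG U V h (Submodule.Quotient.mk R) = Submodule.Quotient.mk ⟨ρ U V h R, hR⟩) ∧
          -- with which `U ↦ M U / N U` is a sheaf
          NonlinearExt.IsVectorSheaf (fun U => M U ⧸ (N U).submoduleOf (M U)) ρG := by
  exact NonlinearExt.mainTheorem3_general E F T A D hAD.growth.add hAD.compare hTO
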